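/- **Corollary (Saturation agrees with oplax base change, i.e. relative Hofmann–Streicher lifting, over the point).** *Notation.* For a category $B$, let $\mathbf{CAT}/B$ be the strict $2$-category of displayed categories over $B$: objects are categories $X$ equipped with a functor $X\to B$, $1$-cells are functors commuting strictly with the functors to $B$, and $2$-cells are natural transformations with components over identities. Let $\mathbf{FIB}_B$ be the $2$-category of (Grothendieck) fibrations over $B$, functors over $B$ preserving cartesian arrows, and natural transformations with components over identities, and let $U_B\colon\mathbf{FIB}_B\to\mathbf{CAT}/B$ be the forgetful $2$-functor. For $b\in B$ let $y_B(b)$ be the slice $B/b$ with its discrete fibration $B/b\to B$; for $f\colon b\to b'$ let $y_B(f)\colon B/b\to B/b'$ be postcomposition with $f$. * For a functor $h\colon P\to Q$, $\Sigma_h\colon\mathbf{CAT}/P\to\mathbf{CAT}/Q$ is postcomposition with $h$, and $h^*\colon\mathbf{CAT}/Q\to\mathbf{CAT}/P$ is base change: the objects of $h^*X$ are pairs of $a\in P$ and an object of $X$ lying over $h(a)$, and the arrows are pairs of arrows compatible in the same way. * The co-free fibration $N_B(X)$ on $X\in\mathbf{CAT}/B$ has as objects over $b$ the functors $y_B(b)\to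 X$ over $B$, and as arrows over $f\colon b\to b'$ from $s$ to $t$ the $2$-cells $s\Rightarrow t\circ y_B(f)$. This gives a $2$-functor $N_B\colon\mathbf{CAT}/B\to\mathbf{FIB}_B$, acting on $1$-cells by postcomposition and on $2$-cells by whiskering. Its counit $\varepsilon_X\colon U_BN_B(X)\to X$ is evaluation at $\mathrm{id}_b$. * For a fibration $h\colon P\to Q$, oplax base change (relative Hofmann–Streicher lifting) is the $2$-functor $\Delta_h\colon\mathbf{FIB}_Q\to\mathbf{FIB}_P$ for which the objects of $\Delta_h(E)$ over $a\in P$ are the fibred functors $(P/a\to P\xrightarrow{h}Q)\to E$ over $Q$, and the arrows over $f\colon a\to a'$ from $s$ to $t$ are the $2$-cells $s\Rightarrow t\circ y_P(f)$. It acts by postcomposition and whiskering. Write $\mathbf 1$ for the terminal category and $!_C\colon C\to\mathbf 1$ for the unique functor; a category $E$ is regarded as a fibration over $\mathbf 1$. Two $2$-functors are called *equivalent*, written $\simeq$, if there is a pseudonatural transformation between them all of whose components are equivalences in the target $2$-category. *Statement.* 1. (Co-free fibrations.) For every category $P$, every $F\in\mathbf{FIB}_P$ and every $X\in\mathbf{CAT}/P$,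 composition with $\varepsilon_X$ is an equivalence of categories $$\mathbf{FIB}_P(F,N_P(X))\simeq(\mathbf{CAT}/P)(U_P(F),X).$$ 2. (Saturation pseudo-adjunction.) For every functor $h\colon P\to Q$, every $F\in\mathbf{FIB}_P$ and every $X\in\mathbf{CAT}/Q$, transposition along the counits (evaluation at identities, followed by the projection $\Sigma_hh^*X\to X$) is an equivalence of categories $$\mathbf{FIB}_P(F,N_P(h^*X))\simeq(\mathbf{CAT}/Q)(\Sigma_h(U_P(F)),X).$$ 3. (Factorisation.) For every fibration $h\colon P\to Q$, the $2$-functors $N_P\circ h^*$ and $\Delta_h\circ N_Q$ from $\mathbf{CAT}/Q$ to $\mathbf{FIB}_P$ are equivalent. 4. (The point.) The $2$-functor $U_{\mathbf 1}\circ N_{\mathbf 1}$ is equivalent to the identity of $\mathbf{CAT}/\mathbf 1$; in particular $N_{\mathbf 1}(X)\simeq X$. 5. (Saturation agrees with oplax base change over the point.) For every category $C$, there is an equivalence $$N_C\bigl((!_C)^*(E)\bigr)\simeq\Delta_{!_C}(E)$$ in $\mathbf{FIB}_C$ for every category $E$, and it is pseudonatural in $E$. -/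

import Mathlib

open CategoryTheory Bicategory

universe v₄ u₄ v₃ u₃ v₂ u₂ v₁ u₁ v u

set_option linter.checkUnivs false
set_option linter.unusedVariables false
attribute [-instance] catToReflQuiver

namespace HSLift

section Basics

variable {A : Type u} [Category.{v} A] {B : Type u₁} [Category.{v₁} B]

/-! ### Displayed and fibred categories

`BasedCategory B` is the strict `2`-category `CAT/B` of displayed categories over `B`: a category with
a functor to `B`, functors commuting with the displays, and vertical natural transformations. -/

/-- A functor over `B` preserves cartesian arrows. -/
def PreservesCartesian {X : BasedCategory.{v₂, u₂} B} {Y : BasedCategory.{v₃, u₃} B}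
    (F : BasedFunctor X Y) : Prop :=
  ∀ ⦃R S : B⦄ (f : R ⟶ S) ⦃a b : X.obj⦄ (φ : a ⟶ b),
    X.p.IsCartesian f φ → Y.p.IsCartesian f (F.map φ)

/-- Fibred categories over `B`. -/
structure FibCat (B : Type u₁) [Category.{v₁} B] where
  toBased : BasedCategory.{v₂, u₂} B
  isFibered : toBased.p.IsFibered

/-- Fibred functors over `B`: functors over `B` preserving cartesian arrows. -/
structure FibFunctor (E : FibCat.{v₂, u₂} B) (F : FibCat.{v₃, u₃} B) where
  toBased : BasedFunctor E.toBased F.toBased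
  cart : PreservesCartesian toBased

/-- Composition of fibred functors. -/
def FibFunctor.comp {E : FibCat.{v₂, u₂} B} {F : FibCat.{v₃, u₃} B} {G : FibCat.{v₄, u₄} B}
    (f : FibFunctor E F) (g : FibFunctor F G) : FibFunctor E G where
  toBased := f.toBased.comp g.toBased
  cart _ _ _ _ _ _ h := g.cart _ _ (f.cart _ _ h)

/-- Natural transformations of fibred functors: the vertical natural transformations. -/
instance (E : FibCat.{v₂, u₂} B) (F : FibCat.{v₃, u₃} B) : Category (FibFunctor E F) where
  Hom f g := f.toBased ⟶ g.toBased
  id f := 𝟙 f.toBased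
  comp α β := BasedNatTrans.comp α β
  id_comp α := Category.id_comp (obj := BasedFunctor _ _) α
  comp_id α := Category.comp_id (obj := BasedFunctor _ _) α
  assoc α β γ := Category.assoc (obj := BasedFunctor _ _) α β γ

/-- An isomorphism of underlying functors is an isomorphism of fibred functors. -/
def BasedNatIso.toFib {E : FibCat.{v₂, u₂} B} {F : FibCat.{v₃, u₃} B} {f g : FibFunctor E F}
    (e : f.toBased ≅ g.toBased) : f ≅ g where
  hom := e.hom
  inv := e.inv
  hom_inv_id := e.hom_inv_id
  inv_hom_id := e.inv_hom_id

/-- The `2`-category of fibred categories over `B`. -/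
instance : Bicategory (FibCat.{v₂, u₂} B) where
  Hom E F := FibFunctor E F
  id E := ⟨BasedFunctor.id _, fun _ _ _ _ _ _ h => h⟩
  comp F G := F.comp G
  homCategory E F := inferInstance
  whiskerLeft f _ _ α := BasedCategory.whiskerLeft f.toBased α
  whiskerRight α h := BasedCategory.whiskerRight α h.toBased
  associator f g h := BasedNatIso.toFib (BasedNatIso.id ((f.toBased.comp g.toBased).comp h.toBased))
  leftUnitor f := BasedNatIso.toFib (BasedNatIso.id f.toBased)
  rightUnitor f := BasedNatIso.toFib (BasedNatIso.id f.toBased)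
  whiskerLeft_id f g := Bicategory.whiskerLeft_id (B := BasedCategory B) f.toBased g.toBased
  whiskerLeft_comp f _ _ _ α β := Bicategory.whiskerLeft_comp (B := BasedCategory B) f.toBased α β
  id_whiskerLeft α := Bicategory.id_whiskerLeft (B := BasedCategory B) α
  comp_whiskerLeft f g _ _ α := Bicategory.comp_whiskerLeft (B := BasedCategory B) f.toBased g.toBased α
  id_whiskerRight f g := Bicategory.id_whiskerRight (B := BasedCategory B) f.toBased g.toBased
  comp_whiskerRight α β h := Bicategory.comp_whiskerRight (B := BasedCategory B) α β h.toBased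
  whiskerRight_id α := Bicategory.whiskerRight_id (B := BasedCategory B) α
  whiskerRight_comp α f g := Bicategory.whiskerRight_comp (B := BasedCategory B) α f.toBased g.toBased
  whisker_assoc f _ _ α g := Bicategory.whisker_assoc (B := BasedCategory B) f.toBased α g.toBased
  whisker_exchange α β := Bicategory.whisker_exchange (B := BasedCategory B) α β
  pentagon f g h i := Bicategory.pentagon (B := BasedCategory B) f.toBased g.toBased h.toBased i.toBased
  triangle f g := Bicategory.triangle (B := BasedCategory B) f.toBased g.toBased


theorem toCart {𝒳 : Type u₂} [Category.{v₂} 𝒳] {p : 𝒳 ⥤ B} {R S : B} {f : R ⟶ S} {a b : 𝒳}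
    {φ : a ⟶ b} (h : p.IsStronglyCartesian f φ) : p.IsCartesian f φ :=
  inferInstance

theorem toStrong {𝒳 : Type u₂} [Category.{v₂} 𝒳] {p : 𝒳 ⥤ B} (hp : p.IsFibered) {R S : B}
    {f : R ⟶ S} {a b : 𝒳} {φ : a ⟶ b} (h : p.IsCartesian f φ) : p.IsStronglyCartesian f φ :=
  inferInstance

/-- A functor over `B` preserves cartesian arrows as soon as it preserves enough cartesian lifts. -/
theorem PreservesCartesian.of_lifts {X : BasedCategory.{v₂, u₂} B} {Y : BasedCategory.{v₃, u₃} B}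
    (F : BasedFunctor X Y)
    (h : ∀ (b : X.obj) (R : B) (f : R ⟶ X.p.obj b), ∃ (a : X.obj) (φ : a ⟶ b),
      X.p.IsCartesian f φ ∧ Y.p.IsCartesian f (F.map φ)) : PreservesCartesian F := by
  intro R S f a b φ hφ
  have hS : X.p.obj b = S := IsHomLift.codomain_eq X.p f φ
  subst hS
  obtain ⟨a', φ', h₁, h₂⟩ := h b R f
  let e := Functor.IsCartesian.domainUniqueUpToIso X.p f φ' φ
  have he : e.hom ≫ φ' = φ := Functor.IsCartesian.fac X.p f φ' φ
  have : Y.p.IsHomLift (𝟙 R) (F.toFunctor.mapIso e).hom :=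
    inferInstanceAs (Y.p.IsHomLift (𝟙 R) (F.map e.hom))
  have h₃ := Functor.IsCartesian.of_iso_comp Y.p f (F.map φ') (F.toFunctor.mapIso e)
  have h₄ : (F.toFunctor.mapIso e).hom ≫ F.map φ' = F.map φ := by
    rw [← he, F.map_comp]
    rfl
  rwa [h₄] at h₃

theorem isHomLift_comp {𝒳 : Type u₂} [Category.{v₂} 𝒳] (q : 𝒳 ⥤ A) (p : A ⥤ B) {a b : A} {R S : B}
    (g : R ⟶ S) (f : a ⟶ b) {x y : 𝒳} (φ : x ⟶ y) (hf : p.IsHomLift g f) (h : q.IsHomLift f φ) :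
    (q ⋙ p).IsHomLift g φ := by
  obtain ⟨⟩ := h
  obtain ⟨⟩ := hf
  exact IsHomLift.map (q ⋙ p) φ

/-- Cartesian lifts along a composite are computed successively. -/
theorem isStronglyCartesian_comp {𝒳 : Type u₂} [Category.{v₂} 𝒳] (q : 𝒳 ⥤ A) (p : A ⥤ B)
    {a b : A} {R S : B} (g : R ⟶ S) (f : a ⟶ b) {x y : 𝒳} (φ : x ⟶ y)
    (hf : p.IsStronglyCartesian g f) (h : q.IsStronglyCartesian f φ) :
    (q ⋙ p).IsStronglyCartesian g φ := by
  have := isHomLift_comp q p g f φ inferInstance inferInstance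
  constructor
  intro z k ψ hψ
  have hb : q.obj y = b := IsHomLift.codomain_eq q f φ
  subst hb
  have : p.IsHomLift (k ≫ g) (q.map ψ) := by
    have e := IsHomLift.fac (q ⋙ p) (k ≫ g) ψ
    exact IsHomLift.of_fac p _ _ rfl (IsHomLift.codomain_eq (q ⋙ p) (k ≫ g) ψ) e
  let k' : q.obj z ⟶ a := Functor.IsStronglyCartesian.map p g f (g := k) rfl (q.map ψ)
  have hk' : k' ≫ f = q.map ψ := Functor.IsStronglyCartesian.fac p g f rfl (q.map ψ)
  refine ⟨Functor.IsStronglyCartesian.map q f φ hk'.symm ψ, ⟨?_, ?_⟩, ?_⟩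
  · exact isHomLift_comp q p k k' _ inferInstance inferInstance
  · exact Functor.IsStronglyCartesian.fac q f φ hk'.symm ψ
  · rintro χ ⟨h₁, h₂⟩
    have ha : q.obj x = a := IsHomLift.domain_eq q f φ
    subst ha
    have : q.IsHomLift k' χ := by
      have : k' = q.map χ := by
        symm
        have : p.IsHomLift k (q.map χ) := by
          have e := IsHomLift.fac (q ⋙ p) k χ
          exact IsHomLift.of_fac p _ _ rfl (IsHomLift.codomain_eq (q ⋙ p) k χ) e
        apply Functor.IsStronglyCartesian.map_uniq p g f rfl (q.map ψ)
        rw [← h₂, q.map_comp, IsHomLift.eq_of_isHomLift q f φ]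
      rw [this]
      infer_instance
    exact Functor.IsStronglyCartesian.map_uniq q f φ hk'.symm ψ χ h₂

/-- A composite of fibrations is a fibration. -/
theorem isFibered_comp {𝒳 : Type u₂} [Category.{v₂} 𝒳] (q : 𝒳 ⥤ A) (p : A ⥤ B)
    (hq : q.IsFibered) (hp : p.IsFibered) : (q ⋙ p).IsFibered := by
  refine Functor.IsFibered.of_exists_isStronglyCartesian fun x R f => ?_
  obtain ⟨a, g, hg⟩ := Functor.IsPreFibered.exists_isCartesian' (p := p) (a := q.obj x) f
  obtain ⟨y, φ, hφ⟩ := Functor.IsPreFibered.exists_isCartesian' (p := q) (a := x) g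
  exact ⟨y, φ, isStronglyCartesian_comp q p f g φ inferInstance inferInstance⟩

/-- The sum of a displayed category along `p`, by postcomposition. -/
abbrev sumBased (p : A ⥤ B) (X : BasedCategory.{v₂, u₂} A) : BasedCategory.{v₂, u₂} B :=
  BasedCategory.ofFunctor (X.p ⋙ p)

/-- The sum along `p` on `1`-cells. -/
def sumFunctor (p : A ⥤ B) {X : BasedCategory.{v₂, u₂} A} {Y : BasedCategory.{v₃, u₃} A}
    (F : BasedFunctor X Y) : BasedFunctor (sumBased p X) (sumBased p Y) where
  toFunctor := F.toFunctor
  w := by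
    change F.toFunctor ⋙ (Y.p ⋙ p) = X.p ⋙ p
    rw [← Functor.assoc, F.w]

/-- The sum along `p` on `2`-cells. -/
def sumTrans (p : A ⥤ B) {X : BasedCategory.{v₂, u₂} A} {Y : BasedCategory.{v₃, u₃} A}
    {F G : BasedFunctor X Y} (α : F ⟶ G) : sumFunctor p F ⟶ sumFunctor p G :=
  ({ toNatTrans := α.toNatTrans
     isHomLift' := fun x => by
      have := isHomLift_comp Y.p p _ _ _ (IsHomLift.map p _) (α.isHomLift' x)
      rwa [p.map_id] at this } : BasedNatTrans (sumFunctor p F) (sumFunctor p G))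

/-- The discrete fibration `A/a → A` represented by `a`. -/
abbrev yoBased (a : A) : BasedCategory.{v, max u v} A := BasedCategory.ofFunctor (Over.forget a)

/-- Postcomposition `A/a → A/b` with `f : a ⟶ b`. -/
def yoMap {a b : A} (f : a ⟶ b) : BasedFunctor (yoBased a) (yoBased b) where
  toFunctor := Over.map f
  w := rfl

/-- The arrow `x ⟶ x` of `A/a`, with identity underlying arrow. -/
def overId {a : A} (x : Over a) : x ⟶ (Over.map (𝟙 a)).obj x := Over.homMk (𝟙 x.left) (by simp)

/-- The comparison, with identity underlying arrow, of postcomposition with a composite. -/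
def overComp {a b c : A} (f : a ⟶ b) (g : b ⟶ c) (x : Over a) :
    (Over.map g).obj ((Over.map f).obj x) ⟶ (Over.map (f ≫ g)).obj x :=
  Over.homMk (𝟙 x.left) (by simp)

/-- The canonical `2`-cell, with identity components, from the identity to postcomposition with the
identity. -/
def yoMapId (a : A) : BasedFunctor.id (yoBased a) ⟶ yoMap (𝟙 a) :=
  ({ app := fun x : Over a => overId x
     naturality := fun x y f => Over.OverMorphism.ext
      ((Category.comp_id f.left).trans (Category.id_comp f.left).symm)
     isHomLift' := fun x => IsHomLift.map (Over.forget a) (overId x) } :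
    BasedNatTrans (BasedFunctor.id (yoBased a)) (yoMap (𝟙 a)))

/-- The canonical `2`-cell, with identity components, between the two ways of postcomposing with
a composite. -/
def yoMapComp {a b c : A} (f : a ⟶ b) (g : b ⟶ c) :
    (yoMap f).comp (yoMap g) ⟶ yoMap (f ≫ g) :=
  ({ app := fun x : Over a => overComp f g x
     naturality := fun x y k => Over.OverMorphism.ext
      ((Category.comp_id k.left).trans (Category.id_comp k.left).symm)
     isHomLift' := fun x => IsHomLift.map (Over.forget c) (overComp f g x) } :
    BasedNatTrans ((yoMap f).comp (yoMap g)) (yoMap (f ≫ g)))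

theorem yo_isStronglyCartesian {c : A} {x y : Over c} (f : x ⟶ y) {R S : A} (g : R ⟶ S)
    (h : (Over.forget c).IsHomLift g f) : (Over.forget c).IsStronglyCartesian g f := by
  obtain ⟨⟩ := h
  constructor
  intro (z : Over c) (k : z.left ⟶ x.left) ψ hψ
  have e : k ≫ f.left = ψ.left :=
    @IsHomLift.eq_of_isHomLift _ _ _ _ (Over.forget c) z y _ ψ hψ
  have w : k ≫ x.hom = z.hom := by
    rw [← Over.w ψ, ← e, Category.assoc, Over.w]
  refine ⟨Over.homMk k w, ⟨?_, ?_⟩, ?_⟩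
  · exact IsHomLift.map (Over.forget c) (Over.homMk k w)
  · ext
    exact e
  · rintro χ ⟨h₁, -⟩
    ext
    exact (IsHomLift.eq_of_isHomLift (p := Over.forget c) (a := z) (b := x) k χ).symm

/-- The cartesian lifts in `A/a`. -/
def yoLift {a : A} (x : Over a) {b : A} (f : b ⟶ x.left) : Over.mk (f ≫ x.hom) ⟶ x :=
  Over.homMk f rfl

/-- The fibred category `A/a → A` represented by `a`. -/
def yo (a : A) : FibCat.{v, max u v} A where
  toBased := yoBased a
  isFibered := Functor.IsFibered.of_exists_isStronglyCartesian fun (x : Over a) _ f =>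
    ⟨Over.mk (f ≫ x.hom), yoLift x f,
      yo_isStronglyCartesian _ _ (IsHomLift.map (Over.forget a) (yoLift x f))⟩

theorem yoMap_cart {a b : A} (f : a ⟶ b) : PreservesCartesian (yoMap f) :=
  PreservesCartesian.of_lifts _ fun (x : Over a) R g => by
    refine ⟨Over.mk (g ≫ x.hom), yoLift x g, ?_, ?_⟩
    · exact toCart (yo_isStronglyCartesian _ _ (IsHomLift.map (Over.forget a) (yoLift x g)))
    · exact toCart (yo_isStronglyCartesian _ _
        (IsHomLift.map (Over.forget b) ((Over.map f).map (yoLift x g))))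

/-- The fibred functor `A/a → A/b` given by postcomposition with `f : a ⟶ b`. -/
def yoFib {a b : A} (f : a ⟶ b) : FibFunctor (yo a) (yo b) where
  toBased := yoMap f
  cart := yoMap_cart f

/-- The oplax sum along a fibration `p`, computed by postcomposition with `p`. -/
def oplaxSum (p : A ⥤ B) [hp : p.IsFibered] (E : FibCat.{v₂, u₂} A) : FibCat.{v₂, u₂} B where
  toBased := sumBased p E.toBased
  isFibered := isFibered_comp E.toBased.p p E.isFibered hp

/-- The oplax sum along a fibration on `1`-cells. -/
def oplaxSumFunctor (p : A ⥤ B) [hp : p.IsFibered] {E : FibCat.{v₂, u₂} A} {F : FibCat.{v₃, u₃} A}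
    (f : FibFunctor E F) : FibFunctor (oplaxSum p E) (oplaxSum p F) where
  toBased := sumFunctor p f.toBased
  cart := PreservesCartesian.of_lifts _ fun (x : E.toBased.obj) R g => by
    have := E.isFibered
    obtain ⟨a, k, hk⟩ := Functor.IsPreFibered.exists_isCartesian' (p := p)
      (a := E.toBased.p.obj x) g
    obtain ⟨y, φ, hφ⟩ := Functor.IsPreFibered.exists_isCartesian' (p := E.toBased.p) (a := x) k
    exact ⟨y, φ,
      toCart (isStronglyCartesian_comp E.toBased.p p g k φ (toStrong hp hk)
        (toStrong E.isFibered hφ)),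
      toCart (isStronglyCartesian_comp F.toBased.p p g k (f.toBased.map φ) (toStrong hp hk)
        (toStrong F.isFibered (f.cart _ _ hφ)))⟩

/-- The inverse of `overComp`. -/
def overCompInv {a b c : A} (f : a ⟶ b) (g : b ⟶ c) (x : Over a) :
    (Over.map (f ≫ g)).obj x ⟶ (Over.map g).obj ((Over.map f).obj x) :=
  Over.homMk (𝟙 x.left) (by simp)

/-- The inverse of `yoMapComp`. -/
def yoMapCompInv {a b c : A} (f : a ⟶ b) (g : b ⟶ c) :
    yoMap (f ≫ g) ⟶ (yoMap f).comp (yoMap g) :=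
  ({ app := fun x : Over a => overCompInv f g x
     naturality := fun x y k => Over.OverMorphism.ext
      ((Category.comp_id k.left).trans (Category.id_comp k.left).symm)
     isHomLift' := fun x => IsHomLift.map (Over.forget c) (overCompInv f g x) } :
    BasedNatTrans (yoMap (f ≫ g)) ((yoMap f).comp (yoMap g)))

/-! ### Sections -/

/-- A pair of an object `base` of `A` and a functor over `B` to `X` from `A/base`, displayed over `B`
by postcomposition with `p`. -/
structure Sec (p : A ⥤ B) (X : BasedCategory.{v₂, u₂} B) where
  base : A
  sec : BasedFunctor (sumBased p (yoBased base)) X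

/-- An arrow from `s` to `t`: an arrow `base` of `A` and a vertical natural transformation from `s` to
the restriction of `t` along `A/base`. -/
structure Sec.Hom {p : A ⥤ B} {X : BasedCategory.{v₂, u₂} B} (s t : Sec p X) where
  base : s.base ⟶ t.base
  trans : s.sec ⟶ (sumFunctor p (yoMap base)).comp t.sec

section
variable {p : A ⥤ B} {X : BasedCategory.{v₂, u₂} B}

instance : CategoryStruct (Sec p X) where
  Hom s t := Sec.Hom s t
  id s := ⟨𝟙 s.base, BasedCategory.whiskerRight (sumTrans p (yoMapId s.base)) s.sec⟩
  comp {_ _ r} α β := ⟨α.base ≫ β.base,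
    α.trans ≫ BasedCategory.whiskerLeft (sumFunctor p (yoMap α.base)) β.trans ≫
      BasedCategory.whiskerRight (sumTrans p (yoMapComp α.base β.base)) r.sec⟩

/-- The value of a section at an object of the slice. -/
def Sec.val (s : Sec p X) (x : Over s.base) : X.obj := s.sec.obj x

/-- The functorial action of a section. -/
def Sec.act (s : Sec p X) {x y : Over s.base} (f : x ⟶ y) : s.val x ⟶ s.val y := s.sec.map f

/-- The components of an arrow of sections. -/
def Sec.app {s t : Sec p X} (α : s ⟶ t) (x : Over s.base) :
    s.val x ⟶ t.val ((Over.map (Sec.Hom.base α)).obj x) :=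
  α.trans.toNatTrans.app x

@[simp]
theorem Sec.act_id (s : Sec p X) (x : Over s.base) : s.act (𝟙 x) = 𝟙 (s.val x) := s.sec.map_id x

@[simp]
theorem Sec.act_comp (s : Sec p X) {x y z : Over s.base} (f : x ⟶ y) (g : y ⟶ z) :
    s.act f ≫ s.act g = s.act (f ≫ g) := (s.sec.map_comp f g).symm

@[simp]
theorem Sec.act_comp_assoc (s : Sec p X) {x y z : Over s.base} (f : x ⟶ y) (g : y ⟶ z) {w : X.obj}
    (h : s.val z ⟶ w) : s.act f ≫ s.act g ≫ h = s.act (f ≫ g) ≫ h := by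
  rw [← Category.assoc, Sec.act_comp]

theorem Sec.app_naturality {s t : Sec p X} (α : s ⟶ t) {x y : Over s.base} (f : x ⟶ y) :
    s.act f ≫ Sec.app α y = Sec.app α x ≫ t.act ((Over.map (Sec.Hom.base α)).map f) :=
  α.trans.toNatTrans.naturality f

theorem Sec.app_naturality_assoc {s t : Sec p X} (α : s ⟶ t) {x y : Over s.base} (f : x ⟶ y)
    {w : X.obj} (h : t.val ((Over.map (Sec.Hom.base α)).obj y) ⟶ w) :
    s.act f ≫ Sec.app α y ≫ h =
      Sec.app α x ≫ t.act ((Over.map (Sec.Hom.base α)).map f) ≫ h := by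
  rw [← Category.assoc, Sec.app_naturality, Category.assoc]

theorem Sec.hom_ext {s t : Sec p X} (α β : s ⟶ t) (h : Sec.Hom.base α = Sec.Hom.base β)
    (h' : ∀ x : Over s.base, Sec.app α x ≫
      t.act (Over.homMk (𝟙 x.left) (by simp [h]) :
        (Over.map (Sec.Hom.base α)).obj x ⟶ (Over.map (Sec.Hom.base β)).obj x) =
      Sec.app β x) : α = β := by
  obtain ⟨a, α⟩ := α
  obtain ⟨b, β⟩ := β
  obtain rfl : a = b := h
  refine congrArg (Sec.Hom.mk a) ?_
  apply BasedNatTrans.ext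
  ext x
  refine Eq.trans ?_ (h' x)
  refine Eq.trans (Category.comp_id _).symm ?_
  congr 1
  exact (t.sec.map_id _).symm

theorem Sec.comp_app {s t r : Sec p X} (α : s ⟶ t) (β : t ⟶ r) (x : Over s.base) :
    Sec.app (α ≫ β) x = Sec.app α x ≫ Sec.app β ((Over.map (Sec.Hom.base α)).obj x) ≫
      r.act (overComp (Sec.Hom.base α) (Sec.Hom.base β) x) :=
  rfl

theorem Sec.id_app (s : Sec p X) (x : Over s.base) : Sec.app (𝟙 s) x = s.act (overId x) :=
  rfl

theorem Sec.comp_base {s t r : Sec p X} (α : s ⟶ t) (β : t ⟶ r) :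
    Sec.Hom.base (α ≫ β) = Sec.Hom.base α ≫ Sec.Hom.base β := rfl

theorem Sec.id_base (s : Sec p X) : Sec.Hom.base (𝟙 s) = 𝟙 s.base := rfl

instance : Category (Sec p X) where
  id_comp {s t} α := Sec.hom_ext _ _ (Category.id_comp _) fun x => by
    rw [Sec.comp_app, Sec.id_app]
    refine (congrArg (· ≫ _) (Sec.app_naturality_assoc α (overId x) _)).trans ?_
    simp only [Category.assoc, Sec.act_comp]
    refine Eq.trans ?_ (Category.comp_id _)
    congr 1
    refine Eq.trans ?_ (t.act_id _)
    congr 1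
    ext
    simp [overId, overComp]
  comp_id {s t} α := Sec.hom_ext _ _ (Category.comp_id _) fun x => by
    rw [Sec.comp_app, Sec.id_app]
    simp only [Category.assoc, Sec.act_comp]
    refine Eq.trans ?_ (Category.comp_id _)
    congr 1
    refine Eq.trans ?_ (t.act_id _)
    congr 1
    ext
    simp [overId, overComp]
  assoc {s t r q} α β γ := Sec.hom_ext _ _ (Category.assoc _ _ _) fun x => by
    simp only [Sec.comp_app, Category.assoc, Sec.act_comp]
    refine congrArg (Sec.app α x ≫ ·) (congrArg (Sec.app β _ ≫ ·) ?_)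
    refine (Sec.app_naturality_assoc γ (overComp α.base β.base x) _).trans ?_
    refine congrArg (Sec.app γ _ ≫ ·) ?_
    refine (Sec.act_comp q _ _).trans (congrArg q.act ?_)
    ext
    simp [overComp]

/-- The projection. -/
def Sec.proj (p : A ⥤ B) (X : BasedCategory.{v₂, u₂} B) : Sec p X ⥤ A where
  obj s := s.base
  map α := Sec.Hom.base α


/-- Restriction of a section along `f`. -/
def Sec.restrict (s : Sec p X) {a : A} (f : a ⟶ s.base) : Sec p X where
  base := a
  sec := (sumFunctor p (yoMap f)).comp s.sec

/-- The cartesian lift. -/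
def Sec.lift (s : Sec p X) {a : A} (f : a ⟶ s.base) : s.restrict f ⟶ s :=
  ⟨f, 𝟙 ((sumFunctor p (yoMap f)).comp s.sec)⟩

theorem Sec.lift_app (s : Sec p X) {a : A} (f : a ⟶ s.base) (x : Over a) :
    Sec.app (s.lift f) x = 𝟙 (s.val ((Over.map f).obj x)) := rfl

theorem Sec.comp_lift_app (s : Sec p X) {a : A} (f : a ⟶ s.base) {t : Sec p X}
    (χ : t ⟶ s.restrict f) (x : Over t.base) :
    Sec.app (χ ≫ s.lift f) x = Sec.app χ x ≫ s.act (overComp (Sec.Hom.base χ) f x) := by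
  rw [Sec.comp_app]
  exact congrArg (Sec.app χ x ≫ ·) (Category.id_comp _)

theorem overComp_inv {a b c : A} (f : a ⟶ b) (g : b ⟶ c) (x : Over a) :
    overComp f g x ≫ overCompInv f g x = 𝟙 _ := by
  ext
  simp [overComp, overCompInv]

theorem overInv_comp {a b c : A} (f : a ⟶ b) (g : b ⟶ c) (x : Over a) :
    overCompInv f g x ≫ overComp f g x = 𝟙 _ := by
  ext
  simp [overComp, overCompInv]

/-- The factorisation through a cartesian lift. -/
def Sec.fac (s : Sec p X) {a : A} (f : a ⟶ s.base) {t : Sec p X} (g : t.base ⟶ a)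
    (α : t.sec ⟶ (sumFunctor p (yoMap (g ≫ f))).comp s.sec) : t ⟶ s.restrict f :=
  ⟨g, α ≫ BasedCategory.whiskerRight (sumTrans p (yoMapCompInv g f)) s.sec⟩

theorem Sec.fac_app (s : Sec p X) {a : A} (f : a ⟶ s.base) {t : Sec p X} (g : t.base ⟶ a)
    (α : t.sec ⟶ (sumFunctor p (yoMap (g ≫ f))).comp s.sec) (x : Over t.base) :
    Sec.app (s.fac f g α) x =
      Sec.app (⟨g ≫ f, α⟩ : t ⟶ s) x ≫ s.act (overCompInv g f x) := rfl

theorem Sec.lift_universal (s : Sec p X) {a : A} (f : a ⟶ s.base) (t : Sec p X) (g : t.base ⟶ a)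
    (α : t ⟶ s) (h : Sec.Hom.base α = g ≫ f) :
    ∃! χ : t ⟶ s.restrict f, Sec.Hom.base χ = g ∧ χ ≫ s.lift f = α := by
  obtain ⟨k, α⟩ := α
  obtain rfl : k = g ≫ f := h
  refine ⟨s.fac f g α, ⟨rfl, ?_⟩, ?_⟩
  · refine Sec.hom_ext _ _ rfl fun x => ?_
    rw [Sec.comp_lift_app, Sec.fac_app]
    refine (Category.assoc _ _ _).trans ((Category.assoc _ _ _).trans ?_)
    refine Eq.trans (congrArg (Sec.app (⟨g ≫ f, α⟩ : t ⟶ s) x ≫ ·) ?_) (Category.comp_id _)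
    refine Eq.trans ((congrArg (s.act _ ≫ ·) (Sec.act_comp s _ _)).trans
      ((Sec.act_comp s _ _).trans ?_)) (s.act_id _)
    refine congrArg s.act ?_
    ext
    simp only [overComp, overCompInv]
    refine (Category.id_comp _).trans (Category.id_comp _)
  · rintro χ ⟨hg, h⟩
    obtain ⟨k, χ⟩ := χ
    obtain rfl : k = g := hg
    refine Sec.hom_ext _ _ rfl fun x => ?_
    have e : Sec.app (⟨k ≫ f, α⟩ : t ⟶ s) x =
        Sec.app (⟨k, χ⟩ : t ⟶ s.restrict f) x ≫ s.act (overComp k f x) :=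
      (congrArg (fun β => BasedNatTrans.toNatTrans β |>.app x)
        (eq_of_heq (Sec.Hom.mk.inj h).2).symm).trans
        (Sec.comp_lift_app s f (⟨k, χ⟩ : t ⟶ s.restrict f) x)
    refine Eq.trans ?_ ((Sec.fac_app s f k α x).trans
      ((congrArg (· ≫ s.act (overCompInv k f x)) e).trans (Category.assoc _ _ _))).symm
    refine congrArg (Sec.app (⟨k, χ⟩ : t ⟶ s.restrict f) x ≫ ·) ?_
    refine Eq.trans ?_ (Sec.act_comp s _ _).symm
    refine congrArg s.act ?_
    ext
    exact (Category.id_comp (𝟙 x.left)).symm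

theorem Sec.lift_isStronglyCartesian (s : Sec p X) {a : A} (f : a ⟶ s.base) :
    (Sec.proj p X).IsStronglyCartesian f (s.lift f) := by
  have : (Sec.proj p X).IsHomLift f (s.lift f) := IsHomLift.map (Sec.proj p X) (s.lift f)
  constructor
  intro t g α hα
  obtain ⟨χ, ⟨h₁, h₂⟩, h₃⟩ := s.lift_universal f t g α
    (@IsHomLift.eq_of_isHomLift _ _ _ _ (Sec.proj p X) t s (g ≫ f) α hα).symm
  refine ⟨χ, ⟨?_, h₂⟩, fun χ' h => h₃ χ' ⟨?_, h.2⟩⟩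
  · rw [← h₁]
    exact IsHomLift.map (Sec.proj p X) χ
  · exact (@IsHomLift.eq_of_isHomLift _ _ _ _ (Sec.proj p X) t (s.restrict f) g χ' h.1).symm

theorem Sec.isFibered (p : A ⥤ B) (X : BasedCategory.{v₂, u₂} B) : (Sec.proj p X).IsFibered :=
  Functor.IsFibered.of_exists_isStronglyCartesian fun s _ f =>
    ⟨s.restrict f, s.lift f, s.lift_isStronglyCartesian f⟩

end

section
variable {p : A ⥤ B} {X : BasedCategory.{v₂, u₂} B} {Y : BasedCategory.{v₃, u₃} B}

/-- Postcomposition of a section with a functor over `B`. -/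
def Sec.postObj (F : BasedFunctor X Y) (s : Sec p X) : Sec p Y := ⟨s.base, s.sec.comp F⟩

/-- Postcomposition of an arrow of sections with a functor over `B`. -/
def Sec.postMap (F : BasedFunctor X Y) {s t : Sec p X} (α : s ⟶ t) :
    s.postObj F ⟶ t.postObj F :=
  Sec.Hom.mk (s := s.postObj F) (t := t.postObj F) (Sec.Hom.base (s := s) (t := t) α)
    (BasedCategory.whiskerRight (Sec.Hom.trans (s := s) (t := t) α) F)

theorem Sec.postMap_app (F : BasedFunctor X Y) {s t : Sec p X} (α : s ⟶ t) (x : Over s.base) :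
    Sec.app (Sec.postMap F α) x = F.map (Sec.app α x) := rfl

theorem Sec.postObj_act (F : BasedFunctor X Y) (s : Sec p X) {x y : Over s.base} (f : x ⟶ y) :
    (s.postObj F).act f = F.map (s.act f) := rfl

theorem Sec.postMap_comp (F : BasedFunctor X Y) {s t r : Sec p X} (α : s ⟶ t) (β : t ⟶ r) :
    Sec.postMap F (α ≫ β) = Sec.postMap F α ≫ Sec.postMap F β := by
  refine congrArg (Sec.Hom.mk (s := s.postObj F) (t := r.postObj F)
    (Sec.Hom.base (s := s) (t := r) (α ≫ β))) ?_
  apply BasedNatTrans.ext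
  ext x
  exact (F.map_comp _ _).trans (congrArg (F.map _ ≫ ·) (F.map_comp _ _))

/-- Whiskering of a section with a natural transformation over `B`. -/
def Sec.postTrans {F G : BasedFunctor X Y} (θ : F ⟶ G) (s : Sec p X) :
    s.postObj F ⟶ s.postObj G :=
  Sec.Hom.mk (s := s.postObj F) (t := s.postObj G) (𝟙 s.base)
    (BasedCategory.whiskerLeft s.sec θ ≫
      BasedCategory.whiskerRight (sumTrans p (yoMapId s.base)) (s.sec.comp G))

theorem Sec.postTrans_app {F G : BasedFunctor X Y} (θ : F ⟶ G) (s : Sec p X) (x : Over s.base) :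
    Sec.app (Sec.postTrans θ s) x = θ.toNatTrans.app (s.val x) ≫ G.map (s.act (overId x)) := rfl

theorem Sec.postTrans_naturality {F G : BasedFunctor X Y} (θ : F ⟶ G) {s t : Sec p X} (α : s ⟶ t) :
    Sec.postMap F α ≫ Sec.postTrans θ t = Sec.postTrans θ s ≫ Sec.postMap G α := by
  have hb : Sec.Hom.base (Sec.postMap F α ≫ Sec.postTrans θ t) =
      Sec.Hom.base (Sec.postTrans θ s ≫ Sec.postMap G α) :=
    (Category.comp_id (Sec.Hom.base (s := s) (t := t) α)).trans
      (Category.id_comp (Sec.Hom.base (s := s) (t := t) α)).symm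
  refine Sec.hom_ext _ _ hb fun (x : Over s.base) => ?_
  generalize_proofs h
  let k : s.base ⟶ t.base := Sec.Hom.base α
  let m : (Over.map (k ≫ 𝟙 t.base)).obj x ⟶ (Over.map (𝟙 s.base ≫ k)).obj x :=
    Over.homMk (𝟙 x.left) h
  change (F.map (Sec.app α x) ≫ (θ.toNatTrans.app (t.val ((Over.map k).obj x)) ≫
      G.map (t.act (overId ((Over.map k).obj x)))) ≫ G.map (t.act (overComp k (𝟙 t.base) x))) ≫
      G.map (t.act m) =
    (θ.toNatTrans.app (s.val x) ≫ G.map (s.act (overId x))) ≫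
      G.map (Sec.app α ((Over.map (𝟙 s.base)).obj x)) ≫ G.map (t.act (overComp (𝟙 s.base) k x))
  have hn : F.map (Sec.app α x) ≫ θ.toNatTrans.app (t.val ((Over.map k).obj x)) =
      θ.toNatTrans.app (s.val x) ≫ G.map (Sec.app α x) := θ.toNatTrans.naturality _
  simp only [Category.assoc]
  rw [← Category.assoc, hn, Category.assoc]
  refine congrArg (θ.toNatTrans.app (s.val x) ≫ ·) ?_
  simp only [← G.map_comp]
  refine congrArg G.map ?_
  refine Eq.trans ?_ (Sec.app_naturality_assoc α (overId x) _).symm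
  simp only [Sec.act_comp]
  refine congrArg (Sec.app α x ≫ ·) (congrArg t.act ?_)
  ext
  exact Category.id_comp (𝟙 x.left ≫ 𝟙 x.left)

theorem Sec.postTrans_id (F : BasedFunctor X Y) (s : Sec p X) :
    Sec.postTrans (𝟙 F) s = 𝟙 (s.postObj F) := by
  refine congrArg (Sec.Hom.mk (s := s.postObj F) (t := s.postObj F) (𝟙 s.base)) ?_
  apply BasedNatTrans.ext
  ext x
  exact Category.id_comp _

theorem Sec.postTrans_comp {F G H : BasedFunctor X Y} (θ : F ⟶ G) (κ : G ⟶ H) (s : Sec p X) :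
    Sec.postTrans (θ ≫ κ) s = Sec.postTrans θ s ≫ Sec.postTrans κ s := by
  refine Sec.hom_ext _ _ (Category.comp_id (𝟙 s.base)).symm fun (x : Over s.base) => ?_
  generalize_proofs h
  let m : (Over.map (𝟙 s.base)).obj x ⟶ (Over.map (𝟙 s.base ≫ 𝟙 s.base)).obj x :=
    Over.homMk (𝟙 x.left) h
  change ((θ.toNatTrans.app (s.val x) ≫ κ.toNatTrans.app (s.val x)) ≫ H.map (s.act (overId x))) ≫
      H.map (s.act m) =
    (θ.toNatTrans.app (s.val x) ≫ G.map (s.act (overId x))) ≫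
      (κ.toNatTrans.app (s.val ((Over.map (𝟙 s.base)).obj x)) ≫ H.map (s.act (overId _))) ≫
        H.map (s.act (overComp (𝟙 s.base) (𝟙 s.base) x))
  have hn : G.map (s.act (overId x)) ≫ κ.toNatTrans.app (s.val ((Over.map (𝟙 s.base)).obj x)) =
      κ.toNatTrans.app (s.val x) ≫ H.map (s.act (overId x)) := κ.toNatTrans.naturality _
  simp only [Category.assoc]
  rw [← Category.assoc (G.map (s.act (overId x))), hn, Category.assoc]
  refine congrArg (θ.toNatTrans.app (s.val x) ≫ ·) (congrArg (κ.toNatTrans.app (s.val x) ≫ ·) ?_)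
  refine congrArg (H.map (s.act (overId x)) ≫ ·) ?_
  refine Eq.trans (congrArg H.map ?_) (H.map_comp _ _)
  refine Eq.trans (congrArg s.act ?_) (Sec.act_comp s _ _).symm
  ext
  exact (Category.id_comp (𝟙 x.left)).symm

theorem Sec.postMap_lift (F : BasedFunctor X Y) (s : Sec p X) {a : A} (f : a ⟶ s.base) :
    Sec.postMap F (s.lift f) = (s.postObj F).lift f := by
  refine congrArg (Sec.Hom.mk (s := (s.postObj F).restrict f) (t := s.postObj F) f) ?_
  apply BasedNatTrans.ext
  ext x
  exact F.map_id _

end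

/-! ### Co-free fibred categories -/

section
variable {X : BasedCategory.{v₂, u₂} B} {Y : BasedCategory.{v₃, u₃} B}

/-- The co-free fibred category on a displayed category `X` over `B`: an object over `b` is a functor
`B/b → X` over `B`, and an arrow over `f : b ⟶ b'` from `s` to `t` is a vertical natural
transformation from `s` to the restriction of `t` along `B/f : B/b → B/b'`. -/
def cofree (X : BasedCategory.{v₂, u₂} B) : FibCat.{max u₁ v₁ v₂, max u₁ v₁ u₂ v₂} B where
  toBased := BasedCategory.ofFunctor (Sec.proj (𝟭 B) X)
  isFibered := Sec.isFibered (𝟭 B) X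

/-- The action of `cofree` on functors over `B`, by postcomposition. -/
def cofreeMap (F : BasedFunctor X Y) : FibFunctor (cofree X) (cofree Y) where
  toBased :=
    { obj := fun s : Sec (𝟭 B) X => s.postObj F
      map := fun α => Sec.postMap F α
      map_id := fun _ => rfl
      map_comp := fun α β => Sec.postMap_comp F α β
      w := rfl }
  cart := PreservesCartesian.of_lifts _ fun (s : Sec (𝟭 B) X) R f =>
    ⟨s.restrict f, s.lift f, toCart (s.lift_isStronglyCartesian f), by
      have h : (Sec.proj (𝟭 B) Y).IsCartesian (R := R) f (Sec.postMap F (s.lift f)) := by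
        rw [Sec.postMap_lift F s f]
        exact toCart ((s.postObj F).lift_isStronglyCartesian f)
      exact h⟩

/-- The action of `cofree` on vertical natural transformations, by whiskering. -/
def cofreeMap₂ {F G : BasedFunctor X Y} (θ : F ⟶ G) : cofreeMap F ⟶ cofreeMap G :=
  ({ app := fun s : Sec (𝟭 B) X => Sec.postTrans θ s
     naturality := fun _ _ α => Sec.postTrans_naturality θ α
     isHomLift' := fun s : Sec (𝟭 B) X => IsHomLift.map (Sec.proj (𝟭 B) Y) (Sec.postTrans θ s) } :
    BasedNatTrans (cofreeMap F).toBased (cofreeMap G).toBased)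

theorem cofreeMap₂_id (F : BasedFunctor X Y) : cofreeMap₂ (𝟙 F) = 𝟙 (cofreeMap F) := by
  apply BasedNatTrans.ext
  ext s
  exact Sec.postTrans_id F s

theorem cofreeMap₂_comp {F G H : BasedFunctor X Y} (θ : F ⟶ G) (κ : G ⟶ H) :
    cofreeMap₂ (θ ≫ κ) = cofreeMap₂ θ ≫ cofreeMap₂ κ := by
  apply BasedNatTrans.ext
  ext s
  exact Sec.postTrans_comp θ κ s

end


theorem cofreeMap₂_whiskerLeft {X Y Z : BasedCategory.{v₂, u₂} B} (F : BasedFunctor X Y)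
    {G H : BasedFunctor Y Z} (θ : G ⟶ H) :
    cofreeMap₂ (BasedCategory.whiskerLeft F θ) =
      BasedCategory.whiskerLeft (cofreeMap F).toBased (cofreeMap₂ θ) := rfl

theorem cofreeMap₂_whiskerRight {X Y Z : BasedCategory.{v₂, u₂} B}
    {F G : BasedFunctor X Y} (θ : F ⟶ G) (H : BasedFunctor Y Z) :
    cofreeMap₂ (BasedCategory.whiskerRight θ H) =
      BasedCategory.whiskerRight (cofreeMap₂ θ) (cofreeMap H).toBased := by
  apply BasedNatTrans.ext
  ext (s : Sec (𝟭 B) X)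
  refine congrArg (Sec.Hom.mk (s := (s.postObj F).postObj H) (t := (s.postObj G).postObj H)
    (𝟙 s.base)) ?_
  apply BasedNatTrans.ext
  ext x
  exact (H.map_comp _ _).symm

theorem coh_associator {C : Type*} [Bicategory C] {a b c d : C} (f : a ⟶ b) (g : b ⟶ c)
    (h : c ⟶ d) : (α_ f g h).hom = 𝟙 _ ≫ 𝟙 (f ≫ g) ▷ h ≫ (α_ f g h).hom ≫ f ◁ 𝟙 (g ≫ h) ≫ 𝟙 _ := by
  simp

theorem coh_whisker {C : Type*} [Bicategory C] {a b : C} {f g : a ⟶ b} (θ : f ⟶ g) :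
    θ = 𝟙 f ≫ θ ≫ 𝟙 g := by
  simp

theorem coh_leftUnitor {C : Type*} [Bicategory C] {a b : C} (f : a ⟶ b) :
    (λ_ f).hom = 𝟙 _ ≫ 𝟙 (𝟙 a) ▷ f ≫ (λ_ f).hom := by
  simp

theorem coh_rightUnitor {C : Type*} [Bicategory C] {a b : C} (f : a ⟶ b) :
    (ρ_ f).hom = 𝟙 _ ≫ f ◁ 𝟙 (𝟙 b) ≫ (ρ_ f).hom := by
  simp

/-- The co-free construction `N_B : CAT/B → FIB_B`, as a (strict) `2`-functor. -/
def cofreePseudo (B : Type u₁) [Category.{v₁} B] :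
    BasedCategory.{v₂, u₂} B ⥤ᵖ FibCat.{max u₁ v₁ v₂, max u₁ v₁ u₂ v₂} B where
  obj X := cofree X
  map F := cofreeMap F
  map₂ θ := cofreeMap₂ θ
  map₂_id F := cofreeMap₂_id F
  map₂_comp θ κ := cofreeMap₂_comp θ κ
  mapId X := Iso.refl (𝟙 (cofree X))
  mapComp {X Y Z} F G :=
    Iso.refl (CategoryStruct.comp (X := cofree X) (Y := cofree Y) (Z := cofree Z)
      (cofreeMap F) (cofreeMap G))
  map₂_whisker_left {X Y Z} F G H θ := (cofreeMap₂_whiskerLeft F θ).trans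
    (coh_whisker (C := FibCat B) (a := cofree X) (b := cofree Z)
      (f := (cofreeMap F).comp (cofreeMap G)) (g := (cofreeMap F).comp (cofreeMap H)) _)
  map₂_whisker_right {X Y Z F G} θ H := (cofreeMap₂_whiskerRight θ H).trans
    (coh_whisker (C := FibCat B) (a := cofree X) (b := cofree Z)
      (f := (cofreeMap F).comp (cofreeMap H)) (g := (cofreeMap G).comp (cofreeMap H)) _)
  map₂_associator {X Y Z W} F G H := (cofreeMap₂_id (BasedFunctor.comp (BasedFunctor.comp F G) H)).trans
    (coh_associator (C := FibCat B) (a := cofree X) (b := cofree Y) (c := cofree Z) (d := cofree W)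
      (cofreeMap F) (cofreeMap G) (cofreeMap H))
  map₂_left_unitor {X Y} F := (cofreeMap₂_id F).trans
    (coh_leftUnitor (C := FibCat B) (a := cofree X) (b := cofree Y) (cofreeMap F))
  map₂_right_unitor {X Y} F := (cofreeMap₂_id F).trans
    (coh_rightUnitor (C := FibCat B) (a := cofree X) (b := cofree Y) (cofreeMap F))


/-! ### Oplax base change -/

/-- An object of the oplax base change of `E` along the fibration `p`, over `base`: a fibred functor
over `B` from the oplax sum along `p` of `A/base` to `E`. -/
structure OplObj (p : A ⥤ B) [hp : p.IsFibered] (E : FibCat.{v₂, u₂} B) where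
  base : A
  sec : FibFunctor (oplaxSum p (yo base)) E

section
variable {p : A ⥤ B} [hp : p.IsFibered] {E : FibCat.{v₂, u₂} B} {F : FibCat.{v₃, u₃} B}

/-- The underlying section. -/
def OplObj.toSec (s : OplObj p E) : Sec p E.toBased := ⟨s.base, s.sec.toBased⟩

/-- An arrow over `f : a ⟶ a'` is a natural transformation of fibred functors from `s` to the
restriction of `t` along `A/f`. -/
instance : Category (OplObj p E) where
  Hom s t := s.toSec ⟶ t.toSec
  id s := 𝟙 s.toSec
  comp {s t r} α β := CategoryStruct.comp (X := s.toSec) (Y := t.toSec) (Z := r.toSec) α β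
  id_comp {s t} α := Category.id_comp (X := s.toSec) (Y := t.toSec) α
  comp_id {s t} α := Category.comp_id (X := s.toSec) (Y := t.toSec) α
  assoc {s t r q} α β γ :=
    Category.assoc (W := s.toSec) (X := t.toSec) (Y := r.toSec) (Z := q.toSec) α β γ

/-- The projection to `A`. -/
def OplObj.proj (p : A ⥤ B) [hp : p.IsFibered] (E : FibCat.{v₂, u₂} B) : OplObj p E ⥤ A where
  obj s := s.base
  map {s t} α := Sec.Hom.base (s := s.toSec) (t := t.toSec) α

/-- Restriction along `f`. -/
def OplObj.restrict (s : OplObj p E) {a : A} (f : a ⟶ s.base) : OplObj p E where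
  base := a
  sec := (oplaxSumFunctor p (yoFib f)).comp s.sec

/-- The cartesian lift of `f`. -/
def OplObj.lift (s : OplObj p E) {a : A} (f : a ⟶ s.base) : s.restrict f ⟶ s := s.toSec.lift f

theorem OplObj.lift_isStronglyCartesian (s : OplObj p E) {a : A} (f : a ⟶ s.base) :
    (OplObj.proj p E).IsStronglyCartesian f (s.lift f) := by
  have : (OplObj.proj p E).IsHomLift f (s.lift f) := IsHomLift.map (OplObj.proj p E) (s.lift f)
  constructor
  intro t g α hα
  obtain ⟨χ, ⟨h₁, h₂⟩, h₃⟩ := s.toSec.lift_universal f t.toSec g α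
    (@IsHomLift.eq_of_isHomLift _ _ _ _ (OplObj.proj p E) t s (g ≫ f) α hα).symm
  refine ⟨χ, ⟨?_, h₂⟩, fun χ' h => h₃ χ' ⟨?_, h.2⟩⟩
  · rw [← h₁]
    exact @IsHomLift.map _ _ _ _ (OplObj.proj p E) t (s.restrict f) χ
  · exact (@IsHomLift.eq_of_isHomLift _ _ _ _ (OplObj.proj p E) t (s.restrict f) g χ' h.1).symm

/-- Postcomposition with a fibred functor. -/
def OplObj.postObj (f : FibFunctor E F) (s : OplObj p E) : OplObj p F := ⟨s.base, s.sec.comp f⟩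

end

/-- The oplax base change of a fibred category along a fibration `p : A ⥤ B`. The objects over `a` are
the fibred functors `(A/a → A → B) ⟶ E` over `B`; the arrows over `f : a ⟶ a'` from `s` to `t` are the
natural transformations of fibred functors from `s` to the restriction of `t` along `A/f`. -/
def oplaxBaseChange (p : A ⥤ B) [hp : p.IsFibered] (E : FibCat.{v₂, u₂} B) :
    FibCat.{max u v v₂, max u v u₂ v₂} A where
  toBased := BasedCategory.ofFunctor (OplObj.proj p E)
  isFibered := Functor.IsFibered.of_exists_isStronglyCartesian fun (s : OplObj p E) _ f =>
    ⟨s.restrict f, s.lift f, s.lift_isStronglyCartesian f⟩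

section
variable (p : A ⥤ B) [hp : p.IsFibered] {E : FibCat.{v₂, u₂} B} {F : FibCat.{v₃, u₃} B}

/-- The action on fibred functors, by postcomposition. -/
def oplaxBaseChangeMap (f : FibFunctor E F) :
    FibFunctor (oplaxBaseChange p E) (oplaxBaseChange p F) where
  toBased :=
    { obj := fun s : OplObj p E => s.postObj f
      map := fun {s t} α => Sec.postMap (s := OplObj.toSec s) (t := OplObj.toSec t) f.toBased α
      map_id := fun _ => rfl
      map_comp := fun {s t r} α β => Sec.postMap_comp (s := OplObj.toSec s) (t := OplObj.toSec t)
        (r := OplObj.toSec r) f.toBased α β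
      w := rfl }
  cart := PreservesCartesian.of_lifts _ fun (s : OplObj p E) R g =>
    ⟨s.restrict g, s.lift g, toCart (s.lift_isStronglyCartesian g), by
      have h : (OplObj.proj p F).IsCartesian (R := R) (a := (s.postObj f).restrict g)
          (b := s.postObj f) g (Sec.postMap f.toBased (s.toSec.lift g)) := by
        rw [Sec.postMap_lift f.toBased s.toSec g]
        exact toCart ((s.postObj f).lift_isStronglyCartesian g)
      exact h⟩

/-- The action on natural transformations, by whiskering. -/
def oplaxBaseChangeMap₂ {f g : FibFunctor E F} (θ : f ⟶ g) :
    oplaxBaseChangeMap p f ⟶ oplaxBaseChangeMap p g :=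
  ({ app := fun s : OplObj p E => Sec.postTrans (F := f.toBased) (G := g.toBased) θ s.toSec
     naturality := fun s t α => Sec.postTrans_naturality (F := f.toBased) (G := g.toBased)
      (s := OplObj.toSec s) (t := OplObj.toSec t) θ α
     isHomLift' := fun s : OplObj p E => IsHomLift.map (a := s.postObj f) (b := s.postObj g)
      (OplObj.proj p F) (Sec.postTrans (F := f.toBased) (G := g.toBased) θ s.toSec) } :
    BasedNatTrans (oplaxBaseChangeMap p f).toBased (oplaxBaseChangeMap p g).toBased)

theorem oplaxBaseChangeMap₂_id (f : FibFunctor E F) :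
    oplaxBaseChangeMap₂ p (𝟙 f) = 𝟙 (oplaxBaseChangeMap p f) := by
  apply BasedNatTrans.ext
  ext s
  exact Sec.postTrans_id f.toBased (OplObj.toSec s)

theorem oplaxBaseChangeMap₂_comp {f g h : FibFunctor E F} (θ : f ⟶ g) (κ : g ⟶ h) :
    oplaxBaseChangeMap₂ p (θ ≫ κ) = oplaxBaseChangeMap₂ p θ ≫ oplaxBaseChangeMap₂ p κ := by
  apply BasedNatTrans.ext
  ext s
  exact Sec.postTrans_comp (F := f.toBased) (G := g.toBased) (H := h.toBased) θ κ
    (OplObj.toSec s)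

theorem oplaxBaseChangeMap₂_whiskerLeft {E F G : FibCat.{v₂, u₂} B} (f : FibFunctor E F)
    {g h : FibFunctor F G} (θ : g ⟶ h) :
    oplaxBaseChangeMap₂ p (f := f.comp g) (g := f.comp h)
        (BasedCategory.whiskerLeft f.toBased θ) =
      BasedCategory.whiskerLeft (oplaxBaseChangeMap p f).toBased (oplaxBaseChangeMap₂ p θ) := rfl

theorem oplaxBaseChangeMap₂_whiskerRight {E F G : FibCat.{v₂, u₂} B} {f g : FibFunctor E F}
    (θ : f ⟶ g) (h : FibFunctor F G) :
    oplaxBaseChangeMap₂ p (f := f.comp h) (g := g.comp h)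
        (BasedCategory.whiskerRight θ h.toBased) =
      BasedCategory.whiskerRight (oplaxBaseChangeMap₂ p θ) (oplaxBaseChangeMap p h).toBased := by
  apply BasedNatTrans.ext
  ext (s : OplObj p E)
  refine congrArg (Sec.Hom.mk (s := ((s.postObj f).postObj h).toSec)
    (t := ((s.postObj g).postObj h).toSec) (𝟙 s.base)) ?_
  apply BasedNatTrans.ext
  ext x
  exact (h.toBased.map_comp _ _).symm

/-- Oplax base change along a fibration, as a (strict) `2`-functor. -/
def oplaxBaseChangePseudo :
    FibCat.{v₂, u₂} B ⥤ᵖ FibCat.{max u v v₂, max u v u₂ v₂} A where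
  obj E := oplaxBaseChange p E
  map f := oplaxBaseChangeMap p f
  map₂ θ := oplaxBaseChangeMap₂ p θ
  map₂_id f := oplaxBaseChangeMap₂_id p f
  map₂_comp θ κ := oplaxBaseChangeMap₂_comp p θ κ
  mapId E := Iso.refl (𝟙 (oplaxBaseChange p E))
  mapComp {E F G} f g :=
    Iso.refl (CategoryStruct.comp (X := oplaxBaseChange p E) (Y := oplaxBaseChange p F)
      (Z := oplaxBaseChange p G) (oplaxBaseChangeMap p f) (oplaxBaseChangeMap p g))
  map₂_whisker_left {E F G} f g h θ := (oplaxBaseChangeMap₂_whiskerLeft p f θ).trans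
    (coh_whisker (C := FibCat A) (a := oplaxBaseChange p E) (b := oplaxBaseChange p G)
      (f := (oplaxBaseChangeMap p f).comp (oplaxBaseChangeMap p g))
      (g := (oplaxBaseChangeMap p f).comp (oplaxBaseChangeMap p h)) _)
  map₂_whisker_right {E F G f g} θ h := (oplaxBaseChangeMap₂_whiskerRight p θ h).trans
    (coh_whisker (C := FibCat A) (a := oplaxBaseChange p E) (b := oplaxBaseChange p G)
      (f := (oplaxBaseChangeMap p f).comp (oplaxBaseChangeMap p h))
      (g := (oplaxBaseChangeMap p g).comp (oplaxBaseChangeMap p h)) _)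
  map₂_associator {E F G H} f g h := (oplaxBaseChangeMap₂_id p ((f.comp g).comp h)).trans
    (coh_associator (C := FibCat A) (a := oplaxBaseChange p E) (b := oplaxBaseChange p F)
      (c := oplaxBaseChange p G) (d := oplaxBaseChange p H)
      (oplaxBaseChangeMap p f) (oplaxBaseChangeMap p g) (oplaxBaseChangeMap p h))
  map₂_left_unitor {E F} f := (oplaxBaseChangeMap₂_id p f).trans
    (coh_leftUnitor (C := FibCat A) (a := oplaxBaseChange p E) (b := oplaxBaseChange p F)
      (oplaxBaseChangeMap p f))
  map₂_right_unitor {E F} f := (oplaxBaseChangeMap₂_id p f).trans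
    (coh_rightUnitor (C := FibCat A) (a := oplaxBaseChange p E) (b := oplaxBaseChange p F)
      (oplaxBaseChangeMap p f))

end

end Basics

/-! ### Base change and the saturation adjunction -/

section Saturation

variable {P : Type u} [Category.{v} P] {Q : Type u₁} [Category.{v₁} Q]

/-- An object of the pullback of a displayed category `X` along `h`. -/
structure PullObj (h : P ⥤ Q) (X : BasedCategory.{v₂, u₂} Q) where
  base : P
  fib : X.obj
  w : X.p.obj fib = h.obj base

/-- An arrow of the pullback: a pair of arrows with the same image in `Q`. -/
@[ext]
structure PullObj.Hom {h : P ⥤ Q} {X : BasedCategory.{v₂, u₂} Q} (x y : PullObj h X) where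
  base : x.base ⟶ y.base
  fib : x.fib ⟶ y.fib
  w : X.p.IsHomLift (h.map base) fib

section
variable {h : P ⥤ Q} {X : BasedCategory.{v₂, u₂} Q} {Y : BasedCategory.{v₃, u₃} Q}

instance : CategoryStruct (PullObj h X) where
  Hom x y := PullObj.Hom x y
  id x := ⟨𝟙 x.base, 𝟙 x.fib, by
    rw [h.map_id]
    exact IsHomLift.id x.w⟩
  comp α β := ⟨α.base ≫ β.base, α.fib ≫ β.fib, by
    have := α.w
    have := β.w
    rw [h.map_comp]
    infer_instance⟩

instance : Category (PullObj h X) where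
  id_comp α := PullObj.Hom.ext (Category.id_comp _) (Category.id_comp _)
  comp_id α := PullObj.Hom.ext (Category.comp_id _) (Category.comp_id _)
  assoc α β γ := PullObj.Hom.ext (Category.assoc _ _ _) (Category.assoc _ _ _)

end

/-- The projection of the pullback to `P`. -/
def PullObj.proj (h : P ⥤ Q) (X : BasedCategory.{v₂, u₂} Q) : PullObj h X ⥤ P where
  obj x := x.base
  map α := PullObj.Hom.base α

/-- Base change of displayed categories along `h`, by pullback. -/
def baseChange (h : P ⥤ Q) (X : BasedCategory.{v₂, u₂} Q) :
    BasedCategory.{max v v₂, max u u₂} P :=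
  BasedCategory.ofFunctor (PullObj.proj h X)

section
variable (h : P ⥤ Q) {X : BasedCategory.{v₂, u₂} Q} {Y : BasedCategory.{v₃, u₃} Q}

/-- The action of base change on functors over `Q`. -/
def baseChangeMap (F : BasedFunctor X Y) : BasedFunctor (baseChange h X) (baseChange h Y) where
  obj := fun x : PullObj h X => (⟨x.base, F.obj x.fib, (F.w_obj x.fib).trans x.w⟩ : PullObj h Y)
  map := fun {x y : PullObj h X} (α : PullObj.Hom x y) => ⟨α.base, F.map α.fib, by
    have := α.w
    infer_instance⟩
  map_id := fun x : PullObj h X => PullObj.Hom.ext rfl (F.map_id x.fib)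
  map_comp := fun {x y z : PullObj h X} (α : PullObj.Hom x y) (β : PullObj.Hom y z) =>
    PullObj.Hom.ext rfl (F.map_comp α.fib β.fib)
  w := rfl

/-- The action of base change on vertical natural transformations. -/
def baseChangeMap₂ {F G : BasedFunctor X Y} (θ : F ⟶ G) :
    baseChangeMap h F ⟶ baseChangeMap h G :=
  ({ app := fun x : PullObj h X => ⟨𝟙 x.base, θ.toNatTrans.app x.fib, by
       exact (congrArg (fun k => Y.p.IsHomLift k (θ.toNatTrans.app x.fib))
        (h.map_id x.base)).mpr (θ.isHomLift x.w)⟩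
     naturality := fun (x y : PullObj h X) (α : PullObj.Hom x y) => PullObj.Hom.ext
       ((Category.comp_id α.base).trans (Category.id_comp α.base).symm)
       (θ.toNatTrans.naturality α.fib)
     isHomLift' := fun x : PullObj h X =>
       @IsHomLift.map _ _ _ _ (PullObj.proj h Y) _ _
        (PullObj.Hom.mk (x := (baseChangeMap h F).obj x) (y := (baseChangeMap h G).obj x)
          (𝟙 x.base) (θ.toNatTrans.app x.fib) _) } :
    BasedNatTrans (baseChangeMap h F) (baseChangeMap h G))

theorem baseChangeMap₂_id (F : BasedFunctor X Y) :
    baseChangeMap₂ h (𝟙 F) = 𝟙 (baseChangeMap h F) := rfl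

theorem baseChangeMap₂_comp {F G H : BasedFunctor X Y} (θ : F ⟶ G) (κ : G ⟶ H) :
    baseChangeMap₂ h (θ ≫ κ) = baseChangeMap₂ h θ ≫ baseChangeMap₂ h κ := by
  apply BasedNatTrans.ext
  ext (x : PullObj h X)
  exact PullObj.Hom.ext (Category.id_comp (𝟙 x.base)).symm rfl

/-- Base change of displayed categories, as a (strict) `2`-functor. -/
def baseChangePseudo :
    BasedCategory.{v₂, u₂} Q ⥤ᵖ BasedCategory.{max v v₂, max u u₂} P where
  obj X := baseChange h X
  map F := baseChangeMap h F
  map₂ θ := baseChangeMap₂ h θ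
  map₂_id F := baseChangeMap₂_id h F
  map₂_comp θ κ := baseChangeMap₂_comp h θ κ
  mapId X := Iso.refl (𝟙 (baseChange h X))
  mapComp {X Y Z} F G :=
    Iso.refl (CategoryStruct.comp (X := baseChange h X) (Y := baseChange h Y)
      (Z := baseChange h Z) (baseChangeMap h F) (baseChangeMap h G))
  map₂_whisker_left {X Y Z} F G H θ :=
    coh_whisker (C := BasedCategory P) (a := baseChange h X) (b := baseChange h Z)
      (f := (baseChangeMap h F).comp (baseChangeMap h G))
      (g := (baseChangeMap h F).comp (baseChangeMap h H))
      (BasedCategory.whiskerLeft (baseChangeMap h F) (baseChangeMap₂ h θ))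
  map₂_whisker_right {X Y Z F G} θ H :=
    coh_whisker (C := BasedCategory P) (a := baseChange h X) (b := baseChange h Z)
      (f := (baseChangeMap h F).comp (baseChangeMap h H))
      (g := (baseChangeMap h G).comp (baseChangeMap h H))
      (BasedCategory.whiskerRight (baseChangeMap₂ h θ) (baseChangeMap h H))
  map₂_associator {X Y Z W} F G H :=
    coh_associator (C := BasedCategory P) (a := baseChange h X) (b := baseChange h Y)
      (c := baseChange h Z) (d := baseChange h W)
      (baseChangeMap h F) (baseChangeMap h G) (baseChangeMap h H)
  map₂_left_unitor {X Y} F :=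
    coh_leftUnitor (C := BasedCategory P) (a := baseChange h X) (b := baseChange h Y)
      (baseChangeMap h F)
  map₂_right_unitor {X Y} F :=
    coh_rightUnitor (C := BasedCategory P) (a := baseChange h X) (b := baseChange h Y)
      (baseChangeMap h F)

end

/-- A functor is a functor over the base as soon as it preserves the underlying arrows. -/
def basedFunctorOfLifts {X : BasedCategory.{v₂, u₂} Q} {Y : BasedCategory.{v₃, u₃} Q}
    (F : X.obj ⥤ Y.obj)
    (hF : ∀ {x y : X.obj} (f : x ⟶ y), Y.p.IsHomLift (X.p.map f) (F.map f)) :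
    BasedFunctor X Y where
  toFunctor := F
  w := CategoryTheory.Functor.ext
    (fun x => @IsHomLift.domain_eq _ _ _ _ Y.p _ _ _ _ (X.p.map (𝟙 x)) (F.map (𝟙 x)) (hF (𝟙 x)))
    fun x y f => @IsHomLift.fac' _ _ _ _ Y.p _ _ _ _ (X.p.map f) (F.map f) (hF f)

/-- The counit of the sum along `h` and base change along `h`: the projection to `X`. -/
def baseChangeCounit (h : P ⥤ Q) (X : BasedCategory.{v₂, u₂} Q) :
    BasedFunctor (sumBased h (baseChange h X)) X :=
  basedFunctorOfLifts (X := sumBased h (baseChange h X))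
    { obj := fun x : PullObj h X => x.fib
      map := fun {x y : PullObj h X} (α : PullObj.Hom x y) => α.fib
      map_id := fun _ => rfl
      map_comp := fun _ _ => rfl }
    fun {x y : PullObj h X} (α : PullObj.Hom x y) => α.w

/-- Evaluation of sections at the identity. -/
def Sec.evalId (X : BasedCategory.{v₂, u₂} P) : Sec (𝟭 P) X ⥤ X.obj where
  obj s := s.val (Over.mk (𝟙 s.base))
  map {s t} α := Sec.app α (Over.mk (𝟙 s.base)) ≫
    t.act (Over.homMk (Sec.Hom.base α)
      ((Category.comp_id _).trans (Category.id_comp (Sec.Hom.base α)).symm))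
  map_id s := by
    rw [Sec.id_app, Sec.act_comp]
    refine Eq.trans (congrArg s.act ?_) (s.act_id _)
    ext
    exact Category.id_comp _
  map_comp {s t r} α β := by
    rw [Sec.comp_app]
    simp only [Category.assoc]
    refine congrArg (Sec.app α _ ≫ ·) ?_
    refine Eq.trans ?_ (Sec.app_naturality_assoc β _ _).symm
    refine congrArg (Sec.app β _ ≫ ·) ?_
    refine (Sec.act_comp r _ _).trans (Eq.trans (congrArg r.act ?_) (Sec.act_comp r _ _).symm)
    ext
    exact Category.id_comp _

/-- The counit of the co-free construction: evaluation of sections at the identity. -/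
def cofreeCounit (X : BasedCategory.{v₂, u₂} P) : BasedFunctor (cofree X).toBased X :=
  basedFunctorOfLifts (X := (cofree X).toBased) (Sec.evalId X)
    fun {s t : Sec (𝟭 P) X} α => by
      have h₁ : X.p.IsHomLift (𝟙 s.base) (Sec.app α (Over.mk (𝟙 s.base))) :=
        (Sec.Hom.trans (s := s) (t := t) α).isHomLift' (Over.mk (𝟙 s.base))
      let k : (Over.map (Sec.Hom.base α)).obj (Over.mk (𝟙 s.base)) ⟶ Over.mk (𝟙 t.base) :=
        Over.homMk (Sec.Hom.base α)
          ((Category.comp_id _).trans (Category.id_comp (Sec.Hom.base α)).symm)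
      have h₂ : X.p.IsHomLift (Sec.Hom.base (s := s) (t := t) α) (t.act k) :=
        @BasedFunctor.preserves_isHomLift _ _ _ _ t.sec _ _ _ _ (Sec.Hom.base α) k
          (IsHomLift.map (Over.forget t.base ⋙ 𝟭 P) k)
      have := @IsHomLift.comp _ _ _ _ X.p _ _ _ _ _ _ _ _ _ _ h₁ h₂
      rw [Category.id_comp] at this
      exact this

/-- Evaluation at the identity is strictly natural. -/
theorem cofreeCounit_naturality {X : BasedCategory.{v₂, u₂} P} {Y : BasedCategory.{v₃, u₃} P}
    (F : BasedFunctor X Y) :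
    (cofreeMap F).toBased.toFunctor ⋙ (cofreeCounit Y).toFunctor =
      (cofreeCounit X).toFunctor ⋙ F.toFunctor := by
  refine CategoryTheory.Functor.hext (fun _ => rfl) fun (s t : Sec (𝟭 P) X) α => heq_of_eq ?_
  exact (F.map_comp _ _).symm

/-- Transposition for the forgetful functor and the co-free construction: composition with the
counit, as a functor from fibred functors `F ⟶ cofree X` to functors `F ⟶ X` over `P`. -/
def cofreeTranspose (F : FibCat.{v₃, u₃} P) (X : BasedCategory.{v₂, u₂} P) :
    FibFunctor F (cofree X) ⥤ BasedFunctor F.toBased X where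
  obj φ := φ.toBased.comp (cofreeCounit X)
  map {φ ψ} θ := BasedCategory.whiskerRight (F := φ.toBased) (G := ψ.toBased) θ (cofreeCounit X)
  map_id φ := by
    apply BasedNatTrans.ext
    ext x
    exact (cofreeCounit X).map_id _
  map_comp {φ ψ χ} θ κ := by
    apply BasedNatTrans.ext
    ext x
    exact (cofreeCounit X).map_comp _ _

/-- Transposition for the sum along `h` and base change along `h`: composition with the counit. -/
def baseChangeTranspose (h : P ⥤ Q) (F : BasedCategory.{v₃, u₃} P) (X : BasedCategory.{v₂, u₂} Q) :
    BasedFunctor F (baseChange h X) ⥤ BasedFunctor (sumBased h F) X where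
  obj φ := (sumFunctor h φ).comp (baseChangeCounit h X)
  map θ := BasedCategory.whiskerRight (sumTrans h θ) (baseChangeCounit h X)
  map_id φ := by
    apply BasedNatTrans.ext
    ext x
    exact (baseChangeCounit h X).map_id _
  map_comp θ κ := by
    apply BasedNatTrans.ext
    ext x
    exact (baseChangeCounit h X).map_comp _ _

/-- Transposition for the saturation adjunction, whose left adjoint forgets to displayed categories over
`P` and then postcomposes with `h`, and whose right adjoint is base change along `h` followed by the
co-free construction. -/
def saturationTranspose (h : P ⥤ Q) (F : FibCat.{v₃, u₃} P) (X : BasedCategory.{v₂, u₂} Q) :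
    FibFunctor F (cofree (baseChange h X)) ⥤ BasedFunctor (sumBased h F.toBased) X :=
  cofreeTranspose F (baseChange h X) ⋙ baseChangeTranspose h F.toBased X

/-- The forgetful `2`-functor `U_B : FIB_B → CAT/B`. -/
def forgetPseudo (B : Type u) [Category.{v} B] :
    FibCat.{v₂, u₂} B ⥤ᵖ BasedCategory.{v₂, u₂} B where
  obj E := E.toBased
  map f := FibFunctor.toBased f
  map₂ θ := θ
  mapId X := Iso.refl (𝟙 X.toBased)
  mapComp {X Y Z} F G :=
    Iso.refl (CategoryStruct.comp (X := X.toBased) (Y := Y.toBased) (Z := Z.toBased)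
      F.toBased G.toBased)
  map₂_id f := rfl
  map₂_comp θ κ := rfl
  map₂_whisker_left {X Y Z} F G H θ :=
    coh_whisker (C := BasedCategory B) (a := X.toBased) (b := Z.toBased)
      (f := F.toBased.comp G.toBased) (g := F.toBased.comp H.toBased)
      (BasedCategory.whiskerLeft F.toBased θ)
  map₂_whisker_right {X Y Z F G} θ H :=
    coh_whisker (C := BasedCategory B) (a := X.toBased) (b := Z.toBased)
      (f := F.toBased.comp H.toBased) (g := G.toBased.comp H.toBased)
      (BasedCategory.whiskerRight (F := F.toBased) (G := G.toBased) θ H.toBased)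
  map₂_associator {X Y Z W} F G H :=
    coh_associator (C := BasedCategory B) (a := X.toBased) (b := Y.toBased)
      (c := Z.toBased) (d := W.toBased) F.toBased G.toBased H.toBased
  map₂_left_unitor {X Y} F :=
    coh_leftUnitor (C := BasedCategory B) (a := X.toBased) (b := Y.toBased) F.toBased
  map₂_right_unitor {X Y} F :=
    coh_rightUnitor (C := BasedCategory B) (a := X.toBased) (b := Y.toBased) F.toBased

/-! ### The point -/

/-- The terminal category. -/
abbrev Pt : Type := Discrete PUnit.{1}

theorem isHomLift_pt {C : Type u} [Category.{v} C] (p : C ⥤ Pt) {x y : C} {R S : Pt} (f : R ⟶ S)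
    (φ : x ⟶ y) : p.IsHomLift f φ := by
  have h : f = eqToHom (Subsingleton.elim R (p.obj x)) ≫ p.map φ ≫
      eqToHom (Subsingleton.elim (p.obj y) S) := Subsingleton.elim _ _
  exact IsHomLift.of_fac p f φ (Subsingleton.elim _ _) (Subsingleton.elim _ _) h

/-- Every category is fibred over the point. -/
instance isFibered_star (C : Type u) [Category.{v} C] :
    (Functor.star C : C ⥤ Pt).IsFibered :=
  Functor.IsFibered.of_exists_isStronglyCartesian fun x R f => by
    have := isHomLift_pt (Functor.star C : C ⥤ Pt) f (𝟙 x)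
    exact ⟨x, 𝟙 x, inferInstance⟩

/-- A category, regarded as a fibred category over the point. -/
def pointFib (E : Type u₂) [Category.{v₂} E] : FibCat.{v₂, u₂} Pt where
  toBased := BasedCategory.ofFunctor (Functor.star E)
  isFibered := isFibered_star E

theorem map_isCartesian_pt {E : Type u₂} [Category.{v₂} E] {F : Type u₃} [Category.{v₃} F]
    (f : E ⥤ F) {R S : Pt} (g : R ⟶ S) {a b : E} (φ : a ⟶ b)
    (hφ : (Functor.star E : E ⥤ Pt).IsCartesian g φ) :
    (Functor.star F : F ⥤ Pt).IsCartesian g (f.map φ) := by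
  have h₁ : (Functor.star E : E ⥤ Pt).IsStronglyCartesian g φ :=
    toStrong (isFibered_star E) hφ
  have : IsIso g := ⟨eqToHom (Subsingleton.elim S R), Subsingleton.elim _ _, Subsingleton.elim _ _⟩
  have : IsIso φ := Functor.IsStronglyCartesian.isIso_of_base_isIso (Functor.star E : E ⥤ Pt) g φ
  have := isHomLift_pt (Functor.star F : F ⥤ Pt) g (f.map φ)
  infer_instance

/-- A functor, regarded as a fibred functor over the point. -/
def pointFibMap {E : Type u₂} [Category.{v₂} E] {F : Type u₃} [Category.{v₃} F] (f : E ⥤ F) :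
    FibFunctor (pointFib E) (pointFib F) where
  toBased := { toFunctor := f, w := rfl }
  cart := fun _ _ g _ _ φ hφ => map_isCartesian_pt f g φ hφ

/-- A natural transformation, regarded as a transformation of fibred functors over the point. -/
def pointFibMap₂ {E : Type u₂} [Category.{v₂} E] {F : Type u₃} [Category.{v₃} F] {f g : E ⥤ F}
    (θ : f ⟶ g) : pointFibMap f ⟶ pointFibMap g :=
  ({ toNatTrans := θ
     isHomLift' := fun x => isHomLift_pt (Functor.star F : F ⥤ Pt) _ _ } :
    BasedNatTrans (pointFibMap f).toBased (pointFibMap g).toBased)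

/-- The `2`-functor from categories to fibred categories over the point. -/
def catToFib : Cat.{v₂, u₂} ⥤ᵖ FibCat.{v₂, u₂} Pt where
  obj E := pointFib E
  map f := pointFibMap f.toFunctor
  map₂ θ := pointFibMap₂ θ.toNatTrans
  mapId E := Iso.refl (𝟙 (pointFib E))
  mapComp {E F G} f g :=
    Iso.refl (CategoryStruct.comp (X := pointFib E) (Y := pointFib F) (Z := pointFib G)
      (pointFibMap f.toFunctor) (pointFibMap g.toFunctor))
  map₂_id f := rfl
  map₂_comp θ κ := rfl
  map₂_whisker_left {X Y Z} F G H θ :=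
    coh_whisker (C := FibCat Pt) (a := pointFib X) (b := pointFib Z)
      (f := (pointFibMap F.toFunctor).comp (pointFibMap G.toFunctor))
      (g := (pointFibMap F.toFunctor).comp (pointFibMap H.toFunctor))
      (BasedCategory.whiskerLeft (pointFibMap F.toFunctor).toBased (pointFibMap₂ θ.toNatTrans))
  map₂_whisker_right {X Y Z F G} θ H :=
    coh_whisker (C := FibCat Pt) (a := pointFib X) (b := pointFib Z)
      (f := (pointFibMap F.toFunctor).comp (pointFibMap H.toFunctor))
      (g := (pointFibMap G.toFunctor).comp (pointFibMap H.toFunctor))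
      (BasedCategory.whiskerRight (F := (pointFibMap F.toFunctor).toBased)
        (G := (pointFibMap G.toFunctor).toBased) (pointFibMap₂ θ.toNatTrans)
        (pointFibMap H.toFunctor).toBased)
  map₂_associator {X Y Z W} F G H :=
    coh_associator (C := FibCat Pt) (a := pointFib X) (b := pointFib Y)
      (c := pointFib Z) (d := pointFib W) (pointFibMap F.toFunctor) (pointFibMap G.toFunctor)
      (pointFibMap H.toFunctor)
  map₂_left_unitor {X Y} F :=
    coh_leftUnitor (C := FibCat Pt) (a := pointFib X) (b := pointFib Y) (pointFibMap F.toFunctor)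
  map₂_right_unitor {X Y} F :=
    coh_rightUnitor (C := FibCat Pt) (a := pointFib X) (b := pointFib Y) (pointFibMap F.toFunctor)

/-- Two pseudofunctors are (pseudonaturally) equivalent: there is a pseudonatural transformation
whose components are equivalences. -/
def PseudoEquiv {C : Type*} [Bicategory C] {D : Type*} [Bicategory D] (F G : C ⥤ᵖ D) : Prop :=
  ∃ η : Pseudofunctor.StrongTrans F G, ∀ X : C, ∃ e : F.obj X ≌ G.obj X, e.hom = η.app X

end Saturation
end HSLift

open HSLift

/-! The central fact concerns a fibred functor `φ` from a fibration `F` over `P` to the co-free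
fibration on `X`: it is governed by its values at identities. Let `y ⟶ x` be a cartesian arrow of
`F` over `z : c ⟶ p x`. Its image under `φ` is cartesian, and an arrow of sections is cartesian
exactly when its components are invertible (`Sec.isIso_ev_of_isCartesian`,
`Sec.isStronglyCartesian_of_isIso`). Hence the value of `φ x` at `z` is canonically isomorphic to
the value of `φ y` at the identity. A transformation between two transposes therefore extends
uniquely to the sections, which makes transposition fully faithful. Conversely, a functor `ψ : F ⟶
X` over `P` is, up to isomorphism, the transpose of `x ↦ (z ↦ ψ (z^* x))` for chosen restrictions
`z^* x` (`pullFunctor`). This is the co-free equivalence.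

Base change is a strict pullback, so functors `Z ⟶ h^* X` over `P` amount to functors `Σ_h Z ⟶ X`
over `Q` (`baseChangeTranspose_isEquivalence`). The two equivalences compose to the saturation
equivalence.

For a fibration `h`, the category `Σ_h (P/a)` is fibred over `Q`. The co-free equivalence thus
identifies fibred functors `Σ_h (P/a) ⟶ N_Q X` with functors `Σ_h (P/a) ⟶ X`, and base change
identifies these with functors `P/a ⟶ h^* X`. Letting `a` vary gives the factorisation, in the
direction from `Δ_h ∘ N_Q` to `N_P ∘ h^*` (`evalPairFib`); it is recognised as an equivalence by
`FibFunctor.exists_equivalence`.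

Over the point every category is fibred and every functor is fibred. The co-free equivalence then
inverts the counit. The fibredness condition in the oplax base change is void, so the last clause
needs only the universal property of the pullback and relies neither on the factorisation nor on the
co-free equivalence.

Pseudonaturality costs little: all the 2-functors are strict and every naturality cell is an
identity up to an equality of 1-cells, so the unit and composition axioms are automatic
(`strongTransOfStrict`). -/

namespace HSLift

/-! ### Evaluation of arrows of sections on squares; cartesian arrows of sections. -/

section

variable {A : Type u} [Category.{v} A] {B : Type u₁} [Category.{v₁} B]

section
variable {p : A ⥤ B} {X : BasedCategory.{v₂, u₂} B} {Y : BasedCategory.{v₃, u₃} B}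

/-- The action of an arrow of sections on a square from an arrow over `s.base` to an arrow over
`t.base`. -/
def Sec.ev {s t : Sec p X} (α : s ⟶ t) {z : Over s.base} {z' : Over t.base}
    (k : z.left ⟶ z'.left) (w : k ≫ z'.hom = z.hom ≫ Sec.Hom.base α) : s.val z ⟶ t.val z' :=
  Sec.app α z ≫ t.act (Over.homMk k w : (Over.map (Sec.Hom.base α)).obj z ⟶ z')

/-- Squares paste, by naturality of `β`. Keeping the composite side `m` and its square as separate
data absorbs the comparison `overComp`, so that later composites seldom mention it. -/
theorem Sec.ev_comp {s t r : Sec p X} (α : s ⟶ t) (β : t ⟶ r) {z : Over s.base}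
    {z' : Over t.base} {z'' : Over r.base} (k : z.left ⟶ z'.left)
    (w : k ≫ z'.hom = z.hom ≫ Sec.Hom.base α) (l : z'.left ⟶ z''.left)
    (w' : l ≫ z''.hom = z'.hom ≫ Sec.Hom.base β) (m : z.left ⟶ z''.left)
    (w'' : m ≫ z''.hom = z.hom ≫ Sec.Hom.base (α ≫ β)) (e : k ≫ l = m) :
    Sec.ev α k w ≫ Sec.ev β l w' = Sec.ev (α ≫ β) m w'' := by
  subst e
  unfold Sec.ev
  rw [Sec.comp_app]
  simp only [Category.assoc, Sec.act_comp]
  refine congrArg (Sec.app α z ≫ ·) ((Sec.app_naturality_assoc β _ _).trans ?_)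
  refine congrArg (Sec.app β _ ≫ ·) ((Sec.act_comp r _ _).trans (congrArg r.act ?_))
  ext
  exact (Category.id_comp (k ≫ l)).symm

theorem Sec.ev_id (s : Sec p X) {z z' : Over s.base} (f : z ⟶ z')
    (w : f.left ≫ z'.hom = z.hom ≫ Sec.Hom.base (𝟙 s)) : Sec.ev (𝟙 s) f.left w = s.act f := by
  unfold Sec.ev
  rw [Sec.id_app]
  refine (Sec.act_comp s _ _).trans (congrArg s.act ?_)
  ext
  exact Category.id_comp f.left

theorem Sec.ev_id_id (s : Sec p X) {z : Over s.base} (k : z.left ⟶ z.left)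
    (w : k ≫ z.hom = z.hom ≫ Sec.Hom.base (𝟙 s)) (hk : k = 𝟙 _) :
    Sec.ev (𝟙 s) k w = 𝟙 (s.val z) := by
  subst hk
  exact (Sec.ev_id s (𝟙 z) w).trans (s.act_id z)

theorem Sec.ev_act {s t : Sec p X} (α : s ⟶ t) {z : Over s.base} {z' z'' : Over t.base}
    (k : z.left ⟶ z'.left) (w : k ≫ z'.hom = z.hom ≫ Sec.Hom.base α) (f : z' ⟶ z'')
    (w' : (k ≫ f.left) ≫ z''.hom = z.hom ≫ Sec.Hom.base α) :
    Sec.ev α k w ≫ t.act f = Sec.ev α (k ≫ f.left) w' := by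
  unfold Sec.ev
  rw [Category.assoc, Sec.act_comp]
  rfl

theorem Sec.ev_map_id {s t : Sec p X} (α : s ⟶ t) (z : Over s.base)
    (w : 𝟙 z.left ≫ ((Over.map (Sec.Hom.base α)).obj z).hom = z.hom ≫ Sec.Hom.base α) :
    Sec.ev α (z' := (Over.map (Sec.Hom.base α)).obj z) (𝟙 z.left) w = Sec.app α z := by
  refine Eq.trans (congrArg (Sec.app α z ≫ ·) ?_) (Category.comp_id _)
  exact (congrArg t.act (Over.OverMorphism.ext rfl)).trans (t.act_id _)

/-- When the bases agree only propositionally, the components of `α` and `β` have different targets.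
Evaluations on a square share the target `t.val z'`, so no transport enters the comparison. -/
theorem Sec.hom_ext_ev {s t : Sec p X} (α β : s ⟶ t) (h : Sec.Hom.base α = Sec.Hom.base β)
    (h' : ∀ (z : Over s.base) (z' : Over t.base) (k : z.left ⟶ z'.left)
      (w : k ≫ z'.hom = z.hom ≫ Sec.Hom.base α) (w' : k ≫ z'.hom = z.hom ≫ Sec.Hom.base β),
      Sec.ev α k w = Sec.ev β k w') : α = β := by
  refine Sec.hom_ext α β h fun z => ?_
  have e : z.hom ≫ Sec.Hom.base β = z.hom ≫ Sec.Hom.base α := by rw [h]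
  exact (h' z ((Over.map (Sec.Hom.base β)).obj z) (𝟙 z.left)
    ((Category.id_comp _).trans e) (Category.id_comp _)).trans (Sec.ev_map_id β z _)

theorem Sec.ev_congr {s t : Sec p X} {α β : s ⟶ t} (h : α = β) {z : Over s.base}
    {z' : Over t.base} {k k' : z.left ⟶ z'.left} (hk : k = k')
    (w : k ≫ z'.hom = z.hom ≫ Sec.Hom.base α) (w' : k' ≫ z'.hom = z.hom ≫ Sec.Hom.base β) :
    Sec.ev α k w = Sec.ev β k' w' := by
  subst h
  subst hk
  rfl

theorem Sec.ev_isHomLift {s t : Sec p X} (α : s ⟶ t) {z : Over s.base} {z' : Over t.base}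
    (k : z.left ⟶ z'.left) (w : k ≫ z'.hom = z.hom ≫ Sec.Hom.base α) :
    X.p.IsHomLift (p.map k) (Sec.ev α k w) := by
  have h₁ : X.p.IsHomLift (𝟙 (p.obj z.left)) (Sec.app α z) :=
    (Sec.Hom.trans (s := s) (t := t) α).isHomLift' z
  let f : (Over.map (Sec.Hom.base α)).obj z ⟶ z' := Over.homMk k w
  have h₂ : X.p.IsHomLift (p.map k) (t.act f) :=
    @BasedFunctor.preserves_isHomLift _ _ _ _ t.sec _ _ _ _ (p.map k) f
      (IsHomLift.map (Over.forget t.base ⋙ p) f)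
  have := @IsHomLift.comp _ _ _ _ X.p _ _ _ _ _ _ _ _ _ _ h₁ h₂
  rwa [Category.id_comp] at this

/-- The inverse is `inv α` evaluated on the reversed square; both composites paste to an evaluation
of an identity. -/
theorem Sec.isIso_ev {s t : Sec p X} (α : s ⟶ t) [IsIso α] {z : Over s.base} {z' : Over t.base}
    (k : z.left ⟶ z'.left) [IsIso k] (w : k ≫ z'.hom = z.hom ≫ Sec.Hom.base α) :
    IsIso (Sec.ev α k w) := by
  have h : Sec.Hom.base α ≫ Sec.Hom.base (inv α) = 𝟙 _ :=
    (Sec.comp_base α (inv α)).symm.trans (congrArg Sec.Hom.base (IsIso.hom_inv_id α))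
  have h' : inv k ≫ z.hom = z'.hom ≫ Sec.Hom.base (inv α) := by
    rw [IsIso.inv_comp_eq, ← Category.assoc, w, Category.assoc, h]
    exact (Category.comp_id _).symm
  refine ⟨Sec.ev (inv α) (inv k) h', ?_, ?_⟩
  · refine (Sec.ev_comp α (inv α) k w (inv k) h' (𝟙 _) ?_ (IsIso.hom_inv_id k)).trans ?_
    · rw [IsIso.hom_inv_id]
      exact (Category.id_comp _).trans (Category.comp_id _).symm
    · refine (Sec.ev_congr (IsIso.hom_inv_id α) rfl _ ?_).trans (Sec.ev_id_id s _ _ rfl)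
      exact (Category.id_comp _).trans (Category.comp_id _).symm
  · refine (Sec.ev_comp (inv α) α (inv k) h' k w (𝟙 _) ?_ (IsIso.inv_hom_id k)).trans ?_
    · rw [IsIso.inv_hom_id]
      exact (Category.id_comp _).trans (Category.comp_id _).symm
    · refine (Sec.ev_congr (IsIso.inv_hom_id α) rfl _ ?_).trans (Sec.ev_id_id t _ _ rfl)
      exact (Category.id_comp _).trans (Category.comp_id _).symm

/-- The action of `f` is the evaluation of `𝟙 s` on `f`, read as a square. -/
theorem Sec.isIso_act (s : Sec p X) {z z' : Over s.base} (f : z ⟶ z') [IsIso f.left] :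
    IsIso (s.act f) := by
  have := Sec.isIso_ev (𝟙 s) f.left ((Over.w f).trans (Category.comp_id _).symm)
  rwa [Sec.ev_id] at this

/-- The components of a cartesian arrow of sections are isomorphisms. -/
theorem Sec.isIso_ev_of_isCartesian {s t : Sec p X} (α : s ⟶ t) {a b : A} (f : a ⟶ b)
    (hα : (Sec.proj p X).IsCartesian f α) {z : Over s.base} {z' : Over t.base}
    (k : z.left ⟶ z'.left) [IsIso k] (w : k ≫ z'.hom = z.hom ≫ Sec.Hom.base α) :
    IsIso (Sec.ev α k w) := by
  have : (Sec.proj p X).IsHomLift f α := hα.toIsHomLift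
  have ha : s.base = a := IsHomLift.domain_eq (Sec.proj p X) f α
  have hb : t.base = b := IsHomLift.codomain_eq (Sec.proj p X) f α
  subst ha hb
  have hl : (Sec.proj p X).IsCartesian f (t.lift f) := toCart (t.lift_isStronglyCartesian f)
  -- A cartesian arrow differs from the canonical lift by an isomorphism of sections. The lift has
  -- identity components, so its evaluation is the action of an arrow whose underlying arrow `k` is
  -- invertible. The square is cut at `z''`, the object `z` carried along `e`.
  let e := Functor.IsCartesian.domainUniqueUpToIso (Sec.proj p X) f (t.lift f) α
  have he : e.hom ≫ t.lift f = α := Functor.IsCartesian.fac (Sec.proj p X) f (t.lift f) α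
  have hb : Sec.Hom.base e.hom ≫ f = Sec.Hom.base α := congrArg Sec.Hom.base he
  let z'' : Over (t.restrict f).base := Over.mk (z.hom ≫ Sec.Hom.base e.hom)
  have h₀ : 𝟙 z.left ≫ z''.hom = z.hom ≫ Sec.Hom.base e.hom := Category.id_comp _
  have h₁ : k ≫ z'.hom = z''.hom ≫ Sec.Hom.base (t.lift f) := by
    refine w.trans ((congrArg (z.hom ≫ ·) hb.symm).trans (Category.assoc _ _ _).symm)
  have h₂ : IsIso (Sec.ev (t.lift f) (z := z'') k h₁) := by
    have : IsIso (Over.homMk k h₁ : (Over.map f).obj z'' ⟶ z').left := inferInstanceAs (IsIso k)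
    have h := Sec.isIso_act t (Over.homMk k h₁ : (Over.map f).obj z'' ⟶ z')
    exact (congrArg (fun m => IsIso m) (Category.id_comp (t.act _))).mpr h
  have h₃ := Sec.isIso_ev e.hom (z' := z'') (𝟙 z.left) h₀
  have h₄ := Sec.ev_comp e.hom (t.lift f) (z' := z'') (𝟙 z.left) h₀ k h₁ k
    (w.trans (congrArg (z.hom ≫ ·) hb.symm)) (Category.id_comp k)
  have h₅ := Sec.ev_congr he (rfl : k = k) (w.trans (congrArg (z.hom ≫ ·) hb.symm)) w
  rw [← h₅, ← h₄]
  exact IsIso.comp_isIso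

/-- The cancellation used for the factorisation in the next lemma: `i`, `j` are a component of `inv
τ` and of `τ`, while `f`, `g`, `h` are actions of arrows with identity underlying arrow. -/
theorem comp_cancel {C : Type*} [Category* C] {a b c d e : C} (σ : a ⟶ b) (f : b ⟶ c) {i : c ⟶ d}
    {j : d ⟶ c} {g : c ⟶ e} {h : e ⟶ b} (hij : i ≫ j = 𝟙 c) (hf : (f ≫ g) ≫ h = 𝟙 b) :
    ((σ ≫ f ≫ i) ≫ j ≫ g) ≫ h = σ := by
  rw [Category.assoc] at hf
  simp only [Category.assoc, reassoc_of% hij, hf, Category.comp_id]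

/-- An arrow of sections whose underlying transformation is invertible is cartesian. -/
theorem Sec.isStronglyCartesian_of_isIso {s t : Sec p X} (α : s ⟶ t)
    (hα : ∀ z, IsIso (Sec.app α z)) :
    (Sec.proj p X).IsStronglyCartesian (Sec.Hom.base α) α := by
  obtain ⟨f, τ⟩ := α
  have : IsIso (X := s.sec.toFunctor) (Y := ((sumFunctor p (yoMap f)).comp t.sec).toFunctor)
      τ.toNatTrans :=
    @NatIso.isIso_of_isIso_app _ _ _ _ _ _ τ.toNatTrans hα
  have : IsIso τ := BasedNatIso.isIso_of_toNatTrans_isIso τ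
  have hinv : ∀ z : Over s.base, (inv τ).toNatTrans.app z ≫ τ.toNatTrans.app z = 𝟙 _ := fun z =>
    congrArg (fun m => (BasedNatTrans.toNatTrans m).app z) (IsIso.inv_hom_id τ)
  have : (Sec.proj p X).IsHomLift f (Sec.Hom.mk f τ : s ⟶ t) :=
    IsHomLift.map (Sec.proj p X) (Sec.Hom.mk f τ : s ⟶ t)
  change (Sec.proj p X).IsStronglyCartesian f (Sec.Hom.mk f τ : s ⟶ t)
  constructor
  intro r g β hβ
  have hb : Sec.Hom.base β = g ≫ f :=
    (@IsHomLift.eq_of_isHomLift _ _ _ _ (Sec.proj p X) r t (g ≫ f) β hβ).symm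
  obtain ⟨b, σ⟩ := β
  obtain rfl : b = g ≫ f := hb
  -- The factorisation is `σ` followed by the inverse of `τ`; in between, restriction along `g ≫ f`
  -- is rewritten as an iterated restriction.
  let χ : r ⟶ s := ⟨g, σ ≫ BasedCategory.whiskerRight (sumTrans p (yoMapCompInv g f)) t.sec ≫
    BasedCategory.whiskerLeft (sumFunctor p (yoMap g)) (inv τ)⟩
  have hχ : χ ≫ (Sec.Hom.mk f τ : s ⟶ t) = ⟨g ≫ f, σ⟩ := by
    refine Sec.hom_ext _ _ rfl fun z => ?_
    rw [Sec.comp_app]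
    change ((σ.toNatTrans.app z ≫ t.act (overCompInv g f z) ≫
      (inv τ).toNatTrans.app ((Over.map g).obj z)) ≫ τ.toNatTrans.app ((Over.map g).obj z) ≫
        t.act (overComp g f z)) ≫ t.act _ = σ.toNatTrans.app z
    refine comp_cancel _ _ (hinv ((Over.map g).obj z)) ((congrArg (· ≫ _)
      (Sec.act_comp t _ _)).trans ((Sec.act_comp t _ _).trans (Eq.trans (congrArg t.act ?_)
        (t.act_id _))))
    ext
    exact (Category.comp_id _).trans (Category.id_comp _)
  refine ⟨χ, ⟨IsHomLift.map (Sec.proj p X) χ, hχ⟩, ?_⟩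
  rintro χ' ⟨h₁, h₂⟩
  have hb' : Sec.Hom.base χ' = g :=
    (@IsHomLift.eq_of_isHomLift _ _ _ _ (Sec.proj p X) r s g χ' h₁).symm
  -- Uniqueness: composing with the invertible evaluation of `τ` at `z'` turns the two sides into
  -- evaluations of equal composites.
  refine Sec.hom_ext_ev χ' χ hb' fun z z' k w w' => ?_
  have hw : 𝟙 z'.left ≫ ((Over.map f).obj z').hom = z'.hom ≫ f := Category.id_comp _
  have hi : IsIso (Sec.ev (Sec.Hom.mk f τ : s ⟶ t) (z' := (Over.map f).obj z') (𝟙 z'.left) hw) :=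
    (congrArg (fun m => IsIso m) (Sec.ev_map_id (Sec.Hom.mk f τ : s ⟶ t) z' hw)).mpr (hα z')
  have hk : ∀ ω : r ⟶ t, Sec.Hom.base ω = g ≫ f →
      k ≫ ((Over.map f).obj z').hom = z.hom ≫ Sec.Hom.base ω := fun ω hω =>
    (Category.assoc _ _ _).symm.trans (((congrArg (· ≫ f) w').trans (Category.assoc _ _ _)).trans
      (congrArg (z.hom ≫ ·) hω.symm))
  have hω : Sec.Hom.base (χ' ≫ (Sec.Hom.mk f τ : s ⟶ t)) = g ≫ f := congrArg (· ≫ f) hb'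
  refine (cancel_mono
    (Sec.ev (Sec.Hom.mk f τ : s ⟶ t) (z' := (Over.map f).obj z') (𝟙 z'.left) hw)).1 ?_
  refine (Sec.ev_comp χ' (Sec.Hom.mk f τ : s ⟶ t) (z'' := (Over.map f).obj z') k w (𝟙 z'.left) hw k
    (hk _ hω) (Category.comp_id k)).trans (Eq.trans ?_
    (Sec.ev_comp χ (Sec.Hom.mk f τ : s ⟶ t) (z'' := (Over.map f).obj z') k w' (𝟙 z'.left) hw k
    (hk _ rfl) (Category.comp_id k)).symm)
  exact Sec.ev_congr (h₂.trans hχ.symm) rfl _ _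

end

end
-- Traces: comparing the values of a fibred functor with its values at identities.
section

variable {P : Type u} [Category.{v} P]

/-- An arrow of sections from its components. -/
def Sec.mkHom {A : Type u} [Category.{v} A] {B : Type u₁} [Category.{v₁} B] {p : A ⥤ B}
    {X : BasedCategory.{v₂, u₂} B} {s t : Sec p X} (b : s.base ⟶ t.base)
    (Θ : ∀ z : Over s.base, s.val z ⟶ t.val ((Over.map b).obj z))
    (nat : ∀ {z z' : Over s.base} (f : z ⟶ z'), s.act f ≫ Θ z' = Θ z ≫ t.act ((Over.map b).map f))
    (lift : ∀ z : Over s.base, X.p.IsHomLift (𝟙 (p.obj z.left)) (Θ z)) : s ⟶ t :=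
  Sec.Hom.mk b ({ app := Θ, naturality := fun _ _ f => nat f, isHomLift' := lift } :
    BasedNatTrans s.sec ((sumFunctor p (yoMap b)).comp t.sec))

namespace FibFunctor

variable {F : FibCat.{v₃, u₃} P} {X : BasedCategory.{v₂, u₂} P}

/-- The section attached to an object by a functor to the co-free fibred category. -/
def secObj (φ : FibFunctor F (cofree X)) (x : F.toBased.obj) : Sec (𝟭 P) X := φ.toBased.obj x

/-- The arrow of sections attached to an arrow by a functor to the co-free fibred category. -/
def secMap (φ : FibFunctor F (cofree X)) {y x : F.toBased.obj} (u : y ⟶ x) :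
    φ.secObj y ⟶ φ.secObj x := φ.toBased.map u

theorem secMap_comp (φ : FibFunctor F (cofree X)) {y x w : F.toBased.obj} (u : y ⟶ x)
    (u' : x ⟶ w) : φ.secMap (u ≫ u') = φ.secMap u ≫ φ.secMap u' := φ.toBased.map_comp u u'

theorem secMap_id (φ : FibFunctor F (cofree X)) (x : F.toBased.obj) :
    φ.secMap (𝟙 x) = 𝟙 (φ.secObj x) := φ.toBased.map_id x

theorem base_secObj (φ : FibFunctor F (cofree X)) (x : F.toBased.obj) :
    (φ.secObj x).base = F.toBased.p.obj x := φ.toBased.w_obj x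

/-- The value at the identity of the section attached to an object. -/
abbrev evalObj (φ : FibFunctor F (cofree X)) (x : F.toBased.obj) : X.obj :=
  (φ.secObj x).val (Over.mk (𝟙 (φ.secObj x).base))

/-- The action of an arrow on the values at the identity. -/
def evalMap (φ : FibFunctor F (cofree X)) {y x : F.toBased.obj} (u : y ⟶ x) :
    φ.evalObj y ⟶ φ.evalObj x := (cofreeCounit X).map (φ.toBased.map u)

/-- The comparison from the value at the identity of the section attached to `y` to the value of the
section attached to `x`, for an arrow `u : y ⟶ x`. -/
def trace (φ : FibFunctor F (cofree X)) {y x : F.toBased.obj} (u : y ⟶ x)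
    {z : Over (φ.secObj x).base} (k : (φ.secObj y).base ⟶ z.left)
    (w : k ≫ z.hom = Sec.Hom.base (φ.secMap u)) : φ.evalObj y ⟶ (φ.secObj x).val z :=
  Sec.ev (φ.secMap u) (z := Over.mk (𝟙 (φ.secObj y).base)) k (w.trans (Category.id_comp _).symm)

/-- Every object over the base of the section attached to `x` is reached by a universal comparison. -/
theorem exists_trace (φ : FibFunctor F (cofree X)) {x : F.toBased.obj}
    (z : Over (φ.secObj x).base) : ∃ (y : F.toBased.obj) (u : y ⟶ x)
      (k : (φ.secObj y).base ⟶ z.left) (w : k ≫ z.hom = Sec.Hom.base (φ.secMap u)),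
      IsIso k ∧ IsIso (φ.trace u k w) ∧ ∀ (y' : F.toBased.obj) (u' : y' ⟶ x)
        (k' : (φ.secObj y').base ⟶ z.left), k' ≫ z.hom = Sec.Hom.base (φ.secMap u') →
        ∃ m : y' ⟶ y, m ≫ u = u' ∧ Sec.Hom.base (φ.secMap m) ≫ k = k' := by
  have := F.isFibered
  -- Here `y` is a restriction of `x` along `z`. Since `φ` preserves cartesian arrows, the
  -- components of `φ u` are invertible. The base of `φ y` equals `z.left` only propositionally, so
  -- `k` is an `eqToHom`.
  obtain ⟨y, u, hu⟩ := IsPreFibered.exists_isCartesian F.toBased.p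
    (φ.base_secObj x).symm z.hom
  have hu' := toStrong F.isFibered hu
  have hc : (Sec.proj (𝟭 P) X).IsCartesian z.hom (φ.secMap u) := φ.cart z.hom u hu
  have hy : (φ.secObj y).base = z.left :=
    @IsHomLift.domain_eq _ _ _ _ (Sec.proj (𝟭 P) X) _ _ _ _ z.hom (φ.secMap u) hc.toIsHomLift
  have hb := @IsHomLift.fac' _ _ _ _ (Sec.proj (𝟭 P) X) _ _ _ _ z.hom (φ.secMap u) hc.toIsHomLift
  have w : eqToHom hy ≫ z.hom = Sec.Hom.base (φ.secMap u) := by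
    refine Eq.trans ?_ hb.symm
    exact congrArg (eqToHom hy ≫ ·) (Category.comp_id z.hom).symm
  refine ⟨y, u, eqToHom hy, w, inferInstance,
    Sec.isIso_ev_of_isCartesian (φ.secMap u) z.hom hc _ _, fun y' u' k' hk' => ?_⟩
  -- Any other `u'` lies over `k' ≫ z.hom`, hence factors through the strongly cartesian `u`.
  have h₁ : F.toBased.p.IsHomLift (k' ≫ z.hom) u' := by
    rw [hk']
    exact @BasedFunctor.isHomLift_map _ _ _ _ φ.toBased _ _ _ _ (Sec.Hom.base (φ.secMap u')) u'
      (IsHomLift.map (Sec.proj (𝟭 P) X) (φ.secMap u'))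
  let m := Functor.IsStronglyCartesian.map F.toBased.p z.hom u (g := k') rfl u'
  have hm : (Sec.proj (𝟭 P) X).IsHomLift k' (φ.secMap m) :=
    @BasedFunctor.preserves_isHomLift _ _ _ _ φ.toBased _ _ _ _ k' m inferInstance
  refine ⟨m, Functor.IsStronglyCartesian.fac F.toBased.p z.hom u rfl u', ?_⟩
  have hb' : Sec.Hom.base (φ.secMap m) = k' ≫ eqToHom hy.symm :=
    (@IsHomLift.fac' _ _ _ _ (Sec.proj (𝟭 P) X) _ _ _ _ k' (φ.secMap m) hm).trans
      (Category.id_comp _)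
  rw [hb', Category.assoc, eqToHom_trans, eqToHom_refl]
  exact Category.comp_id k'

/-- One trace into the value at `z` is invertible, so traces are jointly epimorphic. Identities
between arrows out of this value are checked by this test from here on. -/
theorem trace_ext (φ : FibFunctor F (cofree X)) {x : F.toBased.obj}
    {z : Over (φ.secObj x).base} {c : X.obj} (m m' : (φ.secObj x).val z ⟶ c)
    (h : ∀ (y : F.toBased.obj) (u : y ⟶ x) (k : (φ.secObj y).base ⟶ z.left)
      (w : k ≫ z.hom = Sec.Hom.base (φ.secMap u)), φ.trace u k w ≫ m = φ.trace u k w ≫ m') :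
    m = m' := by
  obtain ⟨y, u, k, w, -, hi, -⟩ := φ.exists_trace z
  exact (cancel_epi (φ.trace u k w)).1 (h y u k w)

theorem trace_ev (φ : FibFunctor F (cofree X)) {y x : F.toBased.obj} (u : y ⟶ x)
    {z : Over (φ.secObj x).base} (k : (φ.secObj y).base ⟶ z.left)
    (w : k ≫ z.hom = Sec.Hom.base (φ.secMap u)) {x' : F.toBased.obj} (u' : x ⟶ x')
    {z' : Over (φ.secObj x').base} (l : z.left ⟶ z'.left)
    (w' : l ≫ z'.hom = z.hom ≫ Sec.Hom.base (φ.secMap u'))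
    (w'' : (k ≫ l) ≫ z'.hom = Sec.Hom.base (φ.secMap (u ≫ u'))) :
    φ.trace u k w ≫ Sec.ev (φ.secMap u') l w' = φ.trace (u ≫ u') (k ≫ l) w'' := by
  have h : k ≫ l ≫ z'.hom = Sec.Hom.base (φ.secMap u ≫ φ.secMap u') :=
    (Category.assoc _ _ _).symm.trans (w''.trans (congrArg _ (φ.secMap_comp u u')))
  refine (Sec.ev_comp (φ.secMap u) (φ.secMap u') (z := Over.mk (𝟙 (φ.secObj y).base)) k
    (w.trans (Category.id_comp _).symm) l w' (k ≫ l)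
    ((Category.assoc _ _ _).trans (h.trans (Category.id_comp _).symm)) rfl).trans ?_
  exact Sec.ev_congr (φ.secMap_comp u u').symm rfl _ _

theorem trace_act (φ : FibFunctor F (cofree X)) {y x : F.toBased.obj} (u : y ⟶ x)
    {z z' : Over (φ.secObj x).base} (k : (φ.secObj y).base ⟶ z.left)
    (w : k ≫ z.hom = Sec.Hom.base (φ.secMap u)) (f : z ⟶ z')
    (w' : (k ≫ f.left) ≫ z'.hom = Sec.Hom.base (φ.secMap u)) :
    φ.trace u k w ≫ (φ.secObj x).act f = φ.trace u (k ≫ f.left) w' :=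
  Sec.ev_act (φ.secMap u) (z := Over.mk (𝟙 (φ.secObj y).base)) k _ f _

/-- The instance of `trace_ev` at an identity object. It expresses one trace through another by
means of the transpose of `φ` alone. -/
theorem trace_comp (φ : FibFunctor F (cofree X)) {y' y x : F.toBased.obj} (m : y' ⟶ y) (u : y ⟶ x)
    {z : Over (φ.secObj x).base} (k : (φ.secObj y).base ⟶ z.left)
    (w : k ≫ z.hom = Sec.Hom.base (φ.secMap u)) (k' : (φ.secObj y').base ⟶ z.left)
    (hk : Sec.Hom.base (φ.secMap m) ≫ k = k') (u' : y' ⟶ x) (hu : m ≫ u = u')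
    (w' : k' ≫ z.hom = Sec.Hom.base (φ.secMap u')) :
    φ.evalMap m ≫ φ.trace u k w = φ.trace u' k' w' := by
  subst hk hu
  exact φ.trace_ev m (z := Over.mk (𝟙 (φ.secObj y).base)) (Sec.Hom.base (φ.secMap m))
    (Category.comp_id _) u k (w.trans (Category.id_comp _).symm) w'

theorem trace_congr (φ : FibFunctor F (cofree X)) {y x : F.toBased.obj} {u u' : y ⟶ x}
    (hu : u = u') {z : Over (φ.secObj x).base} {k k' : (φ.secObj y).base ⟶ z.left} (hk : k = k')
    (w : k ≫ z.hom = Sec.Hom.base (φ.secMap u)) (w' : k' ≫ z.hom = Sec.Hom.base (φ.secMap u')) :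
    φ.trace u k w = φ.trace u' k' w' := by
  subst hu hk
  rfl

theorem trace_id (φ : FibFunctor F (cofree X)) (x : F.toBased.obj)
    (k : (φ.secObj x).base ⟶ (φ.secObj x).base)
    (w : k ≫ (Over.mk (𝟙 (φ.secObj x).base)).hom = Sec.Hom.base (φ.secMap (𝟙 x))) :
    φ.trace (z := Over.mk (𝟙 (φ.secObj x).base)) (𝟙 x) k w = 𝟙 _ := by
  have hk : k = 𝟙 _ := (Category.comp_id k).symm.trans (w.trans (congrArg _ (φ.secMap_id x)))
  exact (Sec.ev_congr (φ.secMap_id x) rfl _ ((w.trans (congrArg _ (φ.secMap_id x))).trans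
    (Category.id_comp _).symm)).trans (Sec.ev_id_id (φ.secObj x)
      (z := Over.mk (𝟙 (φ.secObj x).base)) k _ hk)

/-- The comparison of the bases of the sections attached to an object by two functors. -/
def baseHom (φ ψ : FibFunctor F (cofree X)) (x : F.toBased.obj) :
    (φ.secObj x).base ⟶ (ψ.secObj x).base :=
  eqToHom ((φ.base_secObj x).trans (ψ.base_secObj x).symm)

@[simp]
theorem baseHom_baseHom (φ ψ : FibFunctor F (cofree X)) (x : F.toBased.obj) :
    φ.baseHom ψ x ≫ ψ.baseHom φ x = 𝟙 _ := by
  simp [baseHom]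

theorem baseHom_naturality (φ ψ : FibFunctor F (cofree X)) {y x : F.toBased.obj} (u : y ⟶ x) :
    Sec.Hom.base (φ.secMap u) ≫ φ.baseHom ψ x = φ.baseHom ψ y ≫ Sec.Hom.base (ψ.secMap u) := by
  have h₁ : Sec.Hom.base (φ.secMap u) = eqToHom (φ.base_secObj y) ≫
      F.toBased.p.map u ≫ eqToHom (φ.base_secObj x).symm := Functor.congr_hom φ.toBased.w u
  have h₂ : Sec.Hom.base (ψ.secMap u) = eqToHom (ψ.base_secObj y) ≫
      F.toBased.p.map u ≫ eqToHom (ψ.base_secObj x).symm := Functor.congr_hom ψ.toBased.w u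
  rw [h₁, h₂]
  simp [baseHom]

/-- Verticality determines the base of each component, so transformations can differ only in their
action on sections. -/
theorem base_app {φ ψ : FibFunctor F (cofree X)} (θ : φ ⟶ ψ) (x : F.toBased.obj) :
    Sec.Hom.base (s := φ.secObj x) (t := ψ.secObj x) (θ.toNatTrans.app x) = φ.baseHom ψ x := by
  have h : Sec.Hom.base (s := φ.secObj x) (t := ψ.secObj x) (θ.toNatTrans.app x) =
      eqToHom (φ.base_secObj x) ≫ 𝟙 _ ≫ eqToHom (ψ.base_secObj x).symm :=
    @IsHomLift.fac' _ _ _ _ (Sec.proj (𝟭 P) X) _ _ (φ.secObj x) (ψ.secObj x) _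
      (θ.toNatTrans.app x) (θ.isHomLift' x)
  refine h.trans ?_
  rw [Category.id_comp, eqToHom_trans]
  rfl

end FibFunctor

end

/-! ### Transposition along the co-free counit is fully faithful. -/

section

variable {P : Type u} [Category.{v} P]

namespace FibFunctor

variable {F : FibCat.{v₃, u₃} P} {X : BasedCategory.{v₂, u₂} P}

/-- Naturality of `θ` at `u`, evaluated at the identity. Only the transpose of `θ` occurs on the
right, which yields faithfulness in view of `trace_ext`. -/
theorem trace_app {φ ψ : FibFunctor F (cofree X)} (θ : φ ⟶ ψ) {y x : F.toBased.obj} (u : y ⟶ x)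
    {z : Over (φ.secObj x).base} {z' : Over (ψ.secObj x).base} (k : (φ.secObj y).base ⟶ z.left)
    (w : k ≫ z.hom = Sec.Hom.base (φ.secMap u)) (l : z.left ⟶ z'.left)
    (w' : l ≫ z'.hom =
      z.hom ≫ Sec.Hom.base (s := φ.secObj x) (t := ψ.secObj x) (θ.toNatTrans.app x))
    (w'' : (ψ.baseHom φ y ≫ k ≫ l) ≫ z'.hom = Sec.Hom.base (ψ.secMap u)) :
    φ.trace u k w ≫ Sec.ev (s := φ.secObj x) (t := ψ.secObj x) (θ.toNatTrans.app x) l w' =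
      (cofreeCounit X).map (θ.toNatTrans.app y) ≫ ψ.trace u (ψ.baseHom φ y ≫ k ≫ l) w'' := by
  let θx : φ.secObj x ⟶ ψ.secObj x := θ.toNatTrans.app x
  let θy : φ.secObj y ⟶ ψ.secObj y := θ.toNatTrans.app y
  have hy : Sec.Hom.base θy = φ.baseHom ψ y := base_app θ y
  have hn : φ.secMap u ≫ θx = θy ≫ ψ.secMap u := θ.toNatTrans.naturality u
  have w₁ : k ≫ z.hom = (Over.mk (𝟙 (φ.secObj y).base)).hom ≫ Sec.Hom.base (φ.secMap u) :=
    w.trans (Category.id_comp _).symm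
  have w₂ : (ψ.baseHom φ y ≫ k ≫ l) ≫ z'.hom =
      (Over.mk (𝟙 (ψ.secObj y).base)).hom ≫ Sec.Hom.base (ψ.secMap u) :=
    w''.trans (Category.id_comp _).symm
  have w₃ : Sec.Hom.base θy ≫ (Over.mk (𝟙 (ψ.secObj y).base)).hom =
      (Over.mk (𝟙 (φ.secObj y).base)).hom ≫ Sec.Hom.base θy :=
    (Category.comp_id _).trans (Category.id_comp _).symm
  have w₄ : (k ≫ l) ≫ z'.hom = (Over.mk (𝟙 (φ.secObj y).base)).hom ≫
      Sec.Hom.base (φ.secMap u ≫ θx) := by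
    refine (Category.assoc _ _ _).trans (((congrArg (k ≫ ·) w').trans
      (Category.assoc _ _ _).symm).trans ?_)
    exact (congrArg (· ≫ Sec.Hom.base θx) w).trans (Category.id_comp _).symm
  have w₅ : (k ≫ l) ≫ z'.hom = (Over.mk (𝟙 (φ.secObj y).base)).hom ≫
      Sec.Hom.base (θy ≫ ψ.secMap u) := by
    rw [← hn]
    exact w₄
  refine (Sec.ev_comp (φ.secMap u) θx (z := Over.mk (𝟙 (φ.secObj y).base)) k w₁ l w' (k ≫ l) w₄ rfl).trans ?_
  refine (Sec.ev_congr hn (z := Over.mk (𝟙 (φ.secObj y).base)) rfl w₄ w₅).trans ?_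
  refine (Sec.ev_comp θy (ψ.secMap u) (z := Over.mk (𝟙 (φ.secObj y).base)) (z' := Over.mk (𝟙 (ψ.secObj y).base))
    (Sec.Hom.base θy) w₃ (ψ.baseHom φ y ≫ k ≫ l) w₂ (k ≫ l) w₅ ?_).symm
  rw [hy]
  exact (Category.assoc _ _ _).symm.trans ((congrArg (· ≫ k ≫ l) (φ.baseHom_baseHom ψ y)).trans
    (Category.id_comp _))

/-- Every natural transformation between the transposes of `φ` and `ψ` extends to the sections. -/
theorem exists_extension (φ ψ : FibFunctor F (cofree X))
    (κ : ∀ y, φ.evalObj y ⟶ ψ.evalObj y)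
    (nat : ∀ {y' y} (m : y' ⟶ y), φ.evalMap m ≫ κ y = κ y' ≫ ψ.evalMap m)
    (lift : ∀ y, X.p.IsHomLift (𝟙 (φ.secObj y).base) (κ y)) {x : F.toBased.obj}
    (z : Over (φ.secObj x).base) :
    ∃ Θ : (φ.secObj x).val z ⟶ (ψ.secObj x).val ((Over.map (φ.baseHom ψ x)).obj z),
      X.p.IsHomLift (𝟙 z.left) Θ ∧
      ∀ (y : F.toBased.obj) (u : y ⟶ x) (k : (φ.secObj y).base ⟶ z.left)
        (w : k ≫ z.hom = Sec.Hom.base (φ.secMap u))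
        (w' : (ψ.baseHom φ y ≫ k) ≫ ((Over.map (φ.baseHom ψ x)).obj z).hom =
          Sec.Hom.base (ψ.secMap u)),
        φ.trace u k w ≫ Θ = κ y ≫
          ψ.trace u (z := (Over.map (φ.baseHom ψ x)).obj z) (ψ.baseHom φ y ≫ k) w' := by
  obtain ⟨y, u, k, w, hk, hi, hu⟩ := φ.exists_trace z
  have hw : ∀ (y : F.toBased.obj) (u : y ⟶ x) (k : (φ.secObj y).base ⟶ z.left),
      k ≫ z.hom = Sec.Hom.base (φ.secMap u) →
      (ψ.baseHom φ y ≫ k) ≫ ((Over.map (φ.baseHom ψ x)).obj z).hom =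
        Sec.Hom.base (ψ.secMap u) := by
    intro y u k w
    change (ψ.baseHom φ y ≫ k) ≫ z.hom ≫ φ.baseHom ψ x = _
    rw [Category.assoc, ← Category.assoc k, w, φ.baseHom_naturality ψ u, ← Category.assoc,
      baseHom_baseHom]
    exact Category.id_comp _
  -- The only possible choice: `κ y` transported along the invertible trace of `φ` and the matching
  -- trace of `ψ`. It is vertical because the three factors lie over `inv k`, an identity and `k`,
  -- once an `eqToHom` is removed.
  refine ⟨inv (φ.trace u k w) ≫ κ y ≫
    ψ.trace u (z := (Over.map (φ.baseHom ψ x)).obj z) (ψ.baseHom φ y ≫ k) (hw y u k w), ?_, ?_⟩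
  · have h₁ : X.p.IsHomLift k (φ.trace u k w) :=
      Sec.ev_isHomLift (φ.secMap u) (z := Over.mk (𝟙 (φ.secObj y).base)) k _
    have h₂ : X.p.IsHomLift (𝟙 (φ.secObj y).base) (κ y) :=
      lift y
    have h₃ : X.p.IsHomLift (ψ.baseHom φ y ≫ k) (ψ.trace u (z := (Over.map (φ.baseHom ψ x)).obj z)
      (ψ.baseHom φ y ≫ k) (hw y u k w)) :=
      Sec.ev_isHomLift (ψ.secMap u) (z := Over.mk (𝟙 (ψ.secObj y).base))
        (z' := (Over.map (φ.baseHom ψ x)).obj z) (ψ.baseHom φ y ≫ k) _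
    have h₄ := (IsHomLift.lift_eqToHom_comp_iff X.p (ψ.baseHom φ y ≫ k) (ψ.trace u
      (z := (Over.map (φ.baseHom ψ x)).obj z) (ψ.baseHom φ y ≫ k) (hw y u k w))
      ((φ.base_secObj y).trans (ψ.base_secObj y).symm)).2 h₃
    have h₅ : X.p.IsHomLift k (ψ.trace u
      (z := (Over.map (φ.baseHom ψ x)).obj z) (ψ.baseHom φ y ≫ k) (hw y u k w)) := by
      have e : eqToHom ((φ.base_secObj y).trans (ψ.base_secObj y).symm) ≫ ψ.baseHom φ y ≫ k = k :=
        by simp [baseHom]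
      rwa [e] at h₄
    have h₆ : X.p.IsHomLift (inv k ≫ 𝟙 (φ.secObj y).base ≫ k) (inv (φ.trace u k w) ≫
      κ y ≫ ψ.trace u (z := (Over.map (φ.baseHom ψ x)).obj z)
        (ψ.baseHom φ y ≫ k) (hw y u k w)) := inferInstance
    rwa [Category.id_comp, IsIso.inv_hom_id] at h₆
  · intro y' u' k' w' w''
    obtain ⟨m, hm, hm'⟩ := hu y' u' k' w'
    rw [← φ.trace_comp m u k w k' hm' u' hm w', Category.assoc, IsIso.hom_inv_id_assoc,
      ← Category.assoc, nat, Category.assoc]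
    congr 1
    refine ψ.trace_comp m u (z := (Over.map (φ.baseHom ψ x)).obj z) (ψ.baseHom φ y ≫ k) _
      (ψ.baseHom φ y' ≫ k') ?_ u' hm w''
    rw [← hm', ← Category.assoc, ψ.baseHom_naturality φ m, Category.assoc]

end FibFunctor

theorem cofreeTranspose_faithful (F : FibCat.{v₃, u₃} P) (X : BasedCategory.{v₂, u₂} P) :
    (cofreeTranspose F X).Faithful where
  map_injective {φ ψ θ κ} h := by
    have hy : ∀ y, (cofreeCounit X).map (θ.toNatTrans.app y) =
        (cofreeCounit X).map (κ.toNatTrans.app y) := fun y =>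
      congrArg (fun m => (BasedNatTrans.toNatTrans m).app y) h
    apply BasedNatTrans.ext
    ext x
    refine Sec.hom_ext_ev (s := φ.secObj x) (t := ψ.secObj x) _ _
      ((FibFunctor.base_app θ x).trans (FibFunctor.base_app κ x).symm) fun z z' l w w' => ?_
    refine φ.trace_ext _ _ fun y u k w₁ => ?_
    have w₂ : (ψ.baseHom φ y ≫ k ≫ l) ≫ z'.hom = Sec.Hom.base (ψ.secMap u) := by
      rw [Category.assoc, Category.assoc, w, FibFunctor.base_app θ x, ← Category.assoc k, w₁,
        φ.baseHom_naturality ψ u, ← Category.assoc, FibFunctor.baseHom_baseHom]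
      exact Category.id_comp _
    exact (FibFunctor.trace_app θ u k w₁ l w w₂).trans ((congrArg (· ≫ _) (hy y)).trans
      (FibFunctor.trace_app κ u k w₁ l w' w₂).symm)

theorem cofreeTranspose_full (F : FibCat.{v₃, u₃} P) (X : BasedCategory.{v₂, u₂} P) :
    (cofreeTranspose F X).Full where
  map_surjective {φ ψ} κ' := by
    let κ : ∀ y, φ.evalObj y ⟶ ψ.evalObj y := κ'.toNatTrans.app
    have nat : ∀ {y' y : F.toBased.obj} (m : y' ⟶ y), φ.evalMap m ≫ κ y = κ y' ≫ ψ.evalMap m :=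
      fun m => κ'.toNatTrans.naturality m
    -- The values of `Θ` are obtained one object `z` at a time. Naturality in `z` and naturality in
    -- `x` are equations between arrows out of a value of `φ`, so both can be tested on traces.
    choose Θ hΘ hΘ' using fun {x} z => φ.exists_extension ψ κ nat
      (fun y => κ'.isHomLift (φ.base_secObj y).symm) (x := x) z
    have hw : ∀ (x y : F.toBased.obj) (z : Over (φ.secObj x).base) (u : y ⟶ x)
        (k : (φ.secObj y).base ⟶ z.left), k ≫ z.hom = Sec.Hom.base (φ.secMap u) →
        (ψ.baseHom φ y ≫ k) ≫ ((Over.map (φ.baseHom ψ x)).obj z).hom =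
          Sec.Hom.base (ψ.secMap u) := by
      intro x y z u k w
      change (ψ.baseHom φ y ≫ k) ≫ z.hom ≫ φ.baseHom ψ x = _
      rw [Category.assoc, ← Category.assoc k, w, φ.baseHom_naturality ψ u, ← Category.assoc,
        FibFunctor.baseHom_baseHom]
      exact Category.id_comp _
    let θ : ∀ x, φ.secObj x ⟶ ψ.secObj x := fun x => Sec.mkHom (φ.baseHom ψ x) Θ
      (by
        intro z z' f
        refine φ.trace_ext _ _ fun y u k w => ?_
        have w₁ : (k ≫ f.left) ≫ z'.hom = Sec.Hom.base (φ.secMap u) := by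
          rw [Category.assoc, Over.w, w]
        rw [← Category.assoc, ← Category.assoc, φ.trace_act u k w f w₁, hΘ' z y u k w (hw _ _ _ _ _ w),
          hΘ' z' y u _ w₁ (hw _ _ _ _ _ w₁), Category.assoc]
        congr 1
        refine Eq.symm ((ψ.trace_act u (z := (Over.map (φ.baseHom ψ x)).obj z)
          (ψ.baseHom φ y ≫ k) _ ((Over.map (φ.baseHom ψ x)).map f) ?_).trans
            (ψ.trace_congr rfl (Category.assoc _ _ _) _ _))
        exact (congrArg (· ≫ _) (Category.assoc _ _ _)).trans (hw _ _ _ _ _ w₁))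
      hΘ
    -- The formula for `Θ` on traces, extended from components to evaluations on arbitrary squares.
    have hθ : ∀ (x y : F.toBased.obj) (u : y ⟶ x) (z : Over (φ.secObj x).base)
        (z' : Over (ψ.secObj x).base) (k : (φ.secObj y).base ⟶ z.left)
        (w : k ≫ z.hom = Sec.Hom.base (φ.secMap u)) (l : z.left ⟶ z'.left)
        (w' : l ≫ z'.hom = z.hom ≫ Sec.Hom.base (θ x))
        (w'' : (ψ.baseHom φ y ≫ k ≫ l) ≫ z'.hom = Sec.Hom.base (ψ.secMap u)),
        φ.trace u k w ≫ Sec.ev (θ x) l w' =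
          κ y ≫ ψ.trace u (ψ.baseHom φ y ≫ k ≫ l) w'' := by
      intro x y u z z' k w l w' w''
      refine (Category.assoc _ _ _).symm.trans ((congrArg (· ≫ _)
        (hΘ' z y u k w (hw _ _ _ _ _ w))).trans ((Category.assoc _ _ _).trans
        (congrArg (κ y ≫ ·) ?_)))
      exact (ψ.trace_act u (z := (Over.map (φ.baseHom ψ x)).obj z) (ψ.baseHom φ y ≫ k) _
        (Over.homMk l w' : (Over.map (φ.baseHom ψ x)).obj z ⟶ z')
        ((congrArg (· ≫ z'.hom) (Category.assoc _ _ _)).trans w'')).trans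
          (ψ.trace_congr rfl (Category.assoc _ _ _) _ _)
    refine ⟨({ app := θ, naturality := fun x x' v => ?_, isHomLift' := fun x => ?_ } :
      BasedNatTrans φ.toBased ψ.toBased), ?_⟩
    · have hb : Sec.Hom.base (φ.secMap v) ≫ φ.baseHom ψ x' =
        φ.baseHom ψ x ≫ Sec.Hom.base (ψ.secMap v) := φ.baseHom_naturality ψ v
      change φ.secMap v ≫ θ x' = θ x ≫ ψ.secMap v
      -- After each composite is cut into two squares and preceded by the trace of `u`, both sides
      -- become `κ y` followed by a trace of `u ≫ v` for `ψ`.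
      refine Sec.hom_ext_ev _ _ hb fun z z' l w w' => ?_
      refine φ.trace_ext _ _ fun y u k w₁ => ?_
      have w₂ : l ≫ z'.hom = z.hom ≫ Sec.Hom.base (φ.secMap v) ≫ φ.baseHom ψ x' := w
      have w₃ : k ≫ z.hom ≫ Sec.Hom.base (φ.secMap v) = Sec.Hom.base (φ.secMap (u ≫ v)) := by
        rw [← Category.assoc, w₁, φ.secMap_comp]
        rfl
      have w₄ : (ψ.baseHom φ y ≫ k ≫ l) ≫ z'.hom = Sec.Hom.base (ψ.secMap (u ≫ v)) := by
        rw [Category.assoc, Category.assoc, w₂]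
        have e : k ≫ z.hom ≫ Sec.Hom.base (φ.secMap v) ≫ φ.baseHom ψ x' =
            Sec.Hom.base (φ.secMap (u ≫ v)) ≫ φ.baseHom ψ x' := by
          rw [← w₃, Category.assoc, Category.assoc]
        rw [e, φ.baseHom_naturality ψ, ← Category.assoc, FibFunctor.baseHom_baseHom]
        exact Category.id_comp _
      have e₁ := Sec.ev_comp (φ.secMap v) (θ x')
        (z' := (Over.map (Sec.Hom.base (φ.secMap v))).obj z) (z'' := z') (𝟙 z.left)
        (Category.id_comp _) l (w₂.trans (Category.assoc _ _ _).symm) l w (Category.id_comp l)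
      have e₂ := Sec.ev_comp (θ x) (ψ.secMap v) (z' := (Over.map (φ.baseHom ψ x)).obj z)
        (z'' := z') (𝟙 z.left) (Category.id_comp _) l (w'.trans (Category.assoc _ _ _).symm) l w'
        (Category.id_comp l)
      refine (congrArg (φ.trace u k w₁ ≫ ·) e₁.symm).trans
        (Eq.trans ?_ (congrArg (φ.trace u k w₁ ≫ ·) e₂))
      refine (Category.assoc _ _ _).symm.trans (Eq.trans ?_ (Category.assoc _ _ _))
      have w₅ : (k ≫ 𝟙 z.left) ≫ ((Over.map (Sec.Hom.base (φ.secMap v))).obj z).hom =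
          Sec.Hom.base (φ.secMap (u ≫ v)) :=
        (congrArg (· ≫ _) (Category.comp_id k)).trans w₃
      have w₆ : (ψ.baseHom φ y ≫ (k ≫ 𝟙 z.left) ≫ l) ≫ z'.hom =
          Sec.Hom.base (ψ.secMap (u ≫ v)) := by
        rw [Category.comp_id]
        exact w₄
      have w₇ : (ψ.baseHom φ y ≫ k ≫ 𝟙 z.left) ≫ ((Over.map (φ.baseHom ψ x)).obj z).hom =
          Sec.Hom.base (ψ.secMap u) := by
        rw [Category.comp_id]
        exact hw _ _ _ _ _ w₁
      refine (congrArg (· ≫ _) (φ.trace_ev u (z := z) k w₁ v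
        (z' := (Over.map (Sec.Hom.base (φ.secMap v))).obj z) (𝟙 z.left) _ w₅)).trans ?_
      refine (hθ x' y (u ≫ v)
        ((Over.map (Sec.Hom.base (φ.secMap v))).obj z) z' (k ≫ 𝟙 z.left) w₅ l _ w₆).trans ?_
      refine Eq.symm ((congrArg (· ≫ _) (hθ x y u z ((Over.map (φ.baseHom ψ x)).obj z) k w₁
        (𝟙 z.left) (Category.id_comp _) w₇)).trans ((Category.assoc _ _ _).trans
          (congrArg (κ y ≫ ·) ?_)))
      have w₈ : ((ψ.baseHom φ y ≫ k ≫ 𝟙 z.left) ≫ l) ≫ z'.hom =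
          Sec.Hom.base (ψ.secMap (u ≫ v)) := by
        rw [Category.comp_id, Category.assoc (ψ.baseHom φ y)]
        exact w₄
      refine (ψ.trace_ev u (z := (Over.map (φ.baseHom ψ x)).obj z) _ w₇ v l _ w₈).trans
        (ψ.trace_congr rfl ?_ _ _)
      simp only [Category.assoc]
    · have h : (Sec.proj (𝟭 P) X).IsHomLift (φ.baseHom ψ x) (θ x) :=
        IsHomLift.map (Sec.proj (𝟭 P) X) (θ x)
      have h' : (Sec.proj (𝟭 P) X).IsHomLift (eqToHom (φ.base_secObj x).symm ≫ φ.baseHom ψ x ≫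
        eqToHom (ψ.base_secObj x)) (θ x) := inferInstance
      have e : eqToHom (φ.base_secObj x).symm ≫ φ.baseHom ψ x ≫ eqToHom (ψ.base_secObj x) =
        𝟙 (F.toBased.p.obj x) := by simp [FibFunctor.baseHom]
      rwa [e] at h'
    · apply BasedNatTrans.ext
      ext x
      have hk : 𝟙 (φ.secObj x).base ≫ (Over.mk (𝟙 (φ.secObj x).base)).hom =
          Sec.Hom.base (φ.secMap (𝟙 x)) :=
        (Category.id_comp _).trans (congrArg Sec.Hom.base (φ.secMap_id x)).symm
      have hk' : (ψ.baseHom φ x ≫ 𝟙 _ ≫ φ.baseHom ψ x) ≫ (Over.mk (𝟙 (ψ.secObj x).base)).hom =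
          Sec.Hom.base (ψ.secMap (𝟙 x)) := by
        rw [Category.id_comp, FibFunctor.baseHom_baseHom]
        exact (Category.id_comp _).trans (congrArg Sec.Hom.base (ψ.secMap_id x)).symm
      -- The trace of `𝟙 x` at the identity is an identity, so the transpose of the new
      -- transformation is `κ`.
      have h := hθ x x (𝟙 x) (Over.mk (𝟙 _)) (Over.mk (𝟙 _)) (𝟙 _) hk (φ.baseHom ψ x)
        ((Category.comp_id _).trans (Category.id_comp _).symm) hk'
      refine (Eq.trans ?_ h).trans ?_
      · exact (Category.id_comp _).symm.trans (congrArg (· ≫ _) (φ.trace_id x _ hk).symm)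
      · exact (congrArg (κ x ≫ ·) (ψ.trace_id x _ hk')).trans (Category.comp_id _)

end

/-! ### Essential surjectivity of transposition: chosen restrictions in a fibration. -/

section

variable {P : Type u} [Category.{v} P]

namespace FibCat

variable (F : FibCat.{v₃, u₃} P)

/-- A chosen restriction of `x` along an arrow to its base. -/
noncomputable def pull (x : F.toBased.obj) (z : Over (F.toBased.p.obj x)) : F.toBased.obj :=
  letI := F.isFibered
  Functor.IsPreFibered.pullbackObj (p := F.toBased.p) (a := x) rfl z.hom

/-- The cartesian arrow from a chosen restriction. -/
noncomputable def pullπ (x : F.toBased.obj) (z : Over (F.toBased.p.obj x)) : F.pull x z ⟶ x :=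
  letI := F.isFibered
  Functor.IsPreFibered.pullbackMap (p := F.toBased.p) (a := x) rfl z.hom

instance (x : F.toBased.obj) (z : Over (F.toBased.p.obj x)) :
    F.toBased.p.IsStronglyCartesian z.hom (F.pullπ x z) := by
  have := F.isFibered
  exact toStrong F.isFibered (Functor.IsPreFibered.pullbackMap.IsCartesian rfl z.hom)

/-- The chosen restriction along the identity is isomorphic to the object. -/
noncomputable def pullIso (x : F.toBased.obj) :
    F.pull x (Over.mk (𝟙 (F.toBased.p.obj x))) ≅ x :=
  letI : IsIso (F.pullπ x (Over.mk (𝟙 (F.toBased.p.obj x)))) :=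
    @Functor.IsStronglyCartesian.isIso_of_base_isIso _ _ _ _ F.toBased.p _ _ _ _
      (𝟙 (F.toBased.p.obj x)) (F.pullπ x (Over.mk (𝟙 (F.toBased.p.obj x))))
      (inferInstanceAs (F.toBased.p.IsStronglyCartesian
        (Over.mk (𝟙 (F.toBased.p.obj x))).hom (F.pullπ x (Over.mk (𝟙 (F.toBased.p.obj x))))))
      inferInstance
  asIso (F.pullπ x (Over.mk (𝟙 (F.toBased.p.obj x))))

variable {F}
variable {x y w : F.toBased.obj}

theorem isHomLift_pullπ_comp (v : x ⟶ y) {z : Over (F.toBased.p.obj x)}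
    {z' : Over (F.toBased.p.obj y)} (k : z.left ⟶ z'.left)
    (h : k ≫ z'.hom = z.hom ≫ F.toBased.p.map v) :
    F.toBased.p.IsHomLift (k ≫ z'.hom) (F.pullπ x z ≫ v) := by
  rw [h]
  infer_instance

/-- The arrow between chosen restrictions induced by a square. -/
noncomputable def pullMap (v : x ⟶ y) {z : Over (F.toBased.p.obj x)}
    {z' : Over (F.toBased.p.obj y)} (k : z.left ⟶ z'.left)
    (h : k ≫ z'.hom = z.hom ≫ F.toBased.p.map v) : F.pull x z ⟶ F.pull y z' :=
  letI := isHomLift_pullπ_comp v k h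
  Functor.IsStronglyCartesian.map F.toBased.p z'.hom (F.pullπ y z') (g := k) rfl (F.pullπ x z ≫ v)

theorem pullMap_isHomLift (v : x ⟶ y) {z : Over (F.toBased.p.obj x)}
    {z' : Over (F.toBased.p.obj y)} (k : z.left ⟶ z'.left)
    (h : k ≫ z'.hom = z.hom ≫ F.toBased.p.map v) : F.toBased.p.IsHomLift k (pullMap v k h) :=
  letI := isHomLift_pullπ_comp v k h
  Functor.IsStronglyCartesian.map_isHomLift F.toBased.p z'.hom (F.pullπ y z') (g := k) rfl
    (F.pullπ x z ≫ v)

theorem pullMap_pullπ (v : x ⟶ y) {z : Over (F.toBased.p.obj x)}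
    {z' : Over (F.toBased.p.obj y)} (k : z.left ⟶ z'.left)
    (h : k ≫ z'.hom = z.hom ≫ F.toBased.p.map v) :
    pullMap v k h ≫ F.pullπ y z' = F.pullπ x z ≫ v :=
  letI := isHomLift_pullπ_comp v k h
  Functor.IsStronglyCartesian.fac F.toBased.p z'.hom (F.pullπ y z') (g := k) rfl (F.pullπ x z ≫ v)

theorem pull_hom_ext {c : F.toBased.obj} {R : P} {z' : Over (F.toBased.p.obj y)}
    (k : R ⟶ z'.left) (m m' : c ⟶ F.pull y z') (hm : F.toBased.p.IsHomLift k m)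
    (hm' : F.toBased.p.IsHomLift k m') (h : m ≫ F.pullπ y z' = m' ≫ F.pullπ y z') : m = m' :=
  Functor.IsStronglyCartesian.ext F.toBased.p z'.hom (F.pullπ y z') k h

/-- Factorisations through a cartesian arrow are unique, so restriction is strictly functorial on
squares even though no splitting of `F` has been chosen. -/
theorem pullMap_comp (v : x ⟶ y) (v' : y ⟶ w) {z : Over (F.toBased.p.obj x)}
    {z' : Over (F.toBased.p.obj y)} {z'' : Over (F.toBased.p.obj w)} (k : z.left ⟶ z'.left)
    (h : k ≫ z'.hom = z.hom ≫ F.toBased.p.map v) (l : z'.left ⟶ z''.left)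
    (h' : l ≫ z''.hom = z'.hom ≫ F.toBased.p.map v') (u : x ⟶ w) (m : z.left ⟶ z''.left)
    (h'' : m ≫ z''.hom = z.hom ≫ F.toBased.p.map u) (e : k ≫ l = m) (e' : v ≫ v' = u) :
    pullMap v k h ≫ pullMap v' l h' = pullMap u m h'' := by
  subst e e'
  have := pullMap_isHomLift v k h
  have := pullMap_isHomLift v' l h'
  refine pull_hom_ext (k ≫ l) _ _ inferInstance (pullMap_isHomLift _ _ _) ?_
  rw [Category.assoc, pullMap_pullπ, pullMap_pullπ, ← Category.assoc, pullMap_pullπ,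
    Category.assoc]

theorem pullMap_id (x : F.toBased.obj) (z : Over (F.toBased.p.obj x))
    (h : 𝟙 z.left ≫ z.hom = z.hom ≫ F.toBased.p.map (𝟙 x)) :
    pullMap (𝟙 x) (𝟙 z.left) h = 𝟙 (F.pull x z) := by
  refine pull_hom_ext (𝟙 z.left) _ _ (pullMap_isHomLift _ _ _)
    (IsHomLift.id (IsHomLift.domain_eq F.toBased.p z.hom (F.pullπ x z))) ?_
  rw [pullMap_pullπ, Category.comp_id, Category.id_comp]

/-- Composed with a cartesian arrow, `pullMap v k h` becomes the cartesian arrow `F.pullπ x z ≫ v`.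
It is therefore cartesian itself, over the isomorphism `k`. -/
theorem isIso_pullMap (v : x ⟶ y) (hv : F.toBased.p.IsCartesian (F.toBased.p.map v) v)
    {z : Over (F.toBased.p.obj x)} {z' : Over (F.toBased.p.obj y)} (k : z.left ⟶ z'.left) [IsIso k]
    (h : k ≫ z'.hom = z.hom ≫ F.toBased.p.map v) : IsIso (pullMap v k h) := by
  have := toStrong F.isFibered hv
  have := pullMap_isHomLift v k h
  have : F.toBased.p.IsStronglyCartesian (k ≫ z'.hom) (pullMap v k h ≫ F.pullπ y z') := by
    rw [h, pullMap_pullπ]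
    infer_instance
  have := Functor.IsStronglyCartesian.of_comp (p := F.toBased.p) (f := k) (g := z'.hom)
    (φ := pullMap v k h) (ψ := F.pullπ y z')
  exact Functor.IsStronglyCartesian.isIso_of_base_isIso F.toBased.p k (pullMap v k h)

end FibCat

open FibCat

section

variable {F : FibCat.{v₃, u₃} P} {X : BasedCategory.{v₂, u₂} P}

/-- Reads an arrow of the slice as a square over `𝟙 x`, so that `pullMap` serves both for arrows of
the slice and for arrows of `F`. -/
theorem over_pull_w {x : F.toBased.obj} {z z' : Over (F.toBased.p.obj x)} (f : z ⟶ z') :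
    f.left ≫ z'.hom = z.hom ≫ F.toBased.p.map (𝟙 x) := by
  rw [Over.w, F.toBased.p.map_id]
  exact (Category.comp_id _).symm

/-- The section of `X` given by restriction of `x` followed by a functor to `X`. -/
noncomputable def pullSec (ψ : BasedFunctor F.toBased X) (x : F.toBased.obj) : Sec (𝟭 P) X where
  base := F.toBased.p.obj x
  sec := basedFunctorOfLifts (X := sumBased (𝟭 P) (yoBased (F.toBased.p.obj x)))
    { obj := fun z : Over (F.toBased.p.obj x) => ψ.obj (F.pull x z)
      map := fun {z z' : Over (F.toBased.p.obj x)} (f : z ⟶ z') =>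
        ψ.map (pullMap (𝟙 x) f.left (over_pull_w f))
      map_id := fun z : Over (F.toBased.p.obj x) =>
        (congrArg (fun m => ψ.map m) (pullMap_id x z _)).trans (ψ.map_id _)
      map_comp := fun {z z' z'' : Over (F.toBased.p.obj x)} (f : z ⟶ z') (g : z' ⟶ z'') =>
        (congrArg (fun m => ψ.map m) (pullMap_comp (𝟙 x) (𝟙 x) f.left (over_pull_w f) g.left
          (over_pull_w g) (𝟙 x) _ (over_pull_w (f ≫ g)) rfl (Category.comp_id _)).symm).trans
          (ψ.map_comp _ _) }
    fun {z z' : Over (F.toBased.p.obj x)} (f : z ⟶ z') =>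
      @BasedFunctor.preserves_isHomLift _ _ _ _ ψ _ _ _ _ f.left _
        (pullMap_isHomLift (𝟙 x) f.left (over_pull_w f))

/-- The action of `pullSec` on arrows. -/
noncomputable def pullSecMap (ψ : BasedFunctor F.toBased X) {x y : F.toBased.obj} (v : x ⟶ y) :
    pullSec ψ x ⟶ pullSec ψ y :=
  Sec.mkHom (s := pullSec ψ x) (t := pullSec ψ y) (F.toBased.p.map v)
    (fun z : Over (F.toBased.p.obj x) => ψ.map (pullMap v
      (z' := (Over.map (F.toBased.p.map v)).obj z) (𝟙 z.left) (Category.id_comp _)))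
    (by
      intro (z : Over (F.toBased.p.obj x)) (z' : Over (F.toBased.p.obj x)) f
      change ψ.map (pullMap (𝟙 x) f.left (over_pull_w f)) ≫ _ =
        _ ≫ ψ.map (pullMap (𝟙 y) (z := (Over.map (F.toBased.p.map v)).obj z)
          (z' := (Over.map (F.toBased.p.map v)).obj z') f.left (over_pull_w ((Over.map (F.toBased.p.map v)).map f)))
      refine (ψ.map_comp _ _).symm.trans (Eq.trans (congrArg (fun m => ψ.map m) ?_)
        (ψ.map_comp _ _))
      have h : f.left ≫ ((Over.map (F.toBased.p.map v)).obj z').hom =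
          z.hom ≫ F.toBased.p.map v :=
        (Category.assoc _ _ _).symm.trans (congrArg (· ≫ F.toBased.p.map v) (Over.w f))
      refine (pullMap_comp (𝟙 x) v (z' := z') (z'' := (Over.map (F.toBased.p.map v)).obj z')
        f.left (over_pull_w f) (𝟙 z'.left) (Category.id_comp _) v f.left h (Category.comp_id _)
        (Category.id_comp _)).trans ?_
      exact (pullMap_comp v (𝟙 y) (z' := (Over.map (F.toBased.p.map v)).obj z)
        (z'' := (Over.map (F.toBased.p.map v)).obj z') (𝟙 z.left) (Category.id_comp _) f.left
        (over_pull_w ((Over.map (F.toBased.p.map v)).map f)) v f.left h (Category.id_comp _)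
        (Category.comp_id _)).symm)
    (fun z : Over (F.toBased.p.obj x) =>
      @BasedFunctor.preserves_isHomLift _ _ _ _ ψ _ _ _ _ (𝟙 z.left) _ (pullMap_isHomLift v
        (z' := (Over.map (F.toBased.p.map v)).obj z) (𝟙 z.left) (Category.id_comp _)))

/-- Every evaluation has the same form, which reduces functoriality of `pullFunctor` to
`pullMap_comp`. -/
theorem pullSecMap_ev (ψ : BasedFunctor F.toBased X) {x y : F.toBased.obj} (v : x ⟶ y)
    {z : Over (F.toBased.p.obj x)} {z' : Over (F.toBased.p.obj y)} (k : z.left ⟶ z'.left)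
    (h : k ≫ z'.hom = z.hom ≫ F.toBased.p.map v) :
    Sec.ev (pullSecMap ψ v) (z := z) (z' := z') k h = ψ.map (pullMap v k h) :=
  (ψ.map_comp _ _).symm.trans (congrArg (fun m => ψ.map m) (pullMap_comp v (𝟙 y)
    (z' := (Over.map (F.toBased.p.map v)).obj z) (𝟙 z.left) (Category.id_comp _) k
    (over_pull_w (Over.homMk k h : (Over.map (F.toBased.p.map v)).obj z ⟶ z')) v k h
    (Category.id_comp _) (Category.comp_id _)))

/-- Restriction of objects of a fibred category `F`, followed by a functor to `X`, as a fibred functor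
from `F` to the co-free fibred category on `X`. -/
noncomputable def pullFunctor (ψ : BasedFunctor F.toBased X) : FibFunctor F (cofree X) where
  toBased := basedFunctorOfLifts (Y := (cofree X).toBased)
    { obj := fun x => pullSec ψ x
      map := fun v => pullSecMap ψ v
      map_id := fun x => by
        refine Sec.hom_ext_ev (s := pullSec ψ x) (t := pullSec ψ x) _ (𝟙 (pullSec ψ x))
          (F.toBased.p.map_id x) fun z z' k w w' => ?_
        refine (pullSecMap_ev ψ (𝟙 x) k w).trans (Eq.symm ?_)
        exact Sec.ev_id (pullSec ψ x) (Over.homMk k (w'.trans (Category.comp_id _)) : z ⟶ z') w'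
      map_comp := fun {x y y'} v v' => by
        refine Sec.hom_ext_ev (s := pullSec ψ x) (t := pullSec ψ y') _
          (pullSecMap ψ v ≫ pullSecMap ψ v') (F.toBased.p.map_comp v v')
          fun (z : Over (F.toBased.p.obj x)) (z' : Over (F.toBased.p.obj y')) k w w' => ?_
        refine (pullSecMap_ev ψ (v ≫ v') k w).trans (Eq.symm ?_)
        have h : k ≫ z'.hom = (z.hom ≫ F.toBased.p.map v) ≫ F.toBased.p.map v' :=
          w'.trans (Category.assoc _ _ _).symm
        refine (Sec.ev_comp (pullSecMap ψ v) (pullSecMap ψ v') (z := z)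
          (z' := (Over.map (F.toBased.p.map v)).obj z) (z'' := z') (𝟙 z.left)
          (Category.id_comp _) k h k w' (Category.id_comp _)).symm.trans ?_
        refine (congrArg₂ (· ≫ ·) (pullSecMap_ev ψ v _ _) (pullSecMap_ev ψ v' _ _)).trans ?_
        exact (ψ.map_comp _ _).symm.trans (congrArg (fun m => ψ.map m)
          (pullMap_comp _ _ _ _ _ _ _ _ w (Category.id_comp _) rfl)) }
    fun {x y} v => IsHomLift.map (Sec.proj (𝟭 P) X) (pullSecMap ψ v)
  cart := by
    intro R S f x y v hv
    have hx : F.toBased.p.obj x = R := IsHomLift.domain_eq F.toBased.p f v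
    have hy : F.toBased.p.obj y = S := IsHomLift.codomain_eq F.toBased.p f v
    subst hx hy
    obtain rfl := IsHomLift.eq_of_isHomLift F.toBased.p f v
    -- For cartesian `v`, restricting `x` along `z` agrees, up to isomorphism, with restricting `y`
    -- along `z` followed by the image of `v`.
    refine toCart (Sec.isStronglyCartesian_of_isIso (pullSecMap ψ v) fun z => ?_)
    have := isIso_pullMap v hv (z := z) (z' := (Over.map (F.toBased.p.map v)).obj z)
      (𝟙 z.left) (Category.id_comp _)
    exact inferInstanceAs (IsIso (ψ.map (pullMap v (z := z)
      (z' := (Over.map (F.toBased.p.map v)).obj z) (𝟙 z.left) (Category.id_comp _))))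

/-- The transpose of `pullFunctor ψ` is isomorphic to `ψ`. -/
noncomputable def pullFunctorIso (ψ : BasedFunctor F.toBased X) :
    (pullFunctor ψ).toBased.comp (cofreeCounit X) ≅ ψ :=
  BasedNatIso.mkNatIso
    (NatIso.ofComponents
      (fun x => ψ.toFunctor.mapIso (F.pullIso x))
      fun {x y} v => by
        refine (congrArg (· ≫ _) (pullSecMap_ev ψ v (z := Over.mk (𝟙 (F.toBased.p.obj x)))
          (z' := Over.mk (𝟙 (F.toBased.p.obj y))) (F.toBased.p.map v)
          ((Category.comp_id _).trans (Category.id_comp _).symm))).trans ?_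
        exact (ψ.map_comp _ _).symm.trans ((congrArg (fun m => ψ.map m)
          (pullMap_pullπ _ _ _)).trans (ψ.map_comp _ _)))
    fun x => @BasedFunctor.preserves_isHomLift _ _ _ _ ψ _ _ _ _ (𝟙 (F.toBased.p.obj x))
      (F.pullπ x (Over.mk (𝟙 (F.toBased.p.obj x))))
      (inferInstanceAs (F.toBased.p.IsHomLift (Over.mk (𝟙 (F.toBased.p.obj x))).hom
        (F.pullπ x (Over.mk (𝟙 (F.toBased.p.obj x))))))

end

theorem cofreeTranspose_isEquivalence (F : FibCat.{v₃, u₃} P) (X : BasedCategory.{v₂, u₂} P) :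
    (cofreeTranspose F X).IsEquivalence where
  faithful := cofreeTranspose_faithful F X
  full := cofreeTranspose_full F X
  essSurj := ⟨fun ψ => ⟨pullFunctor ψ, ⟨pullFunctorIso ψ⟩⟩⟩

end

/-! ### The universal property of base change, and the saturation equivalence. -/

section

variable {P : Type u} [Category.{v} P] {Q : Type u₁} [Category.{v₁} Q]

theorem PullObj.base_eq_of_isHomLift {h : P ⥤ Q} {X : BasedCategory.{v₂, u₂} Q} {x y : PullObj h X}
    {R S : P} (f : R ⟶ S) (m m' : x ⟶ y) (hm : (PullObj.proj h X).IsHomLift f m)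
    (hm' : (PullObj.proj h X).IsHomLift f m') : PullObj.Hom.base m = PullObj.Hom.base m' :=
  (@IsHomLift.fac' _ _ _ _ (PullObj.proj h X) _ _ _ _ f m hm).trans
    (@IsHomLift.fac' _ _ _ _ (PullObj.proj h X) _ _ _ _ f m' hm').symm

/-- The two bases agree only propositionally, so the pair of an identity and `k` exists only after
substitution. The existential form lets `choose` supply components in the proof of fullness. -/
theorem PullObj.exists_vertical {h : P ⥤ Q} {X : BasedCategory.{v₂, u₂} Q} {x y : PullObj h X}
    {a : P} (hx : x.base = a) (hy : y.base = a) (k : x.fib ⟶ y.fib)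
    (hk : X.p.IsHomLift (𝟙 (h.obj a)) k) :
    ∃ m : x ⟶ y, PullObj.Hom.fib m = k ∧ (PullObj.proj h X).IsHomLift (𝟙 a) m := by
  subst hx
  obtain ⟨y, yf, yw⟩ := y
  obtain rfl : y = x.base := hy
  refine ⟨⟨𝟙 x.base, k, by rwa [h.map_id]⟩, rfl, ?_⟩
  exact IsHomLift.map (PullObj.proj h X)
    (PullObj.Hom.mk (𝟙 x.base) k _ : x ⟶ ⟨x.base, yf, yw⟩)

section

variable {h : P ⥤ Q} {Z : BasedCategory.{v₃, u₃} P} {X : BasedCategory.{v₂, u₂} Q}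

/-- The functor to the base change induced by a functor over `Q`. -/
def pairFunctor (f : BasedFunctor (sumBased h Z) X) : BasedFunctor Z (baseChange h X) where
  obj := fun z => (⟨Z.p.obj z, f.obj z, f.w_obj z⟩ : PullObj h X)
  map := fun {z z'} m => PullObj.Hom.mk (Z.p.map m) (f.map m)
    (@BasedFunctor.preserves_isHomLift _ _ _ _ f _ _ _ _ (h.map (Z.p.map m)) m
      (IsHomLift.map (Z.p ⋙ h) m))
  map_id := fun z => PullObj.Hom.ext (Z.p.map_id z) (f.map_id z)
  map_comp := fun m m' => PullObj.Hom.ext (Z.p.map_comp m m') (f.map_comp m m')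
  w := rfl

/-- The transformation to the base change induced by a transformation over `Q`. -/
def pairTrans {f g : BasedFunctor (sumBased h Z) X} (θ : f ⟶ g) : pairFunctor f ⟶ pairFunctor g :=
  ({ app := fun z => PullObj.Hom.mk (𝟙 (Z.p.obj z)) (θ.toNatTrans.app z)
       ((congrArg (fun k => X.p.IsHomLift k (θ.toNatTrans.app z)) (h.map_id _)).mpr
         (θ.isHomLift' z))
     naturality := fun z z' m => PullObj.Hom.ext
       ((Category.comp_id _).trans (Category.id_comp _).symm) (θ.toNatTrans.naturality m)
     isHomLift' := fun z => @IsHomLift.map _ _ _ _ (PullObj.proj h X) _ _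
       (PullObj.Hom.mk (x := (pairFunctor f).obj z) (y := (pairFunctor g).obj z)
         (𝟙 (Z.p.obj z)) (θ.toNatTrans.app z) _) } :
    BasedNatTrans (pairFunctor f) (pairFunctor g))

theorem pairTrans_comp {f g k : BasedFunctor (sumBased h Z) X} (θ : f ⟶ g) (κ : g ⟶ k) :
    pairTrans (θ ≫ κ) = pairTrans θ ≫ pairTrans κ := by
  apply BasedNatTrans.ext
  ext z
  exact PullObj.Hom.ext (Category.id_comp _).symm rfl

theorem pairTrans_id (f : BasedFunctor (sumBased h Z) X) :
    pairTrans (𝟙 f) = 𝟙 (pairFunctor f) := by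
  apply BasedNatTrans.ext
  ext z
  exact rfl

end

/-- An arrow of the pullback is a pair; transposition keeps its part in `X`, and verticality fixes
its part in `P`. -/
theorem baseChangeTranspose_faithful (h : P ⥤ Q) (Z : BasedCategory.{v₃, u₃} P)
    (X : BasedCategory.{v₂, u₂} Q) : (baseChangeTranspose h Z X).Faithful where
  map_injective {φ ψ θ κ} e := by
    apply BasedNatTrans.ext
    ext z
    have hz : PullObj.Hom.fib (θ.toNatTrans.app z) = PullObj.Hom.fib (κ.toNatTrans.app z) :=
      congrArg (fun m : (baseChangeTranspose h Z X).obj φ ⟶ (baseChangeTranspose h Z X).obj ψ =>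
        (BasedNatTrans.toNatTrans m).app z) e
    exact PullObj.Hom.ext
      (PullObj.base_eq_of_isHomLift (𝟙 (Z.p.obj z)) _ _ (θ.isHomLift' z) (κ.isHomLift' z)) hz

theorem baseChangeTranspose_full (h : P ⥤ Q) (Z : BasedCategory.{v₃, u₃} P)
    (X : BasedCategory.{v₂, u₂} Q) : (baseChangeTranspose h Z X).Full where
  map_surjective {φ ψ} κ := by
    choose m hm hm' using fun z => PullObj.exists_vertical (x := φ.obj z) (y := ψ.obj z)
      (φ.w_obj z) (ψ.w_obj z) (κ.toNatTrans.app z) (κ.isHomLift' z)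
    refine ⟨({ app := m, naturality := fun z z' v => ?_, isHomLift' := hm' } :
      BasedNatTrans φ ψ), ?_⟩
    · have h₁ : (PullObj.proj h X).IsHomLift (Z.p.map v) (φ.map v) :=
        inferInstanceAs ((baseChange h X).p.IsHomLift (Z.p.map v) (φ.map v))
      have h₂ : (PullObj.proj h X).IsHomLift (Z.p.map v) (ψ.map v) :=
        inferInstanceAs ((baseChange h X).p.IsHomLift (Z.p.map v) (ψ.map v))
      have h₃ := @IsHomLift.comp _ _ _ _ (PullObj.proj h X) _ _ _ _ _ _ _ _ _ _ h₁ (hm' z')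
      have h₄ := @IsHomLift.comp _ _ _ _ (PullObj.proj h X) _ _ _ _ _ _ _ _ _ _ (hm' z) h₂
      rw [Category.comp_id] at h₃
      rw [Category.id_comp] at h₄
      refine PullObj.Hom.ext (PullObj.base_eq_of_isHomLift (Z.p.map v) _ _ h₃ h₄) ?_
      have hn : PullObj.Hom.fib (φ.map v) ≫ κ.toNatTrans.app z' =
        κ.toNatTrans.app z ≫ PullObj.Hom.fib (ψ.map v) := κ.toNatTrans.naturality v
      exact (congrArg (PullObj.Hom.fib (φ.map v) ≫ ·) (hm z')).trans (hn.trans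
        (congrArg (· ≫ PullObj.Hom.fib (ψ.map v)) (hm z)).symm)
    · apply BasedNatTrans.ext
      ext z
      exact hm z

theorem baseChangeTranspose_isEquivalence (h : P ⥤ Q) (Z : BasedCategory.{v₃, u₃} P)
    (X : BasedCategory.{v₂, u₂} Q) : (baseChangeTranspose h Z X).IsEquivalence where
  faithful := baseChangeTranspose_faithful h Z X
  full := baseChangeTranspose_full h Z X
  -- Pairing with the display map and projecting back to `X` returns `f` itself, definitionally.
  essSurj := ⟨fun f => ⟨pairFunctor f, ⟨Iso.refl f⟩⟩⟩

theorem saturationTranspose_isEquivalence (h : P ⥤ Q) (F : FibCat.{v₃, u₃} P)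
    (X : BasedCategory.{v₂, u₂} Q) : (saturationTranspose h F X).IsEquivalence :=
  have := cofreeTranspose_isEquivalence F (baseChange h X)
  have := baseChangeTranspose_isEquivalence h F.toBased X
  inferInstanceAs (cofreeTranspose F (baseChange h X) ⋙
    baseChangeTranspose h F.toBased X).IsEquivalence

end

/-! ### A criterion for equivalences of fibrations. -/

section

variable {B : Type u₁} [Category.{v₁} B]

/-- Every functor over `B` reflects the relation of lying over an arrow, and full faithfulness lifts
factorisations and their uniqueness. -/
theorem isCartesian_of_map {X : BasedCategory.{v₂, u₂} B} {Y : BasedCategory.{v₃, u₃} B}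
    (f : BasedFunctor X Y) [f.toFunctor.Full] [f.toFunctor.Faithful] {R S : B} (k : R ⟶ S)
    {a b : X.obj} (n : a ⟶ b) (h : Y.p.IsCartesian k (f.map n)) : X.p.IsCartesian k n := by
  have : X.p.IsHomLift k n := f.isHomLift_map k n
  constructor
  intro a' m hm
  have h₁ : Y.p.IsHomLift k (f.map m) := inferInstance
  obtain ⟨χ, ⟨h₂, h₃⟩, h₄⟩ := h.universal_property (f.map m)
  obtain ⟨χ, rfl⟩ := f.toFunctor.map_surjective χ
  refine ⟨χ, ⟨f.isHomLift_map (𝟙 R) χ, f.toFunctor.map_injective ((f.map_comp χ n).trans h₃)⟩, ?_⟩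
  rintro χ' ⟨h₅, h₆⟩
  refine f.toFunctor.map_injective (h₄ _ ⟨?_, ?_⟩)
  · exact f.preserves_isHomLift (𝟙 R) χ'
  · exact (f.map_comp χ' n).symm.trans (congrArg (fun m => f.map m) h₆)

/-- A fully faithful fibred functor which is essentially surjective on fibres is an equivalence. -/
theorem FibFunctor.exists_equivalence {E F : FibCat.{v₂, u₂} B} (f : E ⟶ F)
    (full : (FibFunctor.toBased f).toFunctor.Full)
    (faithful : (FibFunctor.toBased f).toFunctor.Faithful)
    (surj : ∀ y : F.toBased.obj, ∃ (x : E.toBased.obj) (e : (FibFunctor.toBased f).obj x ≅ y),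
      F.toBased.p.IsHomLift (𝟙 (F.toBased.p.obj y)) e.hom) : ∃ e : E ≌ F, e.hom = f := by
  choose x e he using surj
  let f₀ : E.toBased.obj ⥤ F.toBased.obj := (FibFunctor.toBased f).toFunctor
  have : f₀.Full := full
  have : f₀.Faithful := faithful
  let g₀ : F.toBased.obj ⥤ E.toBased.obj :=
    { obj := x
      map := fun {y y'} m => f₀.preimage ((e y).hom ≫ m ≫ (e y').inv)
      map_id := fun y => f₀.map_injective (by
        rw [f₀.map_preimage, f₀.map_id, Category.id_comp, Iso.hom_inv_id])
      map_comp := fun {y y' y''} m m' => f₀.map_injective (by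
        rw [f₀.map_comp, f₀.map_preimage, f₀.map_preimage, f₀.map_preimage]
        simp only [Category.assoc, Iso.inv_hom_id_assoc]) }
  have hg : ∀ {y y' : F.toBased.obj} (m : y ⟶ y'),
      f₀.map (g₀.map m) = (e y).hom ≫ m ≫ (e y').inv := fun m => f₀.map_preimage _
  have he' : ∀ y, F.toBased.p.IsHomLift (𝟙 (F.toBased.p.obj y)) (e y).inv := fun y =>
    IsHomLift.lift_id_inv F.toBased.p _ (e y)
  let g : FibFunctor F E :=
    { toBased := basedFunctorOfLifts g₀ fun {y y'} m => by
        have : F.toBased.p.IsHomLift (F.toBased.p.map m) (f₀.map (g₀.map m)) := by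
          rw [hg]
          infer_instance
        exact @BasedFunctor.isHomLift_map _ _ _ _ (FibFunctor.toBased f) _ _ _ _ _ _ this
      cart := by
        intro R S k y y' m hm
        refine isCartesian_of_map (FibFunctor.toBased f) k (g₀.map m) ?_
        have hR : F.toBased.p.obj y = R := IsHomLift.domain_eq F.toBased.p k m
        have hS : F.toBased.p.obj y' = S := IsHomLift.codomain_eq F.toBased.p k m
        subst hR hS
        have : F.toBased.p.IsCartesian k (f₀.map (g₀.map m)) := by
          rw [hg]
          have h₁ : F.toBased.p.IsHomLift (𝟙 _) (e y').symm.hom := he' y'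
          have h₂ : F.toBased.p.IsCartesian k (m ≫ (e y').inv) :=
            Functor.IsCartesian.of_comp_iso F.toBased.p k m (e y').symm
          exact Functor.IsCartesian.of_iso_comp F.toBased.p k (m ≫ (e y').inv) (e y)
        exact this }
  let c : g.comp f ≅ (⟨BasedFunctor.id _, fun _ _ _ _ _ _ h => h⟩ : FibFunctor F F) :=
    BasedNatIso.toFib (BasedNatIso.mkNatIso (NatIso.ofComponents e fun {y y'} m => by
      change f₀.map (g₀.map m) ≫ (e y').hom = (e y).hom ≫ m
      rw [hg, Category.assoc, Category.assoc, Iso.inv_hom_id, Category.comp_id]) he)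
  let η' : f₀ ⋙ g₀ ≅ 𝟭 _ := NatIso.ofComponents
    (fun a => f₀.preimageIso (e (f₀.obj a))) fun {a a'} m => f₀.map_injective (by
      change f₀.map (g₀.map (f₀.map m) ≫ _) = f₀.map (_ ≫ m)
      rw [f₀.map_comp, f₀.map_comp, hg]
      simp)
  let d : FibFunctor.comp f g ≅ (⟨BasedFunctor.id _, fun _ _ _ _ _ _ h => h⟩ : FibFunctor E E) :=
    BasedNatIso.toFib (BasedNatIso.mkNatIso (F := (FibFunctor.comp f g).toBased)
      (G := BasedFunctor.id _) η' fun a => by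
      have h : F.toBased.p.IsHomLift (𝟙 (E.toBased.p.obj a)) (f₀.map (η'.hom.app a)) := by
        have h₁ : f₀.map (η'.hom.app a) = (e (f₀.obj a)).hom := f₀.map_preimage _
        rw [h₁, ← (FibFunctor.toBased f).w_obj a]
        exact he (f₀.obj a)
      exact @BasedFunctor.isHomLift_map _ _ _ _ (FibFunctor.toBased f) _ _ _ _ _ _ h)
  -- Passing to an adjoint equivalence alters only a 2-cell, so the 1-cell is still `f`.
  exact ⟨Equivalence.mkOfAdjointifyCounit (B := FibCat B) (f := f) (g := g) d.symm c, rfl⟩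

end

/-! ### The comparison of saturation with oplax base change over the point. -/

section

variable {P : Type u} [Category.{v} P] {Q : Type u₁} [Category.{v₁} Q]

/-- Functors between fibred categories over the point preserve cartesian arrows. -/
theorem preservesCartesian_pt {X : BasedCategory.{v₂, u₂} Pt} {Y : BasedCategory.{v₃, u₃} Pt}
    (hX : X.p.IsFibered) (F : BasedFunctor X Y) : PreservesCartesian F := by
  intro R S g a b φ hφ
  have h₁ : X.p.IsStronglyCartesian g φ := toStrong hX hφ
  -- All arrows of the point are invertible, so cartesian arrows above them are isomorphisms.
  -- Functors preserve these, and an isomorphism lying over an arrow is cartesian.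
  have : IsIso g := ⟨eqToHom (Subsingleton.elim S R), Subsingleton.elim _ _, Subsingleton.elim _ _⟩
  have : IsIso φ := Functor.IsStronglyCartesian.isIso_of_base_isIso X.p g φ
  have : IsIso (F.map φ) := Functor.map_isIso F.toFunctor φ
  have := isHomLift_pt Y.p g (F.map φ)
  infer_instance

section

variable {h : P ⥤ Q} {X : BasedCategory.{v₂, u₂} Q}

/-- A section of the base change along `h`, as a section over `Q`. -/
def Sec.unpair (s : Sec (𝟭 P) (baseChange h X)) : Sec h X :=
  ⟨s.base, (sumFunctor h s.sec).comp (baseChangeCounit h X)⟩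

/-- An arrow of sections of the base change along `h`, as an arrow of sections over `Q`. -/
def Sec.unpairMap {s t : Sec (𝟭 P) (baseChange h X)} (α : s ⟶ t) : s.unpair ⟶ t.unpair :=
  Sec.Hom.mk (s := s.unpair) (t := t.unpair) (Sec.Hom.base (s := s) (t := t) α)
    (BasedCategory.whiskerRight (sumTrans h (Sec.Hom.trans (s := s) (t := t) α))
      (baseChangeCounit h X))

/-- For a fixed base arrow, `Sec.unpairMap` is base change transposition on the slice. This gives
injectivity from faithfulness and, in the next lemma, surjectivity from fullness. -/
theorem Sec.unpairMap_injective {s t : Sec (𝟭 P) (baseChange h X)} :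
    Function.Injective (Sec.unpairMap (s := s) (t := t)) := by
  rintro ⟨a, α⟩ ⟨b, β⟩ e
  obtain rfl : a = b := congrArg Sec.Hom.base e
  have e' := eq_of_heq (Sec.Hom.mk.inj e).2
  have := baseChangeTranspose_faithful h (sumBased (𝟭 P) (yoBased s.base)) X
  exact congrArg (Sec.Hom.mk a)
    ((baseChangeTranspose h (sumBased (𝟭 P) (yoBased s.base)) X).map_injective e')

theorem Sec.unpairMap_surjective {s t : Sec (𝟭 P) (baseChange h X)} :
    Function.Surjective (Sec.unpairMap (s := s) (t := t)) := by
  rintro ⟨a, τ⟩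
  have := baseChangeTranspose_full h (sumBased (𝟭 P) (yoBased s.base)) X
  obtain ⟨α, rfl⟩ := (baseChangeTranspose h (sumBased (𝟭 P) (yoBased s.base)) X).map_surjective
    (X := s.sec) (Y := (sumFunctor (𝟭 P) (yoMap a)).comp t.sec) τ
  exact ⟨⟨a, α⟩, rfl⟩

end

section

variable (h : P ⥤ Pt) [hh : h.IsFibered] (E : FibCat.{v₂, u₂} Pt)

/-- The comparison from the co-free fibred category on the base change to the oplax base change, over
the point. -/
def unpairFib : FibFunctor (cofree (baseChange h E.toBased)) (oplaxBaseChange h E) where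
  toBased :=
    { obj := fun s : Sec (𝟭 P) (baseChange h E.toBased) =>
        -- The fibredness condition on objects of the oplax base change is automatic over the point.
        (⟨s.base, s.unpair.sec, preservesCartesian_pt (oplaxSum h (yo s.base)).isFibered _⟩ :
          OplObj h E)
      map := fun {s t : Sec (𝟭 P) (baseChange h E.toBased)} α => Sec.unpairMap (s := s) (t := t) α
      map_id := fun _ => rfl
      map_comp := fun _ _ => rfl
      w := rfl }
  cart := PreservesCartesian.of_lifts _ fun (s : Sec (𝟭 P) (baseChange h E.toBased)) R f =>
    ⟨s.restrict f, s.lift f, toCart (s.lift_isStronglyCartesian f),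
      toCart (OplObj.lift_isStronglyCartesian (⟨s.base, s.unpair.sec,
        preservesCartesian_pt (oplaxSum h (yo s.base)).isFibered _⟩ : OplObj h E) f)⟩

theorem unpairFib_exists_equivalence :
    ∃ e : cofree (baseChange h E.toBased) ≌ oplaxBaseChange h E, e.hom = unpairFib h E :=
  FibFunctor.exists_equivalence (unpairFib h E)
    ⟨fun {s t} α => Sec.unpairMap_surjective (s := s) (t := t) α⟩
    ⟨fun {s t} _ _ e => Sec.unpairMap_injective (s := s) (t := t) e⟩
    -- The comparison is strictly surjective on objects, since projecting a paired functor returns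
    -- it.
    fun s : OplObj h E => ⟨(⟨s.base, pairFunctor (Z := yoBased s.base) s.sec.toBased⟩ :
      Sec (𝟭 P) (baseChange h E.toBased)), Iso.refl s,
        IsHomLift.id (p := OplObj.proj h E) (a := s) rfl⟩

end

end

/-! ### Identities up to equality, and pseudonaturality between strict 2-functors. -/

section

/-- A morphism which is an identity up to an equality of objects. -/
def IsEqTo {C : Type*} [Category* C] {a b : C} (f : a ⟶ b) : Prop := ∃ h : a = b, f = eqToHom h

namespace IsEqTo

variable {C : Type*} [Category* C] {D : Type*} [Category* D]

theorem id (a : C) : IsEqTo (𝟙 a) := ⟨rfl, rfl⟩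

theorem comp {a b c : C} {f : a ⟶ b} {g : b ⟶ c} (hf : IsEqTo f) (hg : IsEqTo g) :
    IsEqTo (f ≫ g) := by
  obtain ⟨rfl, rfl⟩ := hf
  obtain ⟨rfl, rfl⟩ := hg
  exact ⟨rfl, by simp⟩

/-- Proof irrelevance of the equality of objects. Coherence axioms whose two sides are built from
such arrows follow from this. -/
theorem eq {a b : C} {f g : a ⟶ b} (hf : IsEqTo f) (hg : IsEqTo g) : f = g := by
  obtain ⟨h, rfl⟩ := hf
  obtain ⟨_, rfl⟩ := hg
  rfl

theorem map (F : C ⥤ D) {a b : C} {f : a ⟶ b} (hf : IsEqTo f) : IsEqTo (F.map f) := by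
  obtain ⟨rfl, rfl⟩ := hf
  exact ⟨rfl, by simp⟩

theorem isIso {a b : C} {f : a ⟶ b} (hf : IsEqTo f) : IsIso f := by
  obtain ⟨rfl, rfl⟩ := hf
  infer_instance

/-- A natural transformation whose components are identities up to equality is an identity up to
equality. -/
theorem of_app {F G : C ⥤ D} (α : F ⟶ G) (h : ∀ x, IsEqTo (α.app x)) : IsEqTo α := by
  have : ∀ x, IsIso (α.app x) := fun x => (h x).isIso
  obtain rfl : F = G := CategoryTheory.Functor.ext_of_iso (NatIso.ofComponents
    (fun x => asIso (α.app x)) fun f => α.naturality f) (fun x => (h x).1) fun x => (h x).2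
  refine ⟨rfl, ?_⟩
  ext x
  exact (h x).eq (IsEqTo.id _)

end IsEqTo

theorem IsEqTo.whiskerLeft {C : Type*} [Bicategory C] {a b c : C} (f : a ⟶ b) {g h : b ⟶ c}
    {η : g ⟶ h} (hη : IsEqTo η) : IsEqTo (f ◁ η) := by
  obtain ⟨rfl, rfl⟩ := hη
  exact ⟨rfl, by simp⟩

theorem IsEqTo.whiskerRight {C : Type*} [Bicategory C] {a b c : C} {f g : a ⟶ b}
    {η : f ⟶ g} (hη : IsEqTo η) (h : b ⟶ c) : IsEqTo (η ▷ h) := by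
  obtain ⟨rfl, rfl⟩ := hη
  exact ⟨rfl, by simp⟩

theorem IsEqTo.map₂ {C : Type*} [Bicategory C] {D : Type*} [Bicategory D] (F : C ⥤ᵖ D) {a b : C}
    {f g : a ⟶ b} {η : f ⟶ g} (hη : IsEqTo η) : IsEqTo (F.map₂ η) := by
  obtain ⟨rfl, rfl⟩ := hη
  exact ⟨rfl, by simp⟩

theorem isEqTo_associator {C : Type*} [Bicategory C] [Bicategory.Strict C] {a b c d : C} (f : a ⟶ b)
    (g : b ⟶ c) (h : c ⟶ d) : IsEqTo (α_ f g h).hom := by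
  rw [Bicategory.Strict.associator_eqToIso]
  exact ⟨Bicategory.Strict.assoc f g h, rfl⟩

theorem isEqTo_associator_inv {C : Type*} [Bicategory C] [Bicategory.Strict C] {a b c d : C}
    (f : a ⟶ b) (g : b ⟶ c) (h : c ⟶ d) : IsEqTo (α_ f g h).inv := by
  rw [Bicategory.Strict.associator_eqToIso]
  exact ⟨(Bicategory.Strict.assoc f g h).symm, rfl⟩

theorem isEqTo_leftUnitor {C : Type*} [Bicategory C] [Bicategory.Strict C] {a b : C} (f : a ⟶ b) :
    IsEqTo (λ_ f).hom := by
  rw [Bicategory.Strict.leftUnitor_eqToIso]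
  exact ⟨Bicategory.Strict.id_comp f, rfl⟩

theorem isEqTo_rightUnitor_inv {C : Type*} [Bicategory C] [Bicategory.Strict C] {a b : C}
    (f : a ⟶ b) : IsEqTo (ρ_ f).inv := by
  rw [Bicategory.Strict.rightUnitor_eqToIso]
  exact ⟨(Bicategory.Strict.comp_id f).symm, rfl⟩

/-- A pseudofunctor whose coherence cells are identities up to equality. -/
structure IsStrictPseudo {C : Type*} [Bicategory C] {D : Type*} [Bicategory D] (F : C ⥤ᵖ D) :
    Prop where
  mapId : ∀ a, IsEqTo (F.mapId a).hom
  mapComp : ∀ {a b c : C} (f : a ⟶ b) (g : b ⟶ c), IsEqTo (F.mapComp f g).hom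

theorem IsStrictPseudo.comp {C : Type*} [Bicategory C] {D : Type*} [Bicategory D] {E : Type*}
    [Bicategory E] {F : C ⥤ᵖ D} {G : D ⥤ᵖ E} (hF : IsStrictPseudo F) (hG : IsStrictPseudo G) :
    IsStrictPseudo (F.comp G) where
  mapId a := IsEqTo.comp ((hF.mapId a).map₂ G) (hG.mapId (F.obj a))
  mapComp f g := IsEqTo.comp ((hF.mapComp f g).map₂ G) (hG.mapComp (F.map f) (F.map g))

/-- A pseudonatural transformation of strict pseudofunctors from naturality cells which are identities
up to equality. -/
def strongTransOfStrict {C : Type*} [Bicategory C] {D : Type*} [Bicategory D] [Bicategory.Strict D]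
    {F G : C ⥤ᵖ D} (hF : IsStrictPseudo F) (hG : IsStrictPseudo G) (app : ∀ a, F.obj a ⟶ G.obj a)
    (nat : ∀ {a b : C} (f : a ⟶ b), F.map f ≫ app b ≅ app a ≫ G.map f)
    (hnat : ∀ {a b : C} (f : a ⟶ b), IsEqTo (nat f).hom)
    (nat₂ : ∀ {a b : C} {f g : a ⟶ b} (η : f ⟶ g),
      F.map₂ η ▷ app b ≫ (nat g).hom = (nat f).hom ≫ app a ◁ G.map₂ η) :
    Pseudofunctor.StrongTrans F G where
  app := app
  naturality := nat
  naturality_naturality := nat₂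
  -- In the unit and composition axioms both sides are composites of identities up to equality. The
  -- content lies in `nat₂`, naturality for 2-cells.
  naturality_id a := ((hnat _).comp ((hG.mapId a).whiskerLeft (app a))).eq
    (((hF.mapId a).whiskerRight (app a)).comp
      ((isEqTo_leftUnitor _).comp (isEqTo_rightUnitor_inv _)))
  naturality_comp {a b c} f g := ((hnat _).comp ((hG.mapComp f g).whiskerLeft (app a))).eq
    (((hF.mapComp f g).whiskerRight (app c)).comp ((isEqTo_associator _ _ _).comp
      (((hnat g).whiskerLeft (F.map f)).comp ((isEqTo_associator_inv _ _ _).comp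
        (((hnat f).whiskerRight (G.map g)).comp (isEqTo_associator _ _ _))))))

section

variable {B : Type u₁} [Category.{v₁} B]

instance : Bicategory.Strict (FibCat.{v₂, u₂} B) where
  id_comp _ := rfl
  comp_id _ := rfl
  assoc _ _ _ := rfl
  leftUnitor_eqToIso _ := by
    ext1
    rfl
  rightUnitor_eqToIso _ := by
    ext1
    rfl
  associator_eqToIso _ _ _ := by
    ext1
    rfl

/-- Compatibility with the displays is a proposition, so equality of the underlying functors
suffices. -/
theorem IsEqTo.based_of_app {X : BasedCategory.{v₂, u₂} B} {Y : BasedCategory.{v₃, u₃} B}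
    {f g : BasedFunctor X Y} (α : f ⟶ g) (h : ∀ x, IsEqTo (α.toNatTrans.app x)) : IsEqTo α := by
  obtain ⟨f, hf⟩ := f
  obtain ⟨g, hg⟩ := g
  obtain ⟨e, e'⟩ := IsEqTo.of_app α.toNatTrans h
  obtain rfl : f = g := e
  exact ⟨rfl, BasedNatTrans.ext _ _ e'⟩

theorem IsEqTo.fib_of_app {E : FibCat.{v₂, u₂} B} {F : FibCat.{v₃, u₃} B}
    {f g : FibFunctor E F} (α : f ⟶ g) (h : ∀ x, IsEqTo (BasedNatTrans.toNatTrans α |>.app x)) :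
    IsEqTo α := by
  obtain ⟨f, hf⟩ := f
  obtain ⟨g, hg⟩ := g
  obtain ⟨e, e'⟩ := IsEqTo.based_of_app α h
  obtain rfl : f = g := e
  exact ⟨rfl, e'⟩

theorem forgetPseudo_isStrictPseudo : IsStrictPseudo (forgetPseudo.{v₂, u₂} B) where
  mapId _ := ⟨rfl, rfl⟩
  mapComp _ _ := ⟨rfl, rfl⟩

theorem cofreePseudo_isStrictPseudo : IsStrictPseudo (cofreePseudo.{v₂, u₂} B) where
  mapId _ := ⟨rfl, rfl⟩
  mapComp _ _ := ⟨rfl, rfl⟩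

theorem baseChangePseudo_isStrictPseudo {A : Type u} [Category.{v} A] (h : A ⥤ B) :
    IsStrictPseudo (baseChangePseudo.{v₂, u₂} h) where
  mapId _ := ⟨rfl, rfl⟩
  mapComp _ _ := ⟨rfl, rfl⟩

theorem oplaxBaseChangePseudo_isStrictPseudo {A : Type u} [Category.{v} A] (h : A ⥤ B)
    [h.IsFibered] : IsStrictPseudo (oplaxBaseChangePseudo.{v₂, u₂} h) where
  mapId _ := ⟨rfl, rfl⟩
  mapComp _ _ := ⟨rfl, rfl⟩

theorem catToFib_isStrictPseudo : IsStrictPseudo catToFib.{v₂, u₂} where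
  mapId _ := ⟨rfl, rfl⟩
  mapComp _ _ := ⟨rfl, rfl⟩

theorem id_isStrictPseudo {C : Type*} [Bicategory C] : IsStrictPseudo (Pseudofunctor.id C) where
  mapId _ := ⟨rfl, rfl⟩
  mapComp _ _ := ⟨rfl, rfl⟩

end

end

/-! ### Pseudonaturality of the comparison over the point. -/

section

variable (C : Type u) [Category.{v} C]

theorem unpair_postTrans {P : Type u} [Category.{v} P] {Q : Type u₁} [Category.{v₁} Q] (h : P ⥤ Q)
    {X : BasedCategory.{v₂, u₂} Q} {Y : BasedCategory.{v₃, u₃} Q}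
    {F G : BasedFunctor X Y} (θ : F ⟶ G) (s : Sec (𝟭 P) (baseChange h X)) :
    Sec.unpairMap (Sec.postTrans (baseChangeMap₂ h θ) s) = Sec.postTrans θ s.unpair := rfl

/-- The comparison from the co-free fibred category on the base change to the oplax base change, as a
pseudonatural transformation. -/
def unpairTrans : Pseudofunctor.StrongTrans
    (catToFib.{v₂, u₂}.comp ((forgetPseudo Pt).comp
      ((baseChangePseudo (Functor.star C)).comp (cofreePseudo C))))
    (catToFib.{v₂, u₂}.comp (oplaxBaseChangePseudo (Functor.star C))) :=
  strongTransOfStrict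
    (catToFib_isStrictPseudo.comp (forgetPseudo_isStrictPseudo.comp
      ((baseChangePseudo_isStrictPseudo _).comp cofreePseudo_isStrictPseudo)))
    (catToFib_isStrictPseudo.comp (oplaxBaseChangePseudo_isStrictPseudo _))
    (fun E => unpairFib (Functor.star C : C ⥤ Pt) (pointFib E))
    -- Both routes around the naturality square are definitionally equal: postcomposition commutes
    -- with projection out of the pullback.
    (fun {E E'} f => Iso.refl (FibFunctor.comp (cofreeMap (baseChangeMap (Functor.star C)
      (pointFibMap f.toFunctor).toBased)) (unpairFib (Functor.star C : C ⥤ Pt) (pointFib E'))))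
    (fun f => ⟨rfl, rfl⟩)
    (fun {E E' f g} θ => by
      refine (Category.comp_id _).trans (Eq.trans ?_ (Category.id_comp _).symm)
      apply BasedNatTrans.ext
      ext s
      exact unpair_postTrans _ (pointFibMap₂ θ.toNatTrans) s)

theorem pseudoEquiv_saturation_oplaxBaseChange_pt : PseudoEquiv
    (catToFib.{v₂, u₂}.comp ((forgetPseudo Pt).comp
      ((baseChangePseudo (Functor.star C)).comp (cofreePseudo C))))
    (catToFib.{v₂, u₂}.comp (oplaxBaseChangePseudo (Functor.star C))) :=
  ⟨unpairTrans C, fun E => unpairFib_exists_equivalence (Functor.star C : C ⥤ Pt) (pointFib E)⟩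

end

/-! ### The counit, and the co-free construction over the point. -/

section

variable {P : Type u} [Category.{v} P] {X : BasedCategory.{v₂, u₂} P} {Y : BasedCategory.{v₃, u₃} P}

/-- Evaluation at the identity is natural. -/
def cofreeCounitIso (F : BasedFunctor X Y) :
    (cofreeMap F).toBased.comp (cofreeCounit Y) ≅ (cofreeCounit X).comp F :=
  BasedNatIso.mkNatIso
    (NatIso.ofComponents (fun s => Iso.refl _) fun {s t : Sec (𝟭 P) X} α =>
      (Category.comp_id _).trans (Eq.trans (F.map_comp _ _).symm (Category.id_comp _).symm))
    fun s => IsHomLift.id (((cofreeCounit X).comp F).w_obj s)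

theorem cofreeCounitIso_isEqTo (F : BasedFunctor X Y) : IsEqTo (cofreeCounitIso F).hom :=
  IsEqTo.based_of_app _ fun x => ⟨rfl, rfl⟩

/-- Whiskering by `θ` inserts the action of `overId`, and evaluation at the identity inserts the
action of its inverse; these cancel and leave a component of `θ`. -/
theorem cofreeCounitIso_naturality {F G : BasedFunctor X Y} (θ : F ⟶ G) :
    BasedCategory.whiskerRight (F := (cofreeMap F).toBased) (G := (cofreeMap G).toBased)
      (cofreeMap₂ θ) (cofreeCounit Y) ≫ (cofreeCounitIso G).hom =
    (cofreeCounitIso F).hom ≫ BasedCategory.whiskerLeft (cofreeCounit X) θ := by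
  apply BasedNatTrans.ext
  ext (s : Sec (𝟭 P) X)
  refine (Category.comp_id _).trans (Eq.trans ?_ (Category.id_comp _).symm)
  change (θ.toNatTrans.app _ ≫ G.map (s.act (overId _))) ≫ G.map (s.act _) = θ.toNatTrans.app _
  rw [Category.assoc]
  refine Eq.trans (congrArg (θ.toNatTrans.app _ ≫ ·) ?_) (Category.comp_id _)
  refine (G.map_comp _ _).symm.trans (Eq.trans (congrArg (fun m => G.map m) ?_) (G.map_id _))
  refine (Sec.act_comp s _ _).trans (Eq.trans (congrArg s.act ?_) (s.act_id _))
  ext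
  exact Category.comp_id _

end

/-- Evaluation at the identity over the point, as a pseudonatural transformation. -/
def cofreeCounitTrans : Pseudofunctor.StrongTrans
    ((cofreePseudo.{v₂, max u₂ v₂} Pt).comp (forgetPseudo Pt))
    (Pseudofunctor.id (BasedCategory.{v₂, max u₂ v₂} Pt)) :=
  strongTransOfStrict (cofreePseudo_isStrictPseudo.comp forgetPseudo_isStrictPseudo)
    id_isStrictPseudo
    (fun X => cofreeCounit X)
    (fun F => cofreeCounitIso F)
    (fun F => cofreeCounitIso_isEqTo F)
    (fun θ => cofreeCounitIso_naturality θ)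

theorem pt_isFibered {C : Type u} [Category.{v} C] (p : C ⥤ Pt) : p.IsFibered :=
  Functor.IsFibered.of_exists_isStronglyCartesian fun x R f => by
    have := isHomLift_pt p f (𝟙 x)
    exact ⟨x, 𝟙 x, inferInstance⟩

/-- As `X` is itself fibred, transposing its identity gives `i` with `ε ∘ i ≅ id`. Both `i ∘ ε` and
the identity are fibred, and their transposes `ε ∘ i ∘ ε` and `ε` are isomorphic, so full
faithfulness gives `i ∘ ε ≅ id`. The universe `max u₂ v₂` puts `X` and its co-free fibration in the
same 2-category. -/
theorem cofreeCounit_exists_equivalence (X : BasedCategory.{v₂, max u₂ v₂} Pt) :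
    ∃ e : (cofree X).toBased ≌ X, e.hom = cofreeCounit X := by
  let F : FibCat.{v₂, max u₂ v₂} Pt := ⟨X, pt_isFibered X.p⟩
  have := cofreeTranspose_isEquivalence F X
  have := cofreeTranspose_isEquivalence (cofree X) X
  let i : FibFunctor F (cofree X) := (cofreeTranspose F X).objPreimage (BasedFunctor.id X)
  let ei : i.toBased.comp (cofreeCounit X) ≅ BasedFunctor.id X :=
    (cofreeTranspose F X).objObjPreimageIso (BasedFunctor.id X)
  let c : FibFunctor (cofree X) (cofree X) :=
    ⟨(cofreeCounit X).comp i.toBased, preservesCartesian_pt (cofree X).isFibered _⟩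
  let d : FibFunctor (cofree X) (cofree X) := ⟨BasedFunctor.id _, fun _ _ _ _ _ _ h => h⟩
  let e : (cofreeTranspose (cofree X) X).obj c ≅ (cofreeTranspose (cofree X) X).obj d :=
    whiskerLeftIso (B := BasedCategory Pt) (a := (cofree X).toBased) (b := X) (c := X)
      (cofreeCounit X) ei
  let e' : c ≅ d := (cofreeTranspose (cofree X) X).preimageIso e
  let e'' : c.toBased ≅ d.toBased := ⟨e'.hom, e'.inv, e'.hom_inv_id, e'.inv_hom_id⟩
  exact ⟨Equivalence.mkOfAdjointifyCounit (B := BasedCategory Pt) (a := (cofree X).toBased)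
    (b := X) (f := cofreeCounit X) (g := i.toBased) e''.symm ei, rfl⟩

theorem pseudoEquiv_cofree_pt : PseudoEquiv
    ((cofreePseudo.{v₂, max u₂ v₂} Pt).comp (forgetPseudo Pt))
    (Pseudofunctor.id (BasedCategory.{v₂, max u₂ v₂} Pt)) :=
  ⟨cofreeCounitTrans.{v₂, u₂}, fun X => cofreeCounit_exists_equivalence.{v₂, u₂} X⟩

/-! ### Vertical arrows of sections. -/

section

variable {A : Type u} [Category.{v} A] {B : Type u₁} [Category.{v₁} B] {p : A ⥤ B}
  {X : BasedCategory.{v₂, u₂} B}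

/-- The arrow of sections over an identity given by a vertical transformation. -/
def Sec.vert {a : A} {σ τ : BasedFunctor (sumBased p (yoBased a)) X} (θ : σ ⟶ τ) :
    (⟨a, σ⟩ : Sec p X) ⟶ ⟨a, τ⟩ :=
  Sec.Hom.mk (s := ⟨a, σ⟩) (t := ⟨a, τ⟩) (𝟙 a)
    (θ ≫ BasedCategory.whiskerRight (sumTrans p (yoMapId a)) τ)

theorem Sec.vert_ev {a : A} {σ τ : BasedFunctor (sumBased p (yoBased a)) X} (θ : σ ⟶ τ)
    {z z' : Over a} (k : z.left ⟶ z'.left) (w : k ≫ z'.hom = z.hom ≫ 𝟙 a) (f : z ⟶ z')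
    (hf : f.left = k) :
    Sec.ev (Sec.vert θ) (z := z) (z' := z') k w = θ.toNatTrans.app z ≫ τ.map f := by
  subst hf
  refine (Category.assoc _ _ _).trans (congrArg (θ.toNatTrans.app z ≫ ·) ?_)
  refine (τ.map_comp (overId z) (Over.homMk f.left w)).symm.trans
    (congrArg (fun m => τ.map m) (Over.OverMorphism.ext ?_))
  exact Category.id_comp f.left

theorem Sec.vert_id {a : A} (σ : BasedFunctor (sumBased p (yoBased a)) X) :
    Sec.vert (𝟙 σ) = 𝟙 (⟨a, σ⟩ : Sec p X) :=
  congrArg (Sec.Hom.mk (s := ⟨a, σ⟩) (t := ⟨a, σ⟩) (𝟙 a)) (Category.id_comp _)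

/-- Reduces a square with two vertical sides to its components. The composites lie over `b ≫ 𝟙 a'`
and `𝟙 a ≫ b`, hence the detour through evaluation on squares. -/
theorem Sec.vert_naturality {a a' : A} {σ σ' : BasedFunctor (sumBased p (yoBased a)) X}
    {τ τ' : BasedFunctor (sumBased p (yoBased a')) X} (b : a ⟶ a')
    (α : σ ⟶ (sumFunctor p (yoMap b)).comp τ) (α' : σ' ⟶ (sumFunctor p (yoMap b)).comp τ')
    (θ : σ ⟶ σ') (κ : τ ⟶ τ')
    (h : ∀ z : Over a, α.toNatTrans.app z ≫ κ.toNatTrans.app ((Over.map b).obj z) =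
      θ.toNatTrans.app z ≫ α'.toNatTrans.app z) :
    (Sec.Hom.mk (s := ⟨a, σ⟩) (t := ⟨a', τ⟩) b α : (⟨a, σ⟩ : Sec p X) ⟶ ⟨a', τ⟩) ≫ Sec.vert κ =
      Sec.vert θ ≫ (Sec.Hom.mk (s := ⟨a, σ'⟩) (t := ⟨a', τ'⟩) b α' :
        (⟨a, σ'⟩ : Sec p X) ⟶ ⟨a', τ'⟩) := by
  refine Sec.hom_ext_ev (s := ⟨a, σ⟩) (t := ⟨a', τ'⟩) _ _
    ((Category.comp_id b).trans (Category.id_comp b).symm)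
    fun (z : Over a) (z' : Over a') k w w' => ?_
  have w₀ : k ≫ z'.hom = z.hom ≫ b := w'.trans (congrArg (z.hom ≫ ·) (Category.id_comp b))
  let f : (Over.map b).obj z ⟶ z' := Over.homMk k w₀
  refine (Sec.ev_comp (Sec.Hom.mk (s := ⟨a, σ⟩) (t := ⟨a', τ⟩) b α) (Sec.vert κ) (z := z)
    (z' := (Over.map b).obj z) (z'' := z') (𝟙 z.left) (Category.id_comp _) k
    (w₀.trans (Category.comp_id _).symm) k w (Category.id_comp k)).symm.trans ?_
  refine Eq.trans ?_ (Sec.ev_comp (Sec.vert θ) (Sec.Hom.mk (s := ⟨a, σ'⟩) (t := ⟨a', τ'⟩) b α')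
    (z := z) (z' := z) (z'' := z') (𝟙 z.left)
    ((Category.id_comp _).trans (Category.comp_id _).symm) k w₀ k w' (Category.id_comp k))
  refine (congrArg₂ (· ≫ ·) (Sec.ev_map_id (Sec.Hom.mk (s := ⟨a, σ⟩) (t := ⟨a', τ⟩) b α) z _)
    (Sec.vert_ev κ (z := (Over.map b).obj z) (z' := z') k _ f rfl)).trans ?_
  refine Eq.trans ?_ (congrArg (· ≫ _) ((Sec.vert_ev θ (z := z) (z' := z) (𝟙 z.left) _ (𝟙 z)
    rfl).trans ((congrArg (θ.toNatTrans.app z ≫ ·) (σ'.map_id z)).trans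
      (Category.comp_id _)))).symm
  refine (Category.assoc _ _ _).symm.trans ((congrArg (· ≫ τ'.map f) (h z)).trans ?_)
  exact Category.assoc _ _ _

theorem Sec.vert_comp {a : A} {σ τ ρ : BasedFunctor (sumBased p (yoBased a)) X} (θ : σ ⟶ τ)
    (κ : τ ⟶ ρ) : Sec.vert (θ ≫ κ) = Sec.vert θ ≫ Sec.vert κ := by
  -- With `b = 𝟙 a` the upper arrow of the square is `Sec.vert θ` and the lower one is an identity,
  -- by definition.
  have h := Sec.vert_naturality (𝟙 a) (θ ≫ BasedCategory.whiskerRight (sumTrans p (yoMapId a)) τ)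
    (BasedCategory.whiskerRight (sumTrans p (yoMapId a)) ρ) (θ ≫ κ) κ fun z => by
      refine (Category.assoc _ _ _).trans (Eq.trans ?_ (Category.assoc _ _ _).symm)
      exact congrArg (θ.toNatTrans.app z ≫ ·) (κ.toNatTrans.naturality (overId z))
  exact ((Category.comp_id _).symm.trans h.symm).trans rfl

/-- Sections with a fixed base. -/
def Sec.vertFunctor (p : A ⥤ B) (X : BasedCategory.{v₂, u₂} B) (a : A) :
    BasedFunctor (sumBased p (yoBased a)) X ⥤ Sec p X where
  obj σ := ⟨a, σ⟩
  map θ := Sec.vert θ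
  map_id σ := Sec.vert_id σ
  map_comp θ κ := Sec.vert_comp θ κ

end

/-! ### The comparison underlying the factorisation. -/

section

variable {P : Type u} [Category.{v} P] {Q : Type u₁} [Category.{v₁} Q] (h : P ⥤ Q)
  [hh : h.IsFibered] {X : BasedCategory.{v₂, u₂} Q} {Y : BasedCategory.{v₂, u₂} Q}

/-- The section of the base change along `h` given by evaluation at identities. -/
def OplObj.evalPair {h : P ⥤ Q} [hh : h.IsFibered] (s : OplObj h (cofree X)) :
    Sec (𝟭 P) (baseChange h X) :=
  ⟨s.base, pairFunctor (Z := yoBased s.base) (s.sec.toBased.comp (cofreeCounit X))⟩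

/-- The action of `OplObj.evalPair` on arrows. -/
def OplObj.evalPairMap {h : P ⥤ Q} [hh : h.IsFibered] {s t : OplObj h (cofree X)} (α : s ⟶ t) :
    s.evalPair ⟶ t.evalPair :=
  Sec.Hom.mk (s := s.evalPair) (t := t.evalPair) (Sec.Hom.base (s := s.toSec) (t := t.toSec) α)
    (pairTrans (Z := yoBased s.base) (BasedCategory.whiskerRight
      (Sec.Hom.trans (s := s.toSec) (t := t.toSec) α) (cofreeCounit X)))

/-- Over a fixed base arrow, `OplObj.evalPairMap` is co-free transposition for the fibration `Σ_h
(P/a)`, followed by pairing. Base change transposition undoes the pairing. -/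
theorem OplObj.evalPairMap_injective {h : P ⥤ Q} [hh : h.IsFibered] {s t : OplObj h (cofree X)} :
    Function.Injective (OplObj.evalPairMap (s := s) (t := t)) := by
  rintro ⟨a, α⟩ ⟨b, β⟩ e
  obtain rfl : a = b := congrArg Sec.Hom.base e
  have e' := congrArg (fun m => (baseChangeTranspose h (yoBased s.base) X).map m)
    (eq_of_heq (Sec.Hom.mk.inj e).2)
  have := cofreeTranspose_faithful (oplaxSum h (yo s.base)) X
  exact congrArg (Sec.Hom.mk a) ((cofreeTranspose (oplaxSum h (yo s.base)) X).map_injective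
    (X := s.sec) (Y := (oplaxSumFunctor h (yoFib a)).comp t.sec) e')

/-- Fullness of co-free transposition supplies a preimage of the arrow carried to `Q`; faithfulness
of base change transposition shows that it maps to the given arrow over `P`. -/
theorem OplObj.evalPairMap_surjective {h : P ⥤ Q} [hh : h.IsFibered] {s t : OplObj h (cofree X)} :
    Function.Surjective (OplObj.evalPairMap (s := s) (t := t)) := by
  rintro ⟨a, τ⟩
  have := cofreeTranspose_full (oplaxSum h (yo s.base)) X
  have := baseChangeTranspose_faithful h (yoBased s.base) X
  obtain ⟨α, hα⟩ := (cofreeTranspose (oplaxSum h (yo s.base)) X).map_surjective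
    (X := s.sec) (Y := (oplaxSumFunctor h (yoFib a)).comp t.sec)
    ((baseChangeTranspose h (yoBased s.base) X).map τ)
  refine ⟨⟨a, α⟩, congrArg (Sec.Hom.mk (s := s.evalPair) (t := t.evalPair) a)
    ((baseChangeTranspose h (yoBased s.base) X).map_injective ?_)⟩
  exact hα

theorem OplObj.evalPairMap_comp {h : P ⥤ Q} [hh : h.IsFibered] {s t r : OplObj h (cofree X)}
    (α : s ⟶ t) (β : t ⟶ r) :
    OplObj.evalPairMap (α ≫ β) = OplObj.evalPairMap α ≫ OplObj.evalPairMap β := by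
  refine congrArg (Sec.Hom.mk (s := s.evalPair) (t := r.evalPair)
    (Sec.Hom.base (s := s.toSec) (t := r.toSec) (α ≫ β))) ?_
  apply BasedNatTrans.ext
  ext x
  refine PullObj.Hom.ext ?_ ?_
  · exact ((Category.id_comp _).trans (Category.id_comp _)).symm
  · exact ((cofreeCounit X).map_comp _ _).trans
      (congrArg ((cofreeCounit X).map _ ≫ ·) ((cofreeCounit X).map_comp _ _))

theorem OplObj.evalPairMap_lift {h : P ⥤ Q} [hh : h.IsFibered] (s : OplObj h (cofree X)) {a : P}
    (f : a ⟶ s.base) : OplObj.evalPairMap (s.lift f) = s.evalPair.lift f := by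
  refine congrArg (Sec.Hom.mk (s := s.evalPair.restrict f) (t := s.evalPair) f) ?_
  apply BasedNatTrans.ext
  ext x
  exact PullObj.Hom.ext rfl ((cofreeCounit X).map_id _)

variable (X) in
/-- The comparison from the oplax base change of the co-free fibred category to the co-free fibred
category on the base change. -/
def evalPairFib : FibFunctor (oplaxBaseChange h (cofree X)) (cofree (baseChange h X)) where
  toBased :=
    { obj := fun s : OplObj h (cofree X) => s.evalPair
      map := fun {s t : OplObj h (cofree X)} α => OplObj.evalPairMap (s := s) (t := t) α
      map_id := fun s => rfl
      map_comp := fun {s t r : OplObj h (cofree X)} α β =>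
        OplObj.evalPairMap_comp (s := s) (t := t) (r := r) α β
      w := rfl }
  cart := PreservesCartesian.of_lifts _ fun (s : OplObj h (cofree X)) R f =>
    ⟨s.restrict f, s.lift f, toCart (s.lift_isStronglyCartesian f), by
      have h : (Sec.proj (𝟭 P) (baseChange h X)).IsCartesian (R := R) f
          (OplObj.evalPairMap (s.lift f)) := by
        rw [OplObj.evalPairMap_lift s f]
        exact toCart (s.evalPair.lift_isStronglyCartesian f)
      exact h⟩

end

section

variable {P : Type u} [Category.{v} P] {Q : Type u} [Category.{v} Q] (h : P ⥤ Q)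
  [hh : h.IsFibered] {X : BasedCategory.{v₂, u₂} Q} {Y : BasedCategory.{v₂, u₂} Q}

-- Essential surjectivity on the fibre over `a` comes from the two transposition equivalences for
-- `Σ_h (P/a)`. The common universes of `P` and `Q` put both fibrations in one 2-category.
variable (X) in
theorem evalPairFib_exists_equivalence :
    ∃ e : oplaxBaseChange h (cofree X) ≌ cofree (baseChange h X), e.hom = evalPairFib h X :=
  FibFunctor.exists_equivalence (evalPairFib h X)
    ⟨fun {s t} α => OplObj.evalPairMap_surjective (s := s) (t := t) α⟩
    ⟨fun {s t} _ _ e => OplObj.evalPairMap_injective (s := s) (t := t) e⟩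
    fun s : Sec (𝟭 P) (baseChange h X) => by
      have := cofreeTranspose_isEquivalence (oplaxSum h (yo s.base)) X
      have := baseChangeTranspose_isEquivalence h (yoBased s.base) X
      let f : BasedFunctor (sumBased h (yoBased s.base)) X :=
        (baseChangeTranspose h (yoBased s.base) X).obj s.sec
      let φ : FibFunctor (oplaxSum h (yo s.base)) (cofree X) :=
        (cofreeTranspose (oplaxSum h (yo s.base)) X).objPreimage f
      -- Transposing a paired functor returns it definitionally, so the isomorphism chosen for `φ`
      -- has this type; `e₂` is its lift along the fully faithful base change transposition.
      let e₁ : (baseChangeTranspose h (yoBased s.base) X).obj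
          (pairFunctor (φ.toBased.comp (cofreeCounit X))) ≅
          (baseChangeTranspose h (yoBased s.base) X).obj s.sec :=
        (cofreeTranspose (oplaxSum h (yo s.base)) X).objObjPreimageIso f
      let e₂ := (baseChangeTranspose h (yoBased s.base) X).preimageIso e₁
      exact ⟨(⟨s.base, φ⟩ : OplObj h (cofree X)),
        (Sec.vertFunctor (𝟭 P) (baseChange h X) s.base).mapIso e₂,
        IsHomLift.map (Sec.proj (𝟭 P) (baseChange h X)) (Sec.vert e₂.hom)⟩

end

/-! ### Pseudonaturality of the factorisation. -/

/-- The isomorphism of functors to the base change given by an isomorphism of functors. -/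
def pairIso {P : Type u} [Category.{v} P] {Q : Type u₁} [Category.{v₁} Q] {h : P ⥤ Q}
    {Z : BasedCategory.{v₃, u₃} P} {X : BasedCategory.{v₂, u₂} Q}
    {f g : BasedFunctor (sumBased h Z) X} (e : f ≅ g) : pairFunctor f ≅ pairFunctor g where
  hom := pairTrans e.hom
  inv := pairTrans e.inv
  hom_inv_id := (pairTrans_comp _ _).symm.trans
    ((congrArg pairTrans e.hom_inv_id).trans (pairTrans_id _))
  inv_hom_id := (pairTrans_comp _ _).symm.trans
    ((congrArg pairTrans e.inv_hom_id).trans (pairTrans_id _))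

/-- Whiskering an isomorphism of functors over the base. -/
def basedWhiskerLeftIso {B : Type u₁} [Category.{v₁} B] {X : BasedCategory.{v₂, u₂} B}
    {Y : BasedCategory.{v₃, u₃} B} {Z : BasedCategory.{v₄, u₄} B} (F : BasedFunctor X Y)
    {G H : BasedFunctor Y Z} (e : G ≅ H) : F.comp G ≅ F.comp H where
  hom := BasedCategory.whiskerLeft F e.hom
  inv := BasedCategory.whiskerLeft F e.inv
  hom_inv_id := by
    apply BasedNatTrans.ext
    ext x
    exact congrArg (fun m => m.toNatTrans.app (F.obj x)) e.hom_inv_id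
  inv_hom_id := by
    apply BasedNatTrans.ext
    ext x
    exact congrArg (fun m => m.toNatTrans.app (F.obj x)) e.inv_hom_id

section

variable {P : Type u} [Category.{v} P] {Q : Type u₁} [Category.{v₁} Q] (h : P ⥤ Q)
  [hh : h.IsFibered] {X : BasedCategory.{v₂, u₂} Q} {Y : BasedCategory.{v₂, u₂} Q}

/-- Evaluation at identities of a section is natural for functors over the base. -/
def evalPairSecIso (F : BasedFunctor X Y) (s : OplObj h (cofree X)) :
    (pairFunctor (Z := yoBased s.base)
      ((s.sec.toBased.comp (cofreeMap F).toBased).comp (cofreeCounit Y)) :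
        BasedFunctor (yoBased s.base) (baseChange h Y)) ≅
    (pairFunctor (Z := yoBased s.base)
      (s.sec.toBased.comp (cofreeCounit X))).comp (baseChangeMap h F) :=
  pairIso (Z := yoBased s.base) (basedWhiskerLeftIso s.sec.toBased (cofreeCounitIso F))

theorem evalPairSecIso_isEqTo (F : BasedFunctor X Y) (s : OplObj h (cofree X)) :
    IsEqTo (evalPairSecIso h F s).hom :=
  IsEqTo.based_of_app _ fun _ => ⟨rfl, rfl⟩

/-- By `Sec.vert_naturality` only components matter, and there the claim is naturality of
`cofreeCounitIso` at the components of `α`. -/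
theorem evalPairMap_naturality (F : BasedFunctor X Y) {s t : OplObj h (cofree X)} (α : s ⟶ t) :
    ((oplaxBaseChangeMap h (cofreeMap F)).comp (evalPairFib h Y)).toBased.map α ≫
      Sec.vert (evalPairSecIso h F t).hom =
    Sec.vert (evalPairSecIso h F s).hom ≫
      ((evalPairFib h X).comp (cofreeMap (baseChangeMap h F))).toBased.map α := by
  refine Sec.vert_naturality (Sec.Hom.base (s := s.toSec) (t := t.toSec) α) _ _ _ _ fun z => ?_
  refine PullObj.Hom.ext ?_ ?_
  · rfl
  · exact ((cofreeCounitIso F).hom.toNatTrans.naturality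
      ((Sec.Hom.trans (s := s.toSec) (t := t.toSec) α).toNatTrans.app z))

/-- The comparison is natural for functors over the base. -/
def evalPairNat (F : BasedFunctor X Y) :
    (oplaxBaseChangeMap h (cofreeMap F)).comp (evalPairFib h Y) ≅
      (evalPairFib h X).comp (cofreeMap (baseChangeMap h F)) :=
  BasedNatIso.toFib (BasedNatIso.mkNatIso
    (NatIso.ofComponents (fun s : OplObj h (cofree X) =>
      (Sec.vertFunctor (𝟭 P) (baseChange h Y) s.base).mapIso (evalPairSecIso h F s))
      fun {s t : OplObj h (cofree X)} α => evalPairMap_naturality h F α)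
    fun s : OplObj h (cofree X) =>
      IsHomLift.map (Sec.proj (𝟭 P) (baseChange h Y)) (Sec.vert (evalPairSecIso h F s).hom))

theorem evalPairNat_isEqTo (F : BasedFunctor X Y) : IsEqTo (evalPairNat h F).hom :=
  IsEqTo.fib_of_app _ fun s : OplObj h (cofree X) =>
    (evalPairSecIso_isEqTo h F s).map (Sec.vertFunctor (𝟭 P) (baseChange h Y) s.base)

/-- Presents whiskering by `θ` as a vertical arrow, so that the 2-cell condition becomes an equation
of transformations over a fixed slice. -/
theorem evalPairMap_postTrans {F G : BasedFunctor X Y} (θ : F ⟶ G) (s : OplObj h (cofree X)) :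
    OplObj.evalPairMap (s := OplObj.postObj (cofreeMap F) s) (t := OplObj.postObj (cofreeMap G) s)
      (Sec.postTrans (cofreeMap₂ θ) s.toSec) =
    Sec.vert (X := baseChange h Y) (pairTrans (Z := yoBased s.base)
      (f := (s.sec.toBased.comp (cofreeMap F).toBased).comp (cofreeCounit Y))
      (g := (s.sec.toBased.comp (cofreeMap G).toBased).comp (cofreeCounit Y))
      (BasedCategory.whiskerRight (F := s.sec.toBased.comp (cofreeMap F).toBased)
        (G := s.sec.toBased.comp (cofreeMap G).toBased)
        (BasedCategory.whiskerLeft s.sec.toBased (G := (cofreeMap F).toBased)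
          (H := (cofreeMap G).toBased) (cofreeMap₂ θ)) (cofreeCounit Y))) := by
  refine congrArg (Sec.Hom.mk (s := (OplObj.postObj (cofreeMap F) s).evalPair)
    (t := (OplObj.postObj (cofreeMap G) s).evalPair) (𝟙 s.base)) ?_
  apply BasedNatTrans.ext
  ext x
  refine PullObj.Hom.ext ?_ ?_
  · exact (Category.id_comp _).symm
  · exact (cofreeCounit Y).map_comp _ _

theorem evalPairSecIso_naturality {F G : BasedFunctor X Y} (θ : F ⟶ G)
    (s : OplObj h (cofree X)) :
    pairTrans (Z := yoBased s.base)
      (f := (s.sec.toBased.comp (cofreeMap F).toBased).comp (cofreeCounit Y))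
      (g := (s.sec.toBased.comp (cofreeMap G).toBased).comp (cofreeCounit Y))
      (BasedCategory.whiskerRight (F := s.sec.toBased.comp (cofreeMap F).toBased)
        (G := s.sec.toBased.comp (cofreeMap G).toBased)
        (BasedCategory.whiskerLeft s.sec.toBased (G := (cofreeMap F).toBased)
          (H := (cofreeMap G).toBased) (cofreeMap₂ θ)) (cofreeCounit Y)) ≫
      (evalPairSecIso h G s).hom =
    (evalPairSecIso h F s).hom ≫
      BasedCategory.whiskerLeft (pairFunctor (Z := yoBased s.base)
        (s.sec.toBased.comp (cofreeCounit X))) (baseChangeMap₂ h θ) := by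
  apply BasedNatTrans.ext
  ext x
  refine PullObj.Hom.ext rfl ?_
  exact congrArg (fun m => m.toNatTrans.app (s.sec.toBased.obj x)) (cofreeCounitIso_naturality θ)

theorem evalPairNat_naturality {F G : BasedFunctor X Y} (θ : F ⟶ G) :
    CategoryStruct.comp (obj := FibFunctor (oplaxBaseChange h (cofree X))
        (cofree (baseChange h Y)))
      (X := (oplaxBaseChangeMap h (cofreeMap F)).comp (evalPairFib h Y))
      (Y := (oplaxBaseChangeMap h (cofreeMap G)).comp (evalPairFib h Y))
      (BasedCategory.whiskerRight (F := (oplaxBaseChangeMap h (cofreeMap F)).toBased)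
        (G := (oplaxBaseChangeMap h (cofreeMap G)).toBased)
        (oplaxBaseChangeMap₂ h (cofreeMap₂ θ)) (evalPairFib h Y).toBased)
      (evalPairNat h G).hom =
    CategoryStruct.comp (obj := FibFunctor (oplaxBaseChange h (cofree X))
        (cofree (baseChange h Y)))
      (Y := (evalPairFib h X).comp (cofreeMap (baseChangeMap h F)))
      (Z := (evalPairFib h X).comp (cofreeMap (baseChangeMap h G)))
      (evalPairNat h F).hom
      (BasedCategory.whiskerLeft (evalPairFib h X).toBased
        (G := (cofreeMap (baseChangeMap h F)).toBased)
        (H := (cofreeMap (baseChangeMap h G)).toBased) (cofreeMap₂ (baseChangeMap₂ h θ))) := by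
  apply BasedNatTrans.ext
  ext (s : OplObj h (cofree X))
  -- Functoriality of `Sec.vert` carries the equation over the slice to arrows of sections.
  have e := (congrArg (· ≫ Sec.vert (evalPairSecIso h G s).hom)
    (evalPairMap_postTrans h θ s)).trans ((Sec.vert_comp _ _).symm.trans
      ((congrArg Sec.vert (evalPairSecIso_naturality h θ s)).trans (Sec.vert_comp _ _)))
  exact e

end

section

variable {P : Type u} [Category.{v} P] {Q : Type u} [Category.{v} Q] (h : P ⥤ Q) [hh : h.IsFibered]

/-- The comparison from the oplax base change of the co-free fibred category to the co-free fibred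
category on the base change, as a pseudonatural transformation. -/
def evalPairStrongTrans : Pseudofunctor.StrongTrans
    ((cofreePseudo.{v₂, u₂} Q).comp (oplaxBaseChangePseudo h))
    ((baseChangePseudo.{v₂, u₂} h).comp (cofreePseudo P)) :=
  strongTransOfStrict
    (cofreePseudo_isStrictPseudo.comp (oplaxBaseChangePseudo_isStrictPseudo h))
    ((baseChangePseudo_isStrictPseudo h).comp cofreePseudo_isStrictPseudo)
    (fun X => evalPairFib h X)
    (fun F => evalPairNat h F)
    (fun F => evalPairNat_isEqTo h F)
    (fun θ => evalPairNat_naturality h θ)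

theorem pseudoEquiv_oplaxBaseChange_cofree : PseudoEquiv
    ((cofreePseudo.{v₂, u₂} Q).comp (oplaxBaseChangePseudo h))
    ((baseChangePseudo.{v₂, u₂} h).comp (cofreePseudo P)) :=
  ⟨evalPairStrongTrans h, fun X => evalPairFib_exists_equivalence h X⟩

end

end HSLift

theorem mainTheorem7 :
    -- the co-free construction is right adjoint to the forgetful functor
    (∀ (P : Type u) [Category.{v} P] (F : FibCat.{v₃, u₃} P) (X : BasedCategory.{v₂, u₂} P),
      (cofreeTranspose F X).IsEquivalence) ∧
    -- the saturation pseudo-adjunction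
    (∀ (P : Type u) [Category.{v} P] (Q : Type u₁) [Category.{v₁} Q] (h : P ⥤ Q)
      (F : FibCat.{v₃, u₃} P) (X : BasedCategory.{v₂, u₂} Q),
      (saturationTranspose h F X).IsEquivalence) ∧
    -- the factorisation through oplax base change along a fibration
    (∀ (P Q : Type u) [Category.{v} P] [Category.{v} Q] (h : P ⥤ Q) [h.IsFibered],
      PseudoEquiv
        ((cofreePseudo.{v₂, u₂} Q).comp (oplaxBaseChangePseudo h))
        ((baseChangePseudo.{v₂, u₂} h).comp (cofreePseudo P))) ∧
    -- the co-free construction over the point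
    PseudoEquiv
      ((cofreePseudo.{v₂, max u₂ v₂} Pt).comp (forgetPseudo Pt))
      (Pseudofunctor.id (BasedCategory.{v₂, max u₂ v₂} Pt)) ∧
    -- saturation agrees with oplax base change over the point
    (∀ (C : Type u) [Category.{v} C],
      PseudoEquiv
        (catToFib.{v₂, u₂}.comp ((forgetPseudo Pt).comp
          ((baseChangePseudo (Functor.star C)).comp (cofreePseudo C))))
        (catToFib.{v₂, u₂}.comp (oplaxBaseChangePseudo (Functor.star C)))) := by
  exact ⟨fun P _ F X => cofreeTranspose_isEquivalence F X,
    fun P _ Q _ h F X => saturationTranspose_isEquivalence h F X,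
    fun P Q _ _ h _ => pseudoEquiv_oplaxBaseChange_cofree h,
    pseudoEquiv_cofree_pt.{v₂, u₂},
    fun C _ => pseudoEquiv_saturation_oplaxBaseChange_pt C⟩
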